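/- **Setting.** Let $N\ge 1$ and $Z_N=\mathbb C[\Gamma]/(\Gamma^N)$. Let $\mathcal A$ be the ring of formal power series in $\epsilon$ whose coefficients are differential polynomials in $u_i,v_i$ ($0\le i<N$) and $e^{\pm v_0}$. Put $\partial=\partial_x$, $\Lambda=e^{\epsilon\partial}$, $u=\sum_i u_i\Gamma^i$, $v=\sum_i v_i\Gamma^i$ (elements of $Z_N\otimes\mathcal A$), and $\mathrm{Tr}_N\big(\sum_i a_i\Gamma^i\big)=\sum_i a_i$, which is the trace of the product of the matrix $\sum_i a_i\Gamma^i$ with the upper triangular Toeplitz matrix of first row $(\frac1N,\frac1{N-1},\dots,1)$. For $A=\sum_k A_k\Lambda^k$ put $\mathrm{Res}\,A=A_0$ and $A_+=\sum_{k\ge0}A_k\Lambda^k$. Let $\mathcal L=\Lambda+u+e^v\Lambda^{-1}$ and $c_j=\sum_{i=1}^j\frac1i$. The logarithm is $\log\mathcal L=\frac12\big(S\,\epsilon\partial\,S^{-1}-\bar S\,\epsilon\partial\,\bar S^{-1}\big)$, where $S=1+\omega_1\Lambda^{-1}+\cdots$ and $\bar S=\bar\omega_0+\bar\omega_1\Lambda+\cdots$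 (with $\bar\omega_0$ invertible) are dressing operators, $\mathcal L=S\Lambda S^{-1}=\bar S\Lambda^{-1}\bar S^{-1}$. Their coefficients are $Z_N$-valued formal functions of the position near a base point: with the position written as $x+\epsilon X$, they are power series in $\epsilon$ over $B[X,e^{\pm Xv_0}]$, where $B$ is the ring of differential polynomials at the base point; $\epsilon\partial$ acts as $d/dX$ and $\Lambda$ as $X\mapsto X+1$, and an element $f\in\mathcal A$ is the function $\sum_k(\epsilon X)^k\partial^kf/k!$. The flows $t_{0,j}=t_j$ and $t_{1,j}=s_j$ ($j\ge0$) of the extended $Z_N$-Toda hierarchy (EZTH) are $$\epsilon\,\frac{\partial\mathcal L}{\partial t_{k,j}}=[(B_{k,j})_+,\mathcal L],\qquad B_{0,j}=\frac{\mathcal L^{j+1}}{(j+1)!},\qquad B_{1,j}=\frac{2}{j!}\,\mathcal L^j(\log\mathcal L-c_j).$$ For $H=\int h\,dx$, $h\in\mathcal A$, and $w\in\{u,v\}$, let $\frac{\delta H}{\delta w}\in Z_N\otimes\mathcal A$ be the $Z_N$-valued variational derivative, i.e. the element with $\mathrm{Tr}_N\big(A\,\frac{\delta H}{\delta w}\big)=\sum_iA_i\sum_{k\ge0}(-\partial)^k\frac{\partial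 h}{\partial w_i^{(k)}}$ for all $A=\sum_iA_i\Gamma^i$. The two brackets $\{\cdot,H\}_1$ and $\{\cdot,H\}_2$ are the evolutionary vector fields (derivations of $\mathcal A$ commuting with $\partial$ and $\epsilon$-linear) with $$\{u,H\}_1=\tfrac1\epsilon(\Lambda-1)\tfrac{\delta H}{\delta v},\qquad \{v,H\}_1=\tfrac1\epsilon(1-\Lambda^{-1})\tfrac{\delta H}{\delta u},$$ $$\{u,H\}_2=\tfrac1\epsilon\Big[(\Lambda e^v-e^v\Lambda^{-1})\tfrac{\delta H}{\delta u}+u(\Lambda-1)\tfrac{\delta H}{\delta v}\Big],\qquad \{v,H\}_2=\tfrac1\epsilon\Big[(1-\Lambda^{-1})\Big(u\,\tfrac{\delta H}{\delta u}\Big)+(\Lambda-\Lambda^{-1})\tfrac{\delta H}{\delta v}\Big],$$ where $\{w,H\}=\sum_i\{w_i,H\}\Gamma^i$. **Theorem.** Dressing operators exist, and $\log\mathcal L$ has coefficients in $Z_N\otimes\mathcal A$, which do not depend on the choice of the dressing operators. For $k\in\{0,1\}$ and $j\ge0$ let $H_{k,j}=\int h_{k,j}\,dx$ with $$h_{0,j}=\frac1{(j+1)!}\,\mathrm{Tr}_N\,\mathrm{Res}\,\mathcal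 L^{j+1},\qquad h_{1,j}=\frac2{j!}\,\mathrm{Tr}_N\,\mathrm{Res}\big[\mathcal L^j(\log\mathcal L-c_j)\big].$$ 1. For all $k\in\{0,1\}$ and $j\ge0$ the flow $t_{k,j}$ is a well-defined evolutionary vector field on $\mathcal A$, and it is Hamiltonian with respect to the first bracket: for $0\le i<N$, $$\frac{\partial u_i}{\partial t_{k,j}}=\{u_i,H_{k,j+1}\}_1,\qquad \frac{\partial v_i}{\partial t_{k,j}}=\{v_i,H_{k,j+1}\}_1 .$$ 2. For all $n\ge0$ the bi-Hamiltonian recursion relations hold: $$\{\cdot,H_{1,n}\}_2=n\,\{\cdot,H_{1,n+1}\}_1+2\,\{\cdot,H_{0,n}\}_1,\qquad \{\cdot,H_{0,n}\}_2=(n+1)\,\{\cdot,H_{0,n+1}\}_1 .$$ -/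

import Mathlib

/-!
# Definitions for the extended `Z_N`-Toda hierarchy

Everything is done in formal variational calculus: `u_i`, `v_i` and their `x`-derivatives are
independent jet variables, `ε` is a formal parameter, `Λ = e^{ε∂}`.
-/

noncomputable section

namespace EZTH

open Finset

/-! ## The algebra `Z_N(R) = R[Γ]/(Γ^N)` -/

/-- `Z_N(R) = R[Γ]/(Γ^N)`: the element `∑ i, a_i Γ^i` is represented by its coefficients. -/
@[ext]
structure ZN (N : ℕ) (R : Type*) where
  /-- The components `a_i`. -/
  coeff : Fin N → R

namespace ZN

variable {N : ℕ} {R : Type*}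

/-- The coefficients of an element of `Z_N(R)`, continued by zero. -/
def ext0 [Zero R] (a : ZN N R) (n : ℕ) : R := if h : n < N then a.coeff ⟨n, h⟩ else 0

/-- The class modulo `Γ^N` of a power series in `Γ`. -/
def ofPS [Semiring R] (p : PowerSeries R) : ZN N R := ⟨fun i => PowerSeries.coeff (i : ℕ) p⟩

theorem coeff_injective : Function.Injective (coeff : ZN N R → Fin N → R) :=
  fun _ _ h => ZN.ext h

instance [Zero R] : Zero (ZN N R) := ⟨⟨0⟩⟩

instance [Add R] : Add (ZN N R) := ⟨fun a b => ⟨a.coeff + b.coeff⟩⟩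

instance [Neg R] : Neg (ZN N R) := ⟨fun a => ⟨-a.coeff⟩⟩

instance [Sub R] : Sub (ZN N R) := ⟨fun a b => ⟨a.coeff - b.coeff⟩⟩

instance {S : Type*} [SMul S R] : SMul S (ZN N R) := ⟨fun s a => ⟨s • a.coeff⟩⟩

instance [AddCommGroup R] : AddCommGroup (ZN N R) :=
  Function.Injective.addCommGroup coeff coeff_injective rfl (fun _ _ => rfl) (fun _ => rfl)
    (fun _ _ => rfl) (fun _ _ => rfl) (fun _ _ => rfl)

/-- `coeff` as an additive homomorphism. -/
def coeffHom [AddCommGroup R] : ZN N R →+ (Fin N → R) where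
  toFun := coeff
  map_zero' := rfl
  map_add' := fun _ _ => rfl

instance {S : Type*} [Semiring S] [AddCommGroup R] [Module S R] : Module S (ZN N R) :=
  Function.Injective.module S coeffHom coeff_injective (fun _ _ => rfl)

/-- `Γ^i Γ^j = Γ^(i+j)`, and `Γ^k = 0` for `k ≥ N`. -/
instance [Semiring R] : Mul (ZN N R) :=
  ⟨fun a b => ⟨fun k => ∑ p ∈ antidiagonal (k : ℕ), a.ext0 p.1 * b.ext0 p.2⟩⟩

instance [Semiring R] : One (ZN N R) := ⟨⟨fun i => if (i : ℕ) = 0 then 1 else 0⟩⟩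

theorem mul_coeff [Semiring R] (a b : ZN N R) (k : Fin N) :
    (a * b).coeff k = ∑ p ∈ antidiagonal (k : ℕ), a.ext0 p.1 * b.ext0 p.2 := rfl

theorem ofPS_surjective [Semiring R] :
    Function.Surjective (ofPS : PowerSeries R → ZN N R) := by
  intro a
  refine ⟨PowerSeries.mk a.ext0, ?_⟩
  ext i
  simp [ofPS, ext0]

theorem ofPS_add [Ring R] (p q : PowerSeries R) :
    (ofPS (p + q) : ZN N R) = ofPS p + ofPS q := by
  ext i
  exact map_add _ p q

theorem ofPS_zero [Ring R] : (ofPS (0 : PowerSeries R) : ZN N R) = 0 := by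
  ext i
  exact map_zero _

theorem ofPS_one [Semiring R] : (ofPS (1 : PowerSeries R) : ZN N R) = 1 := by
  ext i
  exact PowerSeries.coeff_one _

theorem ofPS_mul [Semiring R] (p q : PowerSeries R) :
    (ofPS (p * q) : ZN N R) = ofPS p * ofPS q := by
  ext i
  rw [mul_coeff]
  change PowerSeries.coeff (i : ℕ) (p * q) = _
  rw [PowerSeries.coeff_mul]
  refine Finset.sum_congr rfl fun r hr => ?_
  have h := mem_antidiagonal.1 hr
  have h1 : r.1 < N := by have := i.2; omega
  have h2 : r.2 < N := by have := i.2; omega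
  simp [ext0, ofPS, h1, h2]

instance [CommRing R] : CommRing (ZN N R) :=
  { (inferInstance : AddCommGroup (ZN N R)),
    (inferInstance : Mul (ZN N R)),
    (inferInstance : One (ZN N R)) with
    mul_assoc := fun a b c => by
      obtain ⟨a, rfl⟩ := ofPS_surjective a
      obtain ⟨b, rfl⟩ := ofPS_surjective b
      obtain ⟨c, rfl⟩ := ofPS_surjective c
      simp only [← ofPS_mul, mul_assoc]
    mul_comm := fun a b => by
      obtain ⟨a, rfl⟩ := ofPS_surjective a
      obtain ⟨b, rfl⟩ := ofPS_surjective b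
      rw [← ofPS_mul, ← ofPS_mul, mul_comm]
    one_mul := fun a => by
      obtain ⟨a, rfl⟩ := ofPS_surjective a
      rw [← ofPS_one, ← ofPS_mul, one_mul]
    mul_one := fun a => by
      obtain ⟨a, rfl⟩ := ofPS_surjective a
      rw [← ofPS_one, ← ofPS_mul, mul_one]
    zero_mul := fun a => by
      obtain ⟨a, rfl⟩ := ofPS_surjective a
      rw [← ofPS_zero, ← ofPS_mul, zero_mul]
    mul_zero := fun a => by
      obtain ⟨a, rfl⟩ := ofPS_surjective a
      rw [← ofPS_zero, ← ofPS_mul, mul_zero]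
    left_distrib := fun a b c => by
      obtain ⟨a, rfl⟩ := ofPS_surjective a
      obtain ⟨b, rfl⟩ := ofPS_surjective b
      obtain ⟨c, rfl⟩ := ofPS_surjective c
      simp only [← ofPS_mul, ← ofPS_add, mul_add]
    right_distrib := fun a b c => by
      obtain ⟨a, rfl⟩ := ofPS_surjective a
      obtain ⟨b, rfl⟩ := ofPS_surjective b
      obtain ⟨c, rfl⟩ := ofPS_surjective c
      simp only [← ofPS_mul, ← ofPS_add, add_mul] }

/-- Coefficientwise application of a map. -/
def map {S : Type*} (g : R → S) (a : ZN N R) : ZN N S := ⟨fun i => g (a.coeff i)⟩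

/-- The matrix `∑ i, a i • Γ^i`, where `Γ = (δ_{i,j+1})`. -/
def toMatrix [Zero R] (a : ZN N R) : Matrix (Fin N) (Fin N) R :=
  fun i j => if (j : ℕ) ≤ i then a.ext0 ((i : ℕ) - (j : ℕ)) else 0

/-- The upper triangular Toeplitz matrix with first row `1/N, 1/(N-1), …, 1`. -/
def trMatrix (N : ℕ) (R : Type*) [CommRing R] [Algebra ℂ R] : Matrix (Fin N) (Fin N) R :=
  fun i j => if (i : ℕ) ≤ j then algebraMap ℂ R (1 / ((N : ℂ) - ((j : ℂ) - (i : ℂ)))) else 0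

/-- `Tr_N`. -/
def tr [CommRing R] [Algebra ℂ R] (a : ZN N R) : R :=
  Matrix.trace (trMatrix N R * a.toMatrix)

/-- The element `g` of `Z_N(R)` with `Tr_N (A * g) = ∑ i, A_i e_i` for all `A`, see
`tr_mul_ofPairing`: its components are `g_m = e_{N-1-m} - e_{N-m}`, where `e_N = 0`. -/
def ofPairing [CommRing R] (e : Fin N → R) : ZN N R :=
  ⟨fun m => e (Fin.rev m)
    - if h : (m : ℕ) = 0 then 0 else e ⟨N - m, by have := m.2; omega⟩⟩

end ZN

/-! ## Differential polynomials -/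

/-- Jet variables: `(w, i, k)` stands for `∂^k u_i` if `w = 0` and for `∂^k v_i` if `w = 1`. -/
abbrev Jet (N : ℕ) : Type := Fin 2 × Fin N × ℕ

/-- Differential polynomials in `u_i`, `v_i`, `e^{v_0}`, `e^{-v_0}`.  The Laurent variable `T n`
stands for `e^{n v_0}`. -/
abbrev DiffPoly (N : ℕ) : Type := LaurentPolynomial (MvPolynomial (Jet N) ℂ)

/-- Formal power series in `ε` with differential polynomial coefficients. -/
abbrev Alg (N : ℕ) : Type := PowerSeries (DiffPoly N)

/-- `∑ p_n T^n ↦ ∑ (g n p_n) T^n`. -/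
def laurentMap {R : Type*} [Semiring R] (g : ℤ → R → R) (f : LaurentPolynomial R) :
    LaurentPolynomial R :=
  f.coeff.sum fun n p => AddMonoidAlgebra.single n (g n p)

/-- Coefficientwise application of a map to a power series. -/
def psMap {R S : Type*} (g : R → S) [Semiring R] (f : PowerSeries R) : PowerSeries S :=
  PowerSeries.mk fun n => g (PowerSeries.coeff n f)

section

variable (N : ℕ) [NeZero N]

/-- The total `x`-derivative on differential polynomials, with
`∂ e^{n v_0} = n v_0' e^{n v_0}`. -/
def dx0 (f : DiffPoly N) : DiffPoly N :=
  laurentMap (fun n p =>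
    MvPolynomial.mkDerivation ℂ
      (fun j : Jet N => (MvPolynomial.X (j.1, j.2.1, j.2.2 + 1) : MvPolynomial (Jet N) ℂ)) p
    + (n : MvPolynomial (Jet N) ℂ) * MvPolynomial.X (1, 0, 1) * p) f

/-- The partial derivative with respect to a jet variable, with
`∂ e^{n v_0} / ∂ v_0 = n e^{n v_0}`. -/
def pd0 (j : Jet N) (f : DiffPoly N) : DiffPoly N :=
  laurentMap (fun n p => MvPolynomial.pderiv j p
    + if j = (1, 0, 0) then (n : MvPolynomial (Jet N) ℂ) * p else 0) f

/-- The total derivative `∂ = d/dx` on formal power series in `ε`. -/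
def dx : Alg N → Alg N := psMap (dx0 N)

/-- `Λ^m = e^{m ε ∂}`. -/
def shift (m : ℤ) (f : Alg N) : Alg N :=
  PowerSeries.mk fun n => ∑ p ∈ antidiagonal n,
    (((m : ℂ) ^ p.1) * ((p.1.factorial : ℂ)⁻¹)) • (dx0 N)^[p.1] (PowerSeries.coeff p.2 f)

/-- `Λ^m` on `Z_N`-valued elements. -/
def zshift (m : ℤ) : ZN N (Alg N) → ZN N (Alg N) := ZN.map (shift N m)

/-- The field `u` (`w = 0`) or `v` (`w = 1`) as a `Z_N`-valued element. -/
def fld (w : Fin 2) : ZN N (Alg N) :=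
  ⟨fun i => PowerSeries.C (LaurentPolynomial.C (MvPolynomial.X (w, i, 0)))⟩

/-- The nilpotent part `v - v_0` of `v`. -/
def vNil : ZN N (Alg N) := ⟨fun i => if i = 0 then 0 else (fld N 1).coeff i⟩

/-- `e^v = e^{v_0} ∑_{m < N} (v - v_0)^m / m!`. -/
def expV : ZN N (Alg N) :=
  (PowerSeries.C (LaurentPolynomial.T 1) : Alg N) •
    ∑ m ∈ range N, ((m.factorial : ℂ)⁻¹) • vNil N ^ m

end

/-! ## Difference operators -/

/-- A (possibly bi-infinite) difference operator `∑ A n Λ^n`. -/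
abbrev DOp (R : Type*) : Type _ := ℤ → R

/-- The product with `(X Λ^i) ∘ (Y Λ^j) = X (Λ^i Y) Λ^(i+j)`, where `sh i` is the action of `Λ^i`
on coefficients.  It is only used where each coefficient is a finite sum. -/
def DOp.comp {R : Type*} [CommRing R] (sh : ℤ → R → R) (A B : DOp R) : DOp R :=
  fun n => ∑ᶠ i : ℤ, A i * sh i (B (n - i))

/-- The operator `a Λ^m`. -/
def DOp.mono {R : Type*} [CommRing R] (a : R) (m : ℤ) : DOp R := fun n => if n = m then a else 0

/-- The part with non-negative powers of `Λ`. -/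
def DOp.pos {R : Type*} [CommRing R] (A : DOp R) : DOp R := fun n => if 0 ≤ n then A n else 0

/-- The residue `Res A = A_0`. -/
def DOp.res {R : Type*} (A : DOp R) : R := A 0

/-- The power `A^j`. -/
def DOp.pow {R : Type*} [CommRing R] (sh : ℤ → R → R) (A : DOp R) : ℕ → DOp R
  | 0 => DOp.mono 1 0
  | j + 1 => DOp.comp sh A (DOp.pow sh A j)

section

variable (N : ℕ) [NeZero N]

/-- The Lax operator `L = Λ + u + e^v Λ⁻¹`. -/
def lax : DOp (ZN N (Alg N)) :=
  DOp.mono 1 1 + DOp.mono (fld N 0) 0 + DOp.mono (expV N) (-1)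

/-! ## Dressing operators and the logarithm

The coefficients of dressing operators are not differential polynomials.  They are formal functions
of the position, near a base point: write the position as `x + ε X`, where `X` is a
new variable.  The coefficients are taken in the ring of formal power series in `ε` over
`B[X, e^{X v_0}, e^{-X v_0}]`, `B` the ring of differential polynomials at the base point; the
Laurent variable `T n` stands for `e^{n X v_0}`.  On it `ε ∂` acts as `d/dX`, and `Λ` acts
as `X ↦ X + 1`, so that `e^{X v_0} ↦ e^{v_0} e^{X v_0}`. -/

/-- `B[X, e^{X v_0}, e^{-X v_0}]`. -/
abbrev PosFun (N : ℕ) : Type := LaurentPolynomial (Polynomial (DiffPoly N))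

/-- The coefficient ring of dressing operators. -/
abbrev PosAlg (N : ℕ) : Type := PowerSeries (PosFun N)

instance : CommRing (DiffPoly N) := inferInstance
instance : CommRing (PosFun N) := inferInstance
instance : CommRing (PosAlg N) := inferInstance
instance : Algebra ℂ (PosFun N) := inferInstance
instance : Algebra ℂ (PosAlg N) := inferInstance

/-- `ε ∂ = d/dX`. -/
def posD : PosAlg N → PosAlg N :=
  psMap (laurentMap fun n p => Polynomial.derivative p
    + (n : Polynomial (DiffPoly N)) *
      Polynomial.C (LaurentPolynomial.C (MvPolynomial.X (1, 0, 0))) * p)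

/-- `Λ^m`, that is `X ↦ X + m` and `e^{n X v_0} ↦ e^{n m v_0} e^{n X v_0}`. -/
def posShift (m : ℤ) : PosAlg N → PosAlg N :=
  psMap (laurentMap fun n p =>
    p.comp (Polynomial.X + (m : Polynomial (DiffPoly N))) *
      Polynomial.C (LaurentPolynomial.T (n * m)))

/-- A density `f` as a function of the position `x + ε X`: the Taylor series
`∑ k, (ε X)^k ∂^k f / k!`. -/
def toPos (f : Alg N) : PosAlg N :=
  PowerSeries.mk fun n => ∑ p ∈ antidiagonal n,
    LaurentPolynomial.C (Polynomial.monomial p.1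
      (((p.1.factorial : ℂ)⁻¹) • (dx0 N)^[p.1] (PowerSeries.coeff p.2 f)))

/-- The product of difference operators with coefficients in `Z_N(PosAlg)`. -/
abbrev posComp (A B : DOp (ZN N (PosAlg N))) : DOp (ZN N (PosAlg N)) :=
  DOp.comp (fun m => ZN.map (posShift N m)) A B

/-- Dressing operators `S = 1 + ω₁ Λ⁻¹ + …` and `Sb = ω̄₀ + ω̄₁ Λ + …`, with inverses `S'` and `Sb'`,
such that `L = S Λ S⁻¹ = Sb Λ⁻¹ Sb⁻¹`. -/
structure IsDressing (S S' Sb Sb' : DOp (ZN N (PosAlg N))) : Prop where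
  S_zero : S 0 = 1
  S_lower : ∀ n, 0 < n → S n = 0
  S'_lower : ∀ n, 0 < n → S' n = 0
  S_mul : posComp N S S' = DOp.mono 1 0
  S'_mul : posComp N S' S = DOp.mono 1 0
  Sb_upper : ∀ n, n < 0 → Sb n = 0
  Sb'_upper : ∀ n, n < 0 → Sb' n = 0
  Sb_mul : posComp N Sb Sb' = DOp.mono 1 0
  Sb'_mul : posComp N Sb' Sb = DOp.mono 1 0
  lax_S : (fun n => ZN.map (toPos N) (lax N n)) = posComp N (posComp N S (DOp.mono 1 1)) S'
  lax_Sb : (fun n => ZN.map (toPos N) (lax N n)) = posComp N (posComp N Sb (DOp.mono 1 (-1))) Sb'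

/-- For mutually inverse `A`, `A'`, the difference operator `A ∘ ε∂ ∘ A' - ε∂ = A ∘ (ε∂ A')`. -/
def dressedD (A A' : DOp (ZN N (PosAlg N))) : DOp (ZN N (PosAlg N)) :=
  posComp N A (fun n => ZN.map (posD N) (A' n))

/-- `W` is `log L = ½ (S ∘ ε∂ ∘ S⁻¹ - Sb ∘ ε∂ ∘ Sb⁻¹)`; the two terms `ε∂` cancel.  The
coefficients of `W` are densities, and those of the right side are functions of the position.
Dressing operators are required to exist, and the formula is required for each choice of them. -/
def IsLogLax (W : DOp (ZN N (Alg N))) : Prop :=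
  (∃ S S' Sb Sb' : DOp (ZN N (PosAlg N)), IsDressing N S S' Sb Sb') ∧
    ∀ S S' Sb Sb' : DOp (ZN N (PosAlg N)), IsDressing N S S' Sb Sb' →
      ∀ n, ZN.map (toPos N) (W n) =
        (1 / 2 : ℂ) • (dressedD N S S' n - dressedD N Sb Sb' n)

/-! ## The hierarchy -/

/-- The product of difference operators with coefficients in `Z_N(Alg)`. -/
abbrev opComp (A B : DOp (ZN N (Alg N))) : DOp (ZN N (Alg N)) := DOp.comp (zshift N) A B

/-- The power `L^j`. -/
abbrev laxPow (j : ℕ) : DOp (ZN N (Alg N)) := DOp.pow (zshift N) (lax N) j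

/-- `c_j = 1 + 1/2 + … + 1/j`. -/
def harm (j : ℕ) : ℂ := ∑ i ∈ range j, 1 / ((i : ℂ) + 1)

/-- `L^j (log L - c_j)`, where `W = log L`. -/
def laxLog (W : DOp (ZN N (Alg N))) (j : ℕ) : DOp (ZN N (Alg N)) :=
  opComp N (laxPow N j) (W - DOp.mono (harm j • (1 : ZN N (Alg N))) 0)

/-- The operators `B_{0,j} = B_j = L^{j+1} / (j+1)!` and
`B_{1,j} = D_j = (2 / j!) L^j (log L - c_j)`. -/
def flowOp (W : DOp (ZN N (Alg N))) (k : Fin 2) (j : ℕ) : DOp (ZN N (Alg N)) :=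
  if k = 0 then (((j + 1).factorial : ℂ)⁻¹) • laxPow N (j + 1)
  else (2 / (j.factorial : ℂ)) • laxLog N W j

/-- The evolutionary vector field `∂_t w_i = (X w)_i` applied to a differential polynomial:
`∑ (∂^k X_{w,i}) ∂f/∂w_i^{(k)}`. -/
def evol0 (X : Fin 2 → ZN N (Alg N)) (f : DiffPoly N) : Alg N :=
  ∑ᶠ j : Jet N, PowerSeries.C (pd0 N j f) * (dx N)^[j.2.2] ((X j.1).coeff j.2.1)

/-- The evolutionary vector field `∂_t w_i = (X w)_i`, extended `ε`-linearly. -/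
def evol (X : Fin 2 → ZN N (Alg N)) (f : Alg N) : Alg N :=
  PowerSeries.mk fun n => ∑ p ∈ antidiagonal n,
    PowerSeries.coeff p.1 (evol0 N X (PowerSeries.coeff p.2 f))

/-- The vector field `∂_t = X` is the flow `ε ∂_t L = [B_+, L]`. -/
def IsLaxFlow (X : Fin 2 → ZN N (Alg N)) (B : DOp (ZN N (Alg N))) : Prop :=
  ∀ n, (PowerSeries.X : Alg N) • ZN.map (evol N X) (lax N n) =
    opComp N B.pos (lax N) n - opComp N (lax N) B.pos n

/-! ## Hamiltonian structures -/

/-- The Euler operator `δ/δw_i = ∑ (-∂)^k ∂/∂w_i^{(k)}`. -/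
def euler (w : Fin 2) (i : Fin N) : Alg N → Alg N :=
  psMap fun f => ∑ᶠ k : ℕ, (-1 : DiffPoly N) ^ k * (dx0 N)^[k] (pd0 N (w, i, k) f)

/-- The `Z_N`-valued variational derivative `δF/δw` of `F = ∫ f dx`.  It is determined by
`Tr_N (A * δF/δw) = ∑ i, A_i δF/δw_i` for all `A`, see `tr_mul_grad`. -/
def grad (w : Fin 2) (f : Alg N) : ZN N (Alg N) :=
  ZN.ofPairing fun i => euler N w i f

/-- Division by `ε` of a series without constant term. -/
def divEps {R : Type*} [CommRing R] (f : PowerSeries R) : PowerSeries R :=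
  PowerSeries.mk fun n => PowerSeries.coeff (n + 1) f

/-- Division by `ε` in `Z_N`. -/
def zdivEps : ZN N (Alg N) → ZN N (Alg N) := ZN.map divEps

/-- The first Poisson operator: `{u, v}₁ = ε⁻¹ (Λ - 1) δ(x - y)`, `{u, u}₁ = {v, v}₁ = 0`. -/
def poisson1 (a b : ZN N (Alg N)) : Fin 2 → ZN N (Alg N) :=
  ![zdivEps N (zshift N 1 b - b), zdivEps N (a - zshift N (-1) a)]

/-- The second Poisson operator: `{u, u}₂ = ε⁻¹ (Λ e^v - e^v Λ⁻¹) δ(x - y)`,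
`{u, v}₂ = ε⁻¹ u (Λ - 1) δ(x - y)`, `{v, v}₂ = ε⁻¹ (Λ - Λ⁻¹) δ(x - y)`. -/
def poisson2 (a b : ZN N (Alg N)) : Fin 2 → ZN N (Alg N) :=
  ![zdivEps N (zshift N 1 (expV N * a) - expV N * zshift N (-1) a
      + fld N 0 * (zshift N 1 b - b)),
    zdivEps N (fld N 0 * a - zshift N (-1) (fld N 0 * a) + (zshift N 1 b - zshift N (-1) b))]

/-- `{f, H}₁` for a density `f` and `H = ∫ h dx`. -/
def bracket1 (f h : Alg N) : Alg N := evol N (poisson1 N (grad N 0 h) (grad N 1 h)) f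

/-- `{f, H}₂` for a density `f` and `H = ∫ h dx`. -/
def bracket2 (f h : Alg N) : Alg N := evol N (poisson2 N (grad N 0 h) (grad N 1 h)) f

/-- The Hamiltonian densities `h_{0,j} = Tr_N Res L^{j+1} / (j+1)!` and
`h_{1,j} = (2 / j!) Tr_N Res [L^j (log L - c_j)]`, where `W = log L`. -/
def hamDensity (W : DOp (ZN N (Alg N))) (k : Fin 2) (j : ℕ) : Alg N :=
  if k = 0 then (((j + 1).factorial : ℂ)⁻¹) • (DOp.res (laxPow N (j + 1))).tr
  else (2 / (j.factorial : ℂ)) • (DOp.res (laxLog N W j)).tr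

end

/-! ## Checks -/

theorem sum_toeplitz {R : Type*} [CommRing R] (F : ℕ → R) (n : ℕ) :
    ∑ i ∈ range n, ∑ j ∈ range n, (if i ≤ j then F (j - i) else 0) =
      ∑ k ∈ range n, ((n : R) - (k : R)) * F k := by
  induction n with
  | zero => simp
  | succ n ih =>
    have h1 : ∑ i ∈ range n, (if i ≤ n then F (n - i) else 0) + F 0 =
        ∑ k ∈ range (n + 1), F k := by
      rw [← Finset.sum_range_reflect F (n + 1), Finset.sum_range_succ]
      congr 1
      · refine Finset.sum_congr rfl fun i hi => ?_
        rw [if_pos (mem_range.1 hi).le]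
        congr 1
      · simp
    have h2 : ∑ j ∈ range n, (if n ≤ j then F (j - n) else 0) = 0 :=
      Finset.sum_eq_zero fun j hj => by
        rw [if_neg (not_le.2 (mem_range.1 hj))]
    have h3 : ∑ k ∈ range (n + 1), (((n + 1 : ℕ) : R) - (k : R)) * F k =
        ∑ k ∈ range n, ((n : R) - (k : R)) * F k + ∑ k ∈ range (n + 1), F k := by
      have : ∑ k ∈ range n, ((n : R) - (k : R)) * F k =
          ∑ k ∈ range (n + 1), ((n : R) - (k : R)) * F k := by
        rw [Finset.sum_range_succ]; simp
      rw [this, ← Finset.sum_add_distrib]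
      refine Finset.sum_congr rfl fun k _ => ?_
      push_cast
      ring
    rw [Finset.sum_range_succ, h3, ← ih, ← h1]
    simp only [Finset.sum_range_succ, Finset.sum_add_distrib, h2]
    simp
    ring

theorem ZN.tr_eq_sum {N : ℕ} {R : Type*} [CommRing R] [Algebra ℂ R] (a : ZN N R) :
    a.tr = ∑ i, a.coeff i := by
  have h1 : a.tr = ∑ i ∈ range N, ∑ j ∈ range N, (if i ≤ j then
      (fun k : ℕ => algebraMap ℂ R (1 / ((N : ℂ) - (k : ℂ))) * a.ext0 k) (j - i) else 0) := by
    rw [Finset.sum_range]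
    unfold ZN.tr Matrix.trace
    refine Finset.sum_congr rfl fun i _ => ?_
    rw [Finset.sum_range, Matrix.diag_apply, Matrix.mul_apply]
    refine Finset.sum_congr rfl fun j _ => ?_
    unfold ZN.trMatrix ZN.toMatrix
    by_cases h : (i : ℕ) ≤ j
    · simp only [if_pos h, Nat.cast_sub h]
    · simp only [if_neg h, zero_mul]
  rw [h1, sum_toeplitz (fun k : ℕ => algebraMap ℂ R (1 / ((N : ℂ) - (k : ℂ))) * a.ext0 k) N,
    Finset.sum_range]
  refine Finset.sum_congr rfl fun k _ => ?_
  have hk : (N : ℂ) - (k : ℂ) ≠ 0 := by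
    rw [sub_ne_zero]
    exact_mod_cast k.2.ne'
  have h2 : ((N : R) - ((k : ℕ) : R)) = algebraMap ℂ R ((N : ℂ) - (k : ℂ)) := by simp
  rw [h2, ← mul_assoc, ← map_mul, mul_one_div_cancel hk, map_one, one_mul]
  simp [ZN.ext0]

theorem ZN.tr_mul_ofPairing {N : ℕ} {R : Type*} [CommRing R] [Algebra ℂ R] (e' : Fin N → R)
    (A : ZN N R) : (A * ZN.ofPairing e').tr = ∑ i, A.coeff i * e' i := by
  set e : ℕ → R := fun n => if h : n < N then e' ⟨n, h⟩ else 0 with he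
  have hg : ∀ m < N, (ZN.ofPairing e').ext0 m = e (N - 1 - m) - e (N - m) := by
    intro m hm
    have h1 : N - 1 - m < N := by omega
    rw [ZN.ext0, dif_pos hm, ZN.ofPairing]
    simp only [he, dif_pos h1]
    congr 1
    · congr 1
      apply Fin.ext
      simp only [Fin.val_rev]
      omega
    · by_cases h0 : m = 0
      · simp [h0]
      · have : N - m < N := by omega
        simp [h0, this]
  have ht : ∀ n ≤ N, ∑ m ∈ range n, (e (N - 1 - m) - e (N - m)) = e (N - n) := by
    intro n hn
    have hN : e N = 0 := by simp [he]
    induction n with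
    | zero => simp [hN]
    | succ n ih =>
      rw [Finset.sum_range_succ, ih (by omega)]
      have : N - 1 - n = N - (n + 1) := by omega
      rw [this]
      ring
  rw [ZN.tr_eq_sum]
  have h1 : ∑ k : Fin N, (A * ZN.ofPairing e').coeff k =
      ∑ k ∈ range N, ∑ i ∈ range (k + 1), A.ext0 i * (ZN.ofPairing e').ext0 (k - i) := by
    rw [Finset.sum_range]
    refine Finset.sum_congr rfl fun k _ => ?_
    exact Finset.Nat.sum_antidiagonal_eq_sum_range_succ
      (fun i j => A.ext0 i * (ZN.ofPairing e').ext0 j) (k : ℕ)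
  rw [h1, Finset.sum_range_diag_flip N (fun i j => A.ext0 i * (ZN.ofPairing e').ext0 j),
    Finset.sum_range]
  refine Finset.sum_congr rfl fun i _ => ?_
  rw [← Finset.mul_sum]
  have h2 : ∑ m ∈ range (N - i), (ZN.ofPairing e').ext0 m = e i := by
    have h3 := ht (N - i) (Nat.sub_le _ _)
    rw [show N - (N - (i : ℕ)) = i by have := i.2; omega] at h3
    rw [← h3]
    refine Finset.sum_congr rfl fun m hm => hg m ?_
    have := mem_range.1 hm
    omega
  rw [h2]
  simp [he, ZN.ext0]

theorem tr_mul_grad (N : ℕ) [NeZero N] (w : Fin 2) (f : Alg N) (A : ZN N (Alg N)) :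
    (A * grad N w f).tr = ∑ i, A.coeff i * euler N w i f :=
  ZN.tr_mul_ofPairing _ A

theorem X_mul_divEps {R : Type*} [CommRing R] (f : PowerSeries R)
    (hf : PowerSeries.constantCoeff f = 0) : PowerSeries.X * divEps f = f := by
  ext n
  cases n with
  | zero => simp [hf]
  | succ n => simp [divEps, PowerSeries.coeff_succ_X_mul]

end EZTH

end

set_option linter.unusedSectionVars false

noncomputable section

namespace EZTH

open Finset

/-! ## Derivations and shifts as plain maps -/

/-! Write `δ` for a variation of the fields that commutes with `∂`, and `≡` for equality up to total
derivatives. The theorem rests on two formulas: `Res (δ(L^m) K) ≡ m Res (δL L^(m-1) K)` for `K`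
commuting with `L` (`res_der_laxPow`), and `Res (L^(m+1) δ log L) ≡ Res (L^m δL)`
(`IsLogLax.res_pow`). With `(j+1) c_(j+1) = (j+1) c_j + 1` they show that `H_{k,j+1}` has the
variation `∫ Tr_N Res (δL B)` with `B = B_{k,j}` (`var_laxPow`, `var_laxLog`). Since `δL = δu + e^v
δv Λ⁻¹`, its gradient is `(B_0, e^v Λ⁻¹(B_1))`, which is `gradOp B`; the fundamental lemma of the
calculus of variations (`eq_zero_of_forall_exact`) makes this an identity of densities.

The rest is the relation `[L, B] = 0`. It gives `[B_+, L] = -[B_-, L]`, so only two coefficients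
survive, and these are the first Poisson operator applied to `gradOp B` (`isLaxFlow_iff_poisson1`).
It also shows that the second Poisson operator on `gradOp B` is the first one on `gradOp (L B)`
(`poisson2_gradOp`). The recursions are then `L B_{1,m} = (m+1) B_{1,m+1} + 2 B_{0,m}` and its
analogue for powers. Only `H_{1,0}`, with gradient `(0, 1)`, needs separate treatment.

The two halves of the logarithm are handled together. Reading operators in powers of `Λ^s`, `s = 1`
for `Sb` and `s = -1` for `S`, and again writing `Λ` for `Λ^s`, both dressings take the form `L = S
Λ⁻¹ S⁻¹` with `S` of non-negative order. For `d = -s ε∂` one has `Λ⁻¹ = e^d`, so that formally `L =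
exp(d + V)` with `V = S ∘ d ∘ S⁻¹ - d`, and `log L` is half the sum of the two `V`. Two dressings
differ by an operator commuting with `Λ⁻¹`; its coefficients are periodic in `X`, hence killed by
`d`, so `V` is independent of the choice (`IsDressed.dressD_eq`). The same argument shows that a
derivation killing `L` and commuting with `d` and the shifts kills `V`. Applied to `posDelta`, whose
kernel consists of the Taylor series of densities, this proves that `V` has coefficients in the ring
of densities (`exists_isLog`).

For the variation of `V` put `Q = S⁻¹ δS`. Then `δV = -S d(Q) S⁻¹` and `δL = S (Q - e^d Q) Λ⁻¹ S⁻¹`,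
so `δL = ∑ ad_{d+V}^k (δV) L / (k+1)!`. After multiplication by `L^m` the residues of all terms with
`k ≥ 1` are exact, because `L` commutes with `d + V`. The expansion makes sense because the dressing
can be chosen with `Q` polynomial in `X` (`exists_pos_dressing`): in each order in `ε` and each
power of `Λ` the Taylor series terminates, and exactness is tested order by order in `ε`. -/

/-- `D` is a `ℂ`-linear derivation. -/
structure IsDer {R : Type*} [CommRing R] [Algebra ℂ R] (D : R → R) : Prop where
  add : ∀ x y, D (x + y) = D x + D y
  smul : ∀ (c : ℂ) x, D (c • x) = c • D x
  mul : ∀ x y, D (x * y) = D x * y + x * D y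

/-- `f` is a homomorphism of `ℂ`-algebras. -/
structure IsHom {R S : Type*} [CommRing R] [Algebra ℂ R] [CommRing S] [Algebra ℂ S]
    (f : R → S) : Prop where
  add : ∀ x y, f (x + y) = f x + f y
  smul : ∀ (c : ℂ) x, f (c • x) = c • f x
  mul : ∀ x y, f (x * y) = f x * f y
  one : f 1 = 1

/-- `sh` is an action of `ℤ` by automorphisms of `ℂ`-algebras. -/
structure IsShift {R : Type*} [CommRing R] [Algebra ℂ R] (sh : ℤ → R → R) : Prop where
  hom : ∀ m, IsHom (sh m)
  zero_apply : ∀ x, sh 0 x = x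
  comp : ∀ m n x, sh (m + n) x = sh m (sh n x)

namespace IsDer

variable {R : Type*} [CommRing R] [Algebra ℂ R] {D : R → R}

theorem zero (h : IsDer D) : D 0 = 0 := by simpa using h.smul 0 0

theorem one (h : IsDer D) : D 1 = 0 := by simpa using h.mul 1 1

theorem neg (h : IsDer D) (x : R) : D (-x) = -D x := by simpa using h.smul (-1) x

theorem sub (h : IsDer D) (x y : R) : D (x - y) = D x - D y := by
  rw [sub_eq_add_neg, h.add, h.neg, sub_eq_add_neg]

theorem intCast (h : IsDer D) (n : ℤ) : D (n : R) = 0 := by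
  have : (n : R) = (n : ℂ) • (1 : R) := by rw [Algebra.smul_def]; simp
  rw [this, h.smul, h.one, smul_zero]

theorem sum (h : IsDer D) {ι : Type*} (s : Finset ι) (f : ι → R) :
    D (∑ i ∈ s, f i) = ∑ i ∈ s, D (f i) := by
  classical
  induction s using Finset.induction_on with
  | empty => simpa using h.zero
  | insert a s ha ih => rw [sum_insert ha, sum_insert ha, h.add, ih]

theorem iterate (h : IsDer D) (n : ℕ) : (∀ x y, D^[n] (x + y) = D^[n] x + D^[n] y) ∧
    ∀ (c : ℂ) x, D^[n] (c • x) = c • D^[n] x := by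
  induction n with
  | zero => simp
  | succ n ih => simp [Function.iterate_succ_apply', ih.1, ih.2, h.add, h.smul]

theorem smulDer (h : IsDer D) (r : R) : IsDer fun x => r * D x where
  add x y := by rw [h.add, mul_add]
  smul c x := by rw [h.smul, mul_smul_comm]
  mul x y := by rw [h.mul]; ring

theorem csmul (h : IsDer D) (r : ℂ) : IsDer fun x => r • D x where
  add x y := by rw [h.add, smul_add]
  smul c x := by rw [h.smul, smul_comm]
  mul x y := by rw [h.mul, smul_add, smul_mul_assoc, mul_smul_comm]

theorem subDer {D' : R → R} (h : IsDer D) (h' : IsDer D') : IsDer fun x => D x - D' x where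
  add x y := by rw [h.add, h'.add]; ring
  smul c x := by rw [h.smul, h'.smul, smul_sub]
  mul x y := by rw [h.mul, h'.mul]; ring

end IsDer

namespace IsHom

variable {R S : Type*} [CommRing R] [Algebra ℂ R] [CommRing S] [Algebra ℂ S] {f : R → S}

theorem zero (h : IsHom f) : f 0 = 0 := by simpa using h.smul 0 0

theorem neg (h : IsHom f) (x : R) : f (-x) = -f x := by simpa using h.smul (-1) x

theorem sub (h : IsHom f) (x y : R) : f (x - y) = f x - f y := by
  rw [sub_eq_add_neg, h.add, h.neg, sub_eq_add_neg]

theorem sum (h : IsHom f) {ι : Type*} (s : Finset ι) (g : ι → R) :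
    f (∑ i ∈ s, g i) = ∑ i ∈ s, f (g i) := by
  classical
  induction s using Finset.induction_on with
  | empty => simpa using h.zero
  | insert a s ha ih => rw [sum_insert ha, sum_insert ha, h.add, ih]

end IsHom

/-! ## Coefficientwise maps -/

section Laurent

variable {R : Type*} [CommRing R] [Algebra ℂ R]

theorem laurentMap_coeff (g : ℤ → R → R) (hg : ∀ n, g n 0 = 0) (f : LaurentPolynomial R) (n : ℤ) :
    (laurentMap g f).coeff n = g n (f.coeff n) := by
  classical
  unfold laurentMap
  rw [AddMonoidAlgebra.coeff_finsuppSum, Finsupp.sum, Finsupp.finsetSum_apply]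
  simp only [AddMonoidAlgebra.coeff_single, Finsupp.single_apply]
  rw [Finset.sum_ite_eq' f.coeff.support n]
  split_ifs with h
  · rfl
  · rw [Finsupp.notMem_support_iff.1 h, hg]

theorem laurentMap_single (g : ℤ → R → R) (hg : ∀ n, g n 0 = 0) (n : ℤ) (p : R) :
    laurentMap g (AddMonoidAlgebra.single n p) = AddMonoidAlgebra.single n (g n p) := by
  ext m
  rw [laurentMap_coeff g hg]
  simp only [AddMonoidAlgebra.coeff_single, Finsupp.single_apply]
  split_ifs with h
  · rw [h]
  · exact hg m

theorem laurent_ind {P : LaurentPolynomial R → Prop} (f : LaurentPolynomial R)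
    (hadd : ∀ p q, P p → P q → P (p + q)) (hs : ∀ n p, P (AddMonoidAlgebra.single n p)) : P f :=
  f.induction_on' hadd fun n a => by
    rw [← LaurentPolynomial.single_eq_C_mul_T]; exact hs n a

theorem laurentMap_add (g : ℤ → R → R) (hg : ∀ n x y, g n (x + y) = g n x + g n y)
    (f f' : LaurentPolynomial R) : laurentMap g (f + f') = laurentMap g f + laurentMap g f' := by
  have h0 : ∀ n, g n 0 = 0 := fun n => by simpa using hg n 0 0
  ext n
  simp only [laurentMap_coeff g h0, AddMonoidAlgebra.coeff_add, Finsupp.add_apply, hg]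

/-- The twist says that `T^n` is multiplied by `n a`, so on monomials the Leibniz rule reduces to
the one for `D` and additivity in the exponent. -/
theorem isDer_laurentMap {D : R → R} (hD : IsDer D) (a : R) :
    IsDer (laurentMap fun n p => D p + (n : R) * a * p) := by
  set g : ℤ → R → R := fun n p => D p + (n : R) * a * p with hg
  have ga : ∀ n x y, g n (x + y) = g n x + g n y := fun n x y => by
    simp only [hg, hD.add]; ring
  have g0 : ∀ n, g n 0 = 0 := fun n => by simp [hg, hD.zero]
  have gadd := laurentMap_add g ga
  refine ⟨gadd, fun c x => ?_, fun x y => ?_⟩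
  · ext n
    rw [AddMonoidAlgebra.coeff_smul_apply, laurentMap_coeff g g0, laurentMap_coeff g g0]
    simp only [hg, AddMonoidAlgebra.coeff_smul_apply, hD.smul, smul_add, mul_smul_comm]
  · refine laurent_ind (P := fun x => laurentMap g (x * y) = laurentMap g x * y + x * laurentMap g y)
      x (fun p q hp hq => ?_) fun n p => ?_
    · rw [add_mul, gadd, hp, hq, gadd]; ring
    · refine laurent_ind (P := fun y => laurentMap g (.single n p * y) =
        laurentMap g (.single n p) * y + .single n p * laurentMap g y) y (fun q q' hp hq => ?_) fun m q => ?_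
      · rw [mul_add, gadd, hp, hq, gadd]; ring
      · simp only [laurentMap_single g g0, AddMonoidAlgebra.single_mul_single]
        rw [← AddMonoidAlgebra.single_add]
        congr 1
        simp only [hg, hD.mul]
        push_cast
        ring

theorem isHom_laurentMap {s : R → R} (hs : IsHom s) (c : ℤ → R) (c0 : c 0 = 1)
    (cadd : ∀ m n, c (m + n) = c m * c n) :
    IsHom (laurentMap fun n p => s p * c n) := by
  set g : ℤ → R → R := fun n p => s p * c n with hg
  have ga : ∀ n x y, g n (x + y) = g n x + g n y := fun n x y => by
    simp only [hg, hs.add]; ring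
  have g0 : ∀ n, g n 0 = 0 := fun n => by simp [hg, hs.zero]
  have gadd := laurentMap_add g ga
  refine ⟨gadd, fun c x => ?_, fun x y => ?_, ?_⟩
  · ext n
    rw [AddMonoidAlgebra.coeff_smul_apply, laurentMap_coeff g g0, laurentMap_coeff g g0]
    simp only [hg, AddMonoidAlgebra.coeff_smul_apply, hs.smul, smul_mul_assoc]
  · refine laurent_ind (P := fun x => laurentMap g (x * y) = laurentMap g x * laurentMap g y)
      x (fun p q hp hq => ?_) fun n p => ?_
    · rw [add_mul, gadd, hp, hq, gadd]; ring
    · refine laurent_ind (P := fun y => laurentMap g (.single n p * y) =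
        laurentMap g (.single n p) * laurentMap g y) y (fun p q hp hq => ?_) fun m q => ?_
      · rw [mul_add, gadd, hp, hq, gadd]; ring
      · simp only [laurentMap_single g g0, AddMonoidAlgebra.single_mul_single]
        congr 1
        simp only [hg, hs.mul, cadd]
        ring
  · rw [AddMonoidAlgebra.one_def, laurentMap_single g g0]
    simp [hg, hs.one, c0]

end Laurent

section PowerSeries

variable {R S : Type*} [CommRing R] [Algebra ℂ R] [CommRing S] [Algebra ℂ S]

theorem coeff_psMap (g : R → S) (n : ℕ) (f : PowerSeries R) :
    PowerSeries.coeff n (psMap g f) = g (PowerSeries.coeff n f) := by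
  simp [psMap]

theorem psMap_psMap {T : Type*} [Semiring T] (h : S → T) (g : R → S) (f : PowerSeries R) :
    psMap h (psMap g f) = psMap (fun x => h (g x)) f := by
  ext n; simp [psMap]

theorem isDer_psMap {D : R → R} (hD : IsDer D) : IsDer (psMap D) where
  add x y := by ext n; simp [coeff_psMap, hD.add]
  smul c x := by ext n; simp [coeff_psMap, hD.smul]
  mul x y := by
    ext n
    simp only [coeff_psMap, map_add, PowerSeries.coeff_mul, hD.sum, hD.mul, sum_add_distrib]

theorem isHom_psMap {f : R → S} (hf : IsHom f) : IsHom (psMap f) where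
  add x y := by ext n; simp [coeff_psMap, hf.add]
  smul c x := by ext n; simp [coeff_psMap, hf.smul]
  mul x y := by
    ext n
    simp only [coeff_psMap, PowerSeries.coeff_mul, hf.sum, hf.mul]
  one := by
    ext n
    simp only [coeff_psMap, PowerSeries.coeff_one]
    split_ifs
    · exact hf.one
    · exact hf.zero

end PowerSeries

namespace ZN

variable {N : ℕ} {R S : Type*} [CommRing R] [Algebra ℂ R] [CommRing S] [Algebra ℂ S]

@[simp] theorem coeff_add (a b : ZN N R) (i : Fin N) : (a + b).coeff i = a.coeff i + b.coeff i := rfl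

@[simp] theorem coeff_sub (a b : ZN N R) (i : Fin N) : (a - b).coeff i = a.coeff i - b.coeff i := rfl

@[simp] theorem coeff_zero (i : Fin N) : (0 : ZN N R).coeff i = 0 := rfl

@[simp] theorem coeff_smul {T : Type*} [SMul T R] (c : T) (a : ZN N R) (i : Fin N) :
    (c • a).coeff i = c • a.coeff i := rfl

@[simp] theorem coeff_map (g : R → S) (a : ZN N R) (i : Fin N) : (map g a).coeff i = g (a.coeff i) :=
  rfl

theorem coeff_one (i : Fin N) : (1 : ZN N R).coeff i = if (i : ℕ) = 0 then 1 else 0 := rfl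

theorem coeff_sum {ι : Type*} (s : Finset ι) (f : ι → ZN N R) (i : Fin N) :
    (∑ k ∈ s, f k).coeff i = ∑ k ∈ s, (f k).coeff i := by
  have h : (∑ k ∈ s, f k).coeff = ∑ k ∈ s, (f k).coeff := map_sum (coeffHom (N := N) (R := R)) f s
  rw [h, Finset.sum_apply]

theorem ext0_smul {T : Type*} [SMulZeroClass T R] (c : T) (a : ZN N R) (n : ℕ) :
    (c • a).ext0 n = c • a.ext0 n := by
  unfold ext0
  split_ifs
  · rfl
  · rw [smul_zero]

theorem ext0_map {g : R → S} (hg : g 0 = 0) (a : ZN N R) (n : ℕ) :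
    (map g a).ext0 n = g (a.ext0 n) := by
  unfold ext0
  split_ifs
  · rfl
  · rw [hg]

theorem smul_mul' {T : Type*} [CommSemiring T] [Algebra T R] (c : T) (a b : ZN N R) :
    c • a * b = c • (a * b) := by
  ext i
  simp only [mul_coeff, ext0_smul, coeff_smul, Finset.smul_sum, smul_mul_assoc]

instance : Algebra ℂ (ZN N R) :=
  Algebra.ofModule smul_mul' fun c a b => by rw [mul_comm, smul_mul', mul_comm]

theorem isDer_map {D : R → R} (hD : IsDer D) : IsDer (map D : ZN N R → ZN N R) where
  add x y := by ext i; exact hD.add _ _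
  smul c x := by ext i; exact hD.smul _ _
  mul x y := by
    ext i
    simp only [coeff_map, mul_coeff, coeff_add, hD.sum, hD.mul, ext0_map hD.zero, sum_add_distrib]

theorem isHom_map {f : R → S} (hf : IsHom f) : IsHom (map f : ZN N R → ZN N S) where
  add x y := by ext i; exact hf.add _ _
  smul c x := by ext i; exact hf.smul _ _
  mul x y := by
    ext i
    simp only [coeff_map, mul_coeff, hf.sum, hf.mul, ext0_map hf.zero]
  one := by
    ext i
    simp only [coeff_map, coeff_one]
    split_ifs
    · exact hf.one
    · exact hf.zero

theorem isShift_map {sh : ℤ → R → R} (h : IsShift sh) :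
    IsShift (fun m => (map (sh m) : ZN N R → ZN N R)) where
  hom m := isHom_map (h.hom m)
  zero_apply x := by ext i; exact h.zero_apply _
  comp m n x := by ext i; exact h.comp _ _ _

theorem tr_add (a b : ZN N R) : (a + b).tr = a.tr + b.tr := by
  simp [tr_eq_sum, sum_add_distrib]

theorem tr_smul (c : ℂ) (a : ZN N R) : (c • a).tr = c • a.tr := by
  simp [tr_eq_sum, Finset.smul_sum]

theorem tr_map {D : R → R} (hD : IsDer D) (a : ZN N R) : (map D a).tr = D a.tr := by
  simp [tr_eq_sum, hD.sum]

end ZN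

theorem isShift_psMap {R : Type*} [CommRing R] [Algebra ℂ R] {sh : ℤ → R → R} (h : IsShift sh) :
    IsShift (fun m => psMap (sh m)) where
  hom m := isHom_psMap (h.hom m)
  zero_apply x := by ext i; simp [coeff_psMap, h.zero_apply]
  comp m n x := by ext i; simp [coeff_psMap, h.comp]

/-! ## Polynomials -/

section Poly

variable {R : Type*} [CommRing R] [Algebra ℂ R]

/-- Coefficientwise application of a derivation to a polynomial. -/
def polyMap (D : R → R) (p : Polynomial R) : Polynomial R :=
  p.sum fun n a => Polynomial.monomial n (D a)

theorem coeff_polyMap {D : R → R} (hD : IsDer D) (p : Polynomial R) (n : ℕ) :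
    (polyMap D p).coeff n = D (p.coeff n) := by
  classical
  unfold polyMap
  rw [Polynomial.sum, Polynomial.finsetSum_coeff]
  simp only [Polynomial.coeff_monomial]
  rw [Finset.sum_ite_eq' p.support n]
  split_ifs with h
  · rfl
  · rw [Polynomial.notMem_support_iff.1 h, hD.zero]

theorem isDer_polyMap {D : R → R} (hD : IsDer D) : IsDer (polyMap D) where
  add x y := by ext n; simp [coeff_polyMap hD, hD.add]
  smul c x := by ext n; simp [coeff_polyMap hD, hD.smul]
  mul x y := by
    ext n
    simp only [coeff_polyMap hD, Polynomial.coeff_add, Polynomial.coeff_mul, hD.sum, hD.mul,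
      sum_add_distrib]

theorem polyMap_monomial {D : R → R} (hD : IsDer D) (n : ℕ) (a : R) :
    polyMap D (Polynomial.monomial n a) = Polynomial.monomial n (D a) := by
  ext m
  rw [coeff_polyMap hD, Polynomial.coeff_monomial, Polynomial.coeff_monomial]
  split_ifs
  · rfl
  · exact hD.zero

theorem polyMap_C {D : R → R} (hD : IsDer D) (a : R) :
    polyMap D (Polynomial.C a) = Polynomial.C (D a) := polyMap_monomial hD 0 a

theorem isDer_derivative : IsDer (fun p : Polynomial R => Polynomial.derivative p) where
  add x y := by simp
  smul c x := by simp
  mul x y := by simp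

theorem isHom_polyComp (q : Polynomial R) : IsHom (fun p : Polynomial R => p.comp q) where
  add x y := Polynomial.add_comp
  smul c x := by simp
  mul x y := Polynomial.mul_comp _ _ _
  one := Polynomial.one_comp

end Poly

/-! ### Commuting coefficientwise maps -/

section Compose

variable {R : Type*} [CommRing R] [Algebra ℂ R]

theorem laurentMap_laurentMap {g g' : ℤ → R → R} (hg : ∀ n, g n 0 = 0) (hg' : ∀ n, g' n 0 = 0)
    (f : LaurentPolynomial R) :
    laurentMap g (laurentMap g' f) = laurentMap (fun n p => g n (g' n p)) f := by
  ext n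
  rw [laurentMap_coeff g hg, laurentMap_coeff g' hg',
    laurentMap_coeff _ fun n => by rw [hg', hg]]

theorem laurentMap_comm {g g' : ℤ → R → R} (hg : ∀ n, g n 0 = 0) (hg' : ∀ n, g' n 0 = 0)
    (h : ∀ n p, g n (g' n p) = g' n (g n p)) (f : LaurentPolynomial R) :
    laurentMap g (laurentMap g' f) = laurentMap g' (laurentMap g f) := by
  rw [laurentMap_laurentMap hg hg', laurentMap_laurentMap hg' hg]
  simp only [h]

theorem derTwist_zero {D : R → R} (hD : IsDer D) (a : R) (n : ℤ) :
    D 0 + (n : R) * a * 0 = 0 := by rw [hD.zero, mul_zero, add_zero]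

/-- The commutator acts on `p T^n` through `[D, D']` and the extra factor `n (D a' - D' a)`; the two
hypotheses remove both. -/
theorem laurentMap_der_comm {D D' : R → R} (hD : IsDer D) (hD' : IsDer D') (a a' : R)
    (h : ∀ p, D (D' p) = D' (D p)) (ha : D a' = D' a) (f : LaurentPolynomial R) :
    laurentMap (fun n p => D p + (n : R) * a * p)
        (laurentMap (fun n p => D' p + (n : R) * a' * p) f) =
      laurentMap (fun n p => D' p + (n : R) * a' * p)
        (laurentMap (fun n p => D p + (n : R) * a * p) f) := by
  refine laurentMap_comm (derTwist_zero hD a) (derTwist_zero hD' a') (fun n p => ?_) f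
  simp only [hD.add, hD'.add, hD.mul, hD'.mul, h, hD.intCast, hD'.intCast, ha]
  ring

end Compose

/-! ### Derivations of differential polynomials and their action on functions of the position -/

section Concrete

variable (N : ℕ) [NeZero N]

/-- The differential polynomials in `u_i`, `v_i`. -/
abbrev JetPoly (N : ℕ) : Type := MvPolynomial (Jet N) ℂ

/-- The total derivative on differential polynomials in `u_i`, `v_i`. -/
def dxP : Derivation ℂ (JetPoly N) (JetPoly N) :=
  MvPolynomial.mkDerivation ℂ fun j : Jet N => (MvPolynomial.X (j.1, j.2.1, j.2.2 + 1) : JetPoly N)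

theorem isDer_derivation {R : Type*} [CommRing R] [Algebra ℂ R] (D : Derivation ℂ R R) :
    IsDer D where
  add := map_add D
  smul := D.map_smul
  mul x y := by rw [D.leibniz]; simp only [smul_eq_mul]; ring

variable {N}

/-- The derivation of differential polynomials with prescribed values on the jet variables. -/
def lder (F : Jet N → JetPoly N) (f : DiffPoly N) : DiffPoly N :=
  laurentMap (fun n p => MvPolynomial.mkDerivation ℂ F p + (n : JetPoly N) * F (1, 0, 0) * p) f

/-- The derivation with values `F` commutes with the total derivative. -/
def Prolonged (F : Jet N → JetPoly N) : Prop :=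
  ∀ w i k, F (w, i, k + 1) = dxP N (F (w, i, k))

theorem isDer_lder (F : Jet N → JetPoly N) : IsDer (lder F) :=
  isDer_laurentMap (isDer_derivation (MvPolynomial.mkDerivation ℂ F)) _

/-- The values of the total derivative on the jet variables. -/
def jetShift (N : ℕ) (j : Jet N) : JetPoly N := MvPolynomial.X (j.1, j.2.1, j.2.2 + 1)

theorem dx0_eq : dx0 N = lder (jetShift N) := rfl

/-- Puts the partial derivatives into the family that also contains the total derivative and all
variations. -/
theorem pd0_eq (j : Jet N) : pd0 N j = lder (Pi.single j 1) := by
  funext f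
  have hp : MvPolynomial.pderiv j = MvPolynomial.mkDerivation ℂ (Pi.single j (1 : JetPoly N)) :=
    MvPolynomial.derivation_ext fun i => by
      rw [MvPolynomial.mkDerivation_X, MvPolynomial.pderiv_X, Pi.single_comm]
  refine congrArg (fun g => laurentMap g f) (funext fun n => funext fun p => ?_)
  rw [hp]
  congr 1
  by_cases h : j = (1, 0, 0)
  · simp [h]
  · rw [if_neg h, Pi.single_eq_of_ne (fun h' => h h'.symm)]; simp

theorem prolonged_jetShift : Prolonged (jetShift N) := fun w i k => by
  simp [jetShift, dxP]

theorem lder_C (F : Jet N → JetPoly N) (p : JetPoly N) :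
    lder F (LaurentPolynomial.C p) = LaurentPolynomial.C (MvPolynomial.mkDerivation ℂ F p) := by
  unfold lder
  rw [← LaurentPolynomial.single_eq_C, laurentMap_single, ← LaurentPolynomial.single_eq_C]
  · simp
  · simp

theorem lder_jet (F : Jet N → JetPoly N) (j : Jet N) :
    lder F (LaurentPolynomial.C (MvPolynomial.X j)) = LaurentPolynomial.C (F j) := by
  rw [lder_C, MvPolynomial.mkDerivation_X]

theorem lder_T (F : Jet N → JetPoly N) (n : ℤ) :
    lder F (LaurentPolynomial.T n) =
      (n : DiffPoly N) * LaurentPolynomial.C (F (1, 0, 0)) * LaurentPolynomial.T n := by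
  unfold lder LaurentPolynomial.T
  rw [laurentMap_single _ (by simp)]
  rw [← map_intCast (LaurentPolynomial.C (R := JetPoly N)), ← map_mul, ← LaurentPolynomial.single_eq_C,
    AddMonoidAlgebra.single_mul_single]
  simp

/-- The commutator is a derivation, so it suffices that it vanishes on the jet variables, and there
this is `Prolonged`. -/
theorem mkDerivation_comm {F : Jet N → JetPoly N} (hF : Prolonged F) (p : JetPoly N) :
    dxP N (MvPolynomial.mkDerivation ℂ F p) = MvPolynomial.mkDerivation ℂ F (dxP N p) := by
  have h : ⁅dxP N, MvPolynomial.mkDerivation ℂ F⁆ = 0 := by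
    refine MvPolynomial.derivation_ext fun j => ?_
    rw [Derivation.commutator_apply, MvPolynomial.mkDerivation_X]
    obtain ⟨w, i, k⟩ := j
    simp [dxP, hF w i k]
  have := congrArg (fun D => D p) h
  rw [Derivation.commutator_apply] at this
  exact sub_eq_zero.1 this

theorem dx0_lder {F : Jet N → JetPoly N} (hF : Prolonged F) (f : DiffPoly N) :
    dx0 N (lder F f) = lder F (dx0 N f) := by
  refine laurentMap_der_comm (isDer_derivation (dxP N))
    (isDer_derivation (MvPolynomial.mkDerivation ℂ F)) _ _ (mkDerivation_comm hF) ?_ f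
  rw [MvPolynomial.mkDerivation_X, ← hF]

theorem isDer_dx0 : IsDer (dx0 N) := isDer_lder (jetShift N)

/-! ## Functions of the position -/

/-- `d/dX` on functions of the position. -/
def posD0 (f : PosFun N) : PosFun N :=
  laurentMap (fun n p => Polynomial.derivative p
    + (n : Polynomial (DiffPoly N)) *
      Polynomial.C (LaurentPolynomial.C (MvPolynomial.X (1, 0, 0))) * p) f

/-- `X ↦ X + m`. -/
def posShift0 (m : ℤ) (f : PosFun N) : PosFun N :=
  laurentMap (fun n p => p.comp (Polynomial.X + (m : Polynomial (DiffPoly N))) *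
      Polynomial.C (LaurentPolynomial.T (n * m))) f

/-- The derivation `lder F`, acting on the base point. -/
def posLift (F : Jet N → JetPoly N) (f : PosFun N) : PosFun N :=
  laurentMap (fun n p => polyMap (lder F) p
    + (n : Polynomial (DiffPoly N)) *
      (Polynomial.X * Polynomial.C (LaurentPolynomial.C (F (1, 0, 0)))) * p) f

theorem isDer_posD0 : IsDer (posD0 (N := N)) := isDer_laurentMap isDer_derivative _

theorem isDer_posLift (F : Jet N → JetPoly N) : IsDer (posLift F) :=
  isDer_laurentMap (isDer_polyMap (isDer_lder F)) _

theorem isHom_posShift0 (m : ℤ) : IsHom (posShift0 (N := N) m) :=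
  isHom_laurentMap (isHom_polyComp _) (fun n => Polynomial.C (LaurentPolynomial.T (n * m)))
    (by simp) fun a b => by rw [add_mul, LaurentPolynomial.T_add, map_mul]

theorem posShift0_zero (x : PosFun N) : posShift0 0 x = x := by
  refine LaurentPolynomial.ext fun n => ?_
  refine (laurentMap_coeff _ (by simp) x n).trans ?_
  simp

theorem posShift0_comp (m n : ℤ) (x : PosFun N) :
    posShift0 (m + n) x = posShift0 m (posShift0 n x) := by
  refine Eq.trans ?_ (laurentMap_laurentMap (by simp) (by simp) x).symm
  refine congrArg (fun g => laurentMap g x) (funext fun k => funext fun p => ?_)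
  rw [Polynomial.mul_comp, Polynomial.comp_assoc, Polynomial.C_comp, mul_add,
    LaurentPolynomial.T_add, map_mul]
  simp only [Polynomial.add_comp, Polynomial.X_comp, Polynomial.intCast_comp, Int.cast_add]
  rw [add_assoc]
  ring

theorem isShift_posShift0 : IsShift (posShift0 (N := N)) :=
  ⟨isHom_posShift0, posShift0_zero, posShift0_comp⟩

theorem posD0_posShift0 (m : ℤ) (f : PosFun N) :
    posD0 (posShift0 m f) = posShift0 m (posD0 f) := by
  refine laurentMap_comm (by simp) (by simp) (fun n p => ?_) f
  simp only [Polynomial.derivative_mul, Polynomial.derivative_C, Polynomial.derivative_comp,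
    Polynomial.add_comp, Polynomial.mul_comp, Polynomial.C_comp, Polynomial.intCast_comp,
    Polynomial.derivative_add, Polynomial.derivative_X, Polynomial.derivative_intCast]
  ring

theorem polyMap_comp {D : DiffPoly N → DiffPoly N} (hD : IsDer D) (m : ℤ)
    (p : Polynomial (DiffPoly N)) :
    polyMap D (p.comp (Polynomial.X + (m : Polynomial (DiffPoly N)))) =
      (polyMap D p).comp (Polynomial.X + (m : Polynomial (DiffPoly N))) := by
  have hP := isDer_polyMap hD
  have h1 : polyMap D (Polynomial.X + (m : Polynomial (DiffPoly N))) = 0 := by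
    rw [hP.add, ← Polynomial.monomial_one_one_eq_X, polyMap_monomial hD, hD.one]
    rw [hP.intCast]
    simp
  have h2 : ∀ n : ℕ, polyMap D ((Polynomial.X + (m : Polynomial (DiffPoly N))) ^ n) = 0 := by
    intro n
    induction n with
    | zero => rw [pow_zero, hP.one]
    | succ n ih => rw [pow_succ, hP.mul, ih, h1, zero_mul, mul_zero, add_zero]
  induction p using Polynomial.induction_on' with
  | add p q hp hq => rw [Polynomial.add_comp, hP.add, hp, hq, hP.add, Polynomial.add_comp]
  | monomial n a =>
    rw [Polynomial.monomial_comp, hP.mul, h2, polyMap_C hD, polyMap_monomial hD,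
      Polynomial.monomial_comp, mul_zero, add_zero]

/-- Shifting `X` in the factor `n X F(v_0)` produces an extra `n m F(v_0)`. This is what the
variation does to the factor `e^{n m v_0}` created by the shift. -/
theorem posLift_posShift0 (F : Jet N → JetPoly N) (m : ℤ) (f : PosFun N) :
    posLift F (posShift0 m f) = posShift0 m (posLift F f) := by
  have hD := isDer_lder F
  have hP := isDer_polyMap hD
  refine laurentMap_comm (derTwist_zero hP _) (by simp) (fun n p => ?_) f
  rw [hP.mul, polyMap_comp hD, polyMap_C hD, lder_T]
  simp only [Polynomial.add_comp, Polynomial.mul_comp, Polynomial.C_comp, Polynomial.intCast_comp,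
    Polynomial.X_comp, map_mul, map_intCast]
  push_cast
  ring

theorem posD0_posLift (F : Jet N → JetPoly N) (f : PosFun N) :
    posD0 (posLift F f) = posLift F (posD0 f) := by
  have hD := isDer_lder F
  refine laurentMap_der_comm isDer_derivative (isDer_polyMap hD) _ _ (fun p => ?_) ?_ f
  · ext n
    simp only [Polynomial.coeff_derivative, coeff_polyMap hD]
    rw [hD.mul]
    have h : lder F ((n : DiffPoly N) + 1) = 0 := by
      have := hD.intCast ((n : ℤ) + 1)
      push_cast at this
      exact this
    rw [h, mul_zero, add_zero]
  · rw [polyMap_C hD, lder_jet]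
    simp

theorem posLift_comm {F : Jet N → JetPoly N} (hF : Prolonged F) (f : PosFun N) :
    posLift (jetShift N) (posLift F f) = posLift F (posLift (jetShift N) f) := by
  have hD := isDer_lder F
  have hD' := isDer_lder (jetShift N)
  have hX : ∀ {D : DiffPoly N → DiffPoly N}, IsDer D → ∀ a,
      polyMap D (Polynomial.X * Polynomial.C a) = Polynomial.X * Polynomial.C (D a) := by
    intro D hD a
    have : ∀ b : DiffPoly N, Polynomial.X * Polynomial.C b = Polynomial.monomial 1 b := fun b => by
      rw [mul_comm, Polynomial.C_mul_X_eq_monomial]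
    rw [this, polyMap_monomial hD, this]
  refine laurentMap_der_comm (isDer_polyMap hD') (isDer_polyMap hD) _ _ (fun p => ?_) ?_ f
  · ext1 n
    simp only [coeff_polyMap hD, coeff_polyMap hD']
    exact dx0_lder hF _
  · rw [hX hD, hX hD']
    simp only [lder_C, jetShift, MvPolynomial.mkDerivation_X]
    rw [hF]
    rfl

/-- The value at the base point. -/
def ev0 (f : PosFun N) : DiffPoly N := f.coeff.sum fun _ p => p.eval 0

theorem ev0_add (f g : PosFun N) : ev0 (f + g) = ev0 f + ev0 g :=
  Finsupp.sum_add_index' (by simp) (by simp)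

theorem ev0_single (n : ℤ) (p : Polynomial (DiffPoly N)) :
    ev0 (AddMonoidAlgebra.single n p) = p.eval 0 :=
  Finsupp.sum_single_index (by simp)

theorem ev0_C (p : Polynomial (DiffPoly N)) : ev0 (LaurentPolynomial.C p) = p.eval 0 := by
  rw [← LaurentPolynomial.single_eq_C, ev0_single]

theorem isHom_ev0 : IsHom (ev0 (N := N)) where
  add := ev0_add
  smul c x := by
    refine laurent_ind (P := fun x => ev0 (c • x) = c • ev0 x) x (fun p q hp hq => ?_) fun n p => ?_
    · rw [smul_add, ev0_add, hp, hq, ev0_add, smul_add]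
    · rw [AddMonoidAlgebra.smul_single, ev0_single, ev0_single, Polynomial.eval_smul]
  mul x y := by
    refine laurent_ind (P := fun x => ev0 (x * y) = ev0 x * ev0 y) x (fun p q hp hq => ?_)
      fun n p => ?_
    · rw [add_mul, ev0_add, hp, hq, ev0_add, add_mul]
    · refine laurent_ind (P := fun y => ev0 (.single n p * y) = ev0 (.single n p) * ev0 y) y
        (fun q q' hp hq => ?_) fun m q => ?_
      · rw [mul_add, ev0_add, hp, hq, ev0_add, mul_add]
      · rw [AddMonoidAlgebra.single_mul_single, ev0_single, ev0_single, ev0_single,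
          Polynomial.eval_mul]
  one := by rw [AddMonoidAlgebra.one_def, ev0_single, Polynomial.eval_one]

theorem ev0_posLift (F : Jet N → JetPoly N) (f : PosFun N) :
    ev0 (posLift F f) = lder F (ev0 f) := by
  have hD := isDer_lder F
  refine laurent_ind (P := fun f => ev0 (posLift F f) = lder F (ev0 f)) f (fun p q hp hq => ?_)
    fun n p => ?_
  · rw [(isDer_posLift F).add, ev0_add, hp, hq, ev0_add, hD.add]
  · unfold posLift
    rw [laurentMap_single _ (derTwist_zero (isDer_polyMap hD) _), ev0_single, ev0_single]
    simp [← Polynomial.coeff_zero_eq_eval_zero, coeff_polyMap hD, mul_assoc]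

end Concrete

/-! ### Constants of `d/dX`, Taylor series of densities, and the shift of densities -/

section Concrete

variable {N : ℕ} [NeZero N]

instance : CharZero (DiffPoly N) :=
  charZero_of_injective_algebraMap (algebraMap ℂ (DiffPoly N)).injective

theorem diffPoly_T_ne_one {n : ℤ} (h : n ≠ 0) : (LaurentPolynomial.T n : DiffPoly N) ≠ 1 := by
  intro h'
  have := congrArg (fun f : DiffPoly N => f.coeff 0) h'
  rw [← LaurentPolynomial.T_zero] at this
  simp [h] at this

theorem jet_ne_zero (j : Jet N) : (LaurentPolynomial.C (MvPolynomial.X j) : DiffPoly N) ≠ 0 := by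
  intro h'
  have := congrArg (fun f : DiffPoly N => f.coeff 0) h'
  simp at this

theorem posD0_coeff (f : PosFun N) (n : ℤ) :
    (posD0 f).coeff n = Polynomial.derivative (f.coeff n) + (n : Polynomial (DiffPoly N)) *
      Polynomial.C (LaurentPolynomial.C (MvPolynomial.X (1, 0, 0))) * f.coeff n :=
  laurentMap_coeff _ (by simp) f n

theorem posShift0_coeff (m : ℤ) (f : PosFun N) (n : ℤ) :
    (posShift0 m f).coeff n = (f.coeff n).comp (Polynomial.X + (m : Polynomial (DiffPoly N))) *
      Polynomial.C (LaurentPolynomial.T (n * m)) :=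
  laurentMap_coeff _ (by simp) f n

/-- Differentiation in `X` lowers the degree, so in top degree the equation says that `n v_0` times
the leading coefficient is zero. -/
theorem coeff_eq_zero_of_posD0 {f : PosFun N} (h : posD0 f = 0) {n : ℤ} (hn : n ≠ 0) :
    f.coeff n = 0 := by
  by_contra hp
  have h1 := congrArg (fun g : PosFun N => (g.coeff n).coeff (f.coeff n).natDegree) h
  simp only [posD0_coeff, Polynomial.coeff_add, Polynomial.coeff_derivative, mul_assoc,
    AddMonoidAlgebra.coeff_zero, Finsupp.zero_apply, Polynomial.coeff_zero] at h1
  rw [Polynomial.coeff_eq_zero_of_natDegree_lt (Nat.lt_succ_self _), zero_mul, zero_add,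
    ← map_intCast (Polynomial.C (R := DiffPoly N)), Polynomial.coeff_C_mul, Polynomial.coeff_C_mul,
    Polynomial.coeff_natDegree] at h1
  refine mul_ne_zero (Int.cast_ne_zero.2 hn) (mul_ne_zero (jet_ne_zero _) ?_) h1
  exact Polynomial.leadingCoeff_ne_zero.2 hp

theorem eq_zero_of_posD0 {f : PosFun N} (h : posD0 f = 0) (h0 : ev0 f = 0) : f = 0 := by
  have hf : f = LaurentPolynomial.C (f.coeff 0) := by
    refine LaurentPolynomial.ext fun n => ?_
    rw [LaurentPolynomial.C_apply]
    split_ifs with hn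
    · rw [hn]
    · exact coeff_eq_zero_of_posD0 h hn
  have h1 := congrArg (fun g : PosFun N => g.coeff 0) h
  simp only [posD0_coeff, Int.cast_zero, zero_mul, add_zero, AddMonoidAlgebra.coeff_zero,
    Finsupp.zero_apply] at h1
  have h2 := Polynomial.derivative_eq_zero.1 h1
  obtain ⟨a, ha⟩ := Polynomial.natDegree_eq_zero.1 h2
  rw [hf, ev0_C, ← ha, Polynomial.eval_C] at h0
  rw [hf, ← ha, h0, map_zero, map_zero]

/-- The component of `e^{n X v_0}` with `n ≠ 0` vanishes, since comparing leading coefficients would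
give `e^{n m v_0} = 1`. The component `n = 0` is a polynomial with equal values at all `k m`, hence
constant. This is what makes `log L` independent of the dressing. -/
theorem posD0_eq_zero_of_periodic {m : ℤ} (hm : m ≠ 0) {f : PosFun N} (h : posShift0 m f = f) :
    posD0 f = 0 := by
  have hc : ∀ n, (f.coeff n).comp (Polynomial.X + (m : Polynomial (DiffPoly N))) *
      Polynomial.C (LaurentPolynomial.T (n * m)) = f.coeff n := fun n => by
    rw [← posShift0_coeff, h]
  refine LaurentPolynomial.ext fun n => ?_
  rw [posD0_coeff, AddMonoidAlgebra.coeff_zero, Finsupp.zero_apply]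
  have h2 := hc n
  set p := f.coeff n with hp
  by_cases hn : n = 0
  · subst hn
    simp only [zero_mul, LaurentPolynomial.T_zero, map_one, mul_one] at h2
    have h3 : ∀ k : ℕ, p.eval ((k : DiffPoly N) * m) = p.eval 0 := by
      intro k
      induction k with
      | zero => simp
      | succ k ih =>
        rw [← ih]
        conv_rhs => rw [← h2]
        simp [Polynomial.eval_comp, add_mul]
    have h4 : p = Polynomial.C (p.eval 0) := by
      refine Polynomial.eq_of_infinite_eval_eq _ _ ?_
      refine Set.infinite_of_injective_forall_mem (f := fun k : ℕ => (k : DiffPoly N) * m) ?_ ?_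
      · intro a b hab
        have hm' : (m : DiffPoly N) ≠ 0 := Int.cast_ne_zero.2 hm
        exact Nat.cast_injective (mul_right_cancel₀ hm' hab)
      · intro k
        simp [h3 k]
    rw [h4]
    simp
  · have h3 : p = 0 := by
      by_contra hp0
      have h4 := congrArg Polynomial.leadingCoeff h2
      rw [← Polynomial.C_eq_intCast, Polynomial.leadingCoeff_mul, Polynomial.leadingCoeff_C,
        Polynomial.leadingCoeff_comp (by rw [Polynomial.natDegree_X_add_C]; exact one_ne_zero), Polynomial.leadingCoeff_X_add_C, one_pow,
        mul_one] at h4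
      exact diffPoly_T_ne_one (mul_ne_zero hn hm)
        (mul_left_cancel₀ (Polynomial.leadingCoeff_ne_zero.2 hp0) (h4.trans (mul_one _).symm))
    rw [h3]
    simp

/-! ## The algebras of densities and of functions of the position -/

theorem posD_eq : posD N = psMap posD0 := rfl

theorem posShift_eq (m : ℤ) : posShift N m = psMap (posShift0 m) := rfl

theorem dx_eq : dx N = psMap (dx0 N) := rfl

theorem isDer_dx : IsDer (dx N) := isDer_psMap isDer_dx0

theorem isDer_posD : IsDer (posD N) := isDer_psMap isDer_posD0

theorem isShift_posShift : IsShift (posShift N) := isShift_psMap isShift_posShift0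

/-- The derivation `ε∂ - d/dX`, where `∂` acts on the base point. -/
def posDelta (f : PosAlg N) : PosAlg N :=
  PowerSeries.X * psMap (posLift (jetShift N)) f - posD N f

theorem isDer_posDelta : IsDer (posDelta (N := N)) :=
  ((isDer_psMap (isDer_posLift _)).smulDer _).subDer isDer_posD

theorem posDelta_posShift (m : ℤ) (f : PosAlg N) :
    posDelta (posShift N m f) = posShift N m (posDelta f) := by
  have hm := isShift_posShift (N := N) |>.hom m
  have hX : posShift N m (PowerSeries.X : PosAlg N) = PowerSeries.X := by
    ext1 n
    rw [posShift_eq, coeff_psMap, PowerSeries.coeff_X]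
    split_ifs
    · exact (isHom_posShift0 m).one
    · exact (isHom_posShift0 m).zero
  unfold posDelta
  rw [hm.sub, hm.mul, hX, posD_eq, posShift_eq]
  simp only [psMap_psMap, posD0_posShift0, posLift_posShift0]

/-- Coefficientwise action of a derivation on power series in `ε` commutes with `ε`. -/
theorem psMap_X_mul {R : Type*} [CommRing R] [Algebra ℂ R] {D : R → R} (hD : IsDer D)
    (f : PowerSeries R) : psMap D (PowerSeries.X * f) = PowerSeries.X * psMap D f := by
  ext n
  cases n with
  | zero => simp [coeff_psMap, hD.zero]
  | succ n => simp [coeff_psMap, PowerSeries.coeff_succ_X_mul]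

theorem posDelta_posD (f : PosAlg N) : posDelta (posD N f) = posD N (posDelta f) := by
  unfold posDelta
  rw [isDer_posD.sub, posD_eq, psMap_X_mul isDer_posD0]
  simp only [psMap_psMap, posD0_posLift]

theorem posDelta_posLift {F : Jet N → JetPoly N} (hF : Prolonged F) (f : PosAlg N) :
    posDelta (psMap (posLift F) f) = psMap (posLift F) (posDelta f) := by
  unfold posDelta
  rw [(isDer_psMap (isDer_posLift F)).sub, psMap_X_mul (isDer_posLift F), posD_eq]
  simp only [psMap_psMap, posD0_posLift, posLift_comm hF]

theorem coeff_toPos (f : Alg N) (n : ℕ) : PowerSeries.coeff n (toPos N f) =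
    ∑ p ∈ antidiagonal n, LaurentPolynomial.C (Polynomial.monomial p.1
      (((p.1.factorial : ℂ)⁻¹) • (dx0 N)^[p.1] (PowerSeries.coeff p.2 f))) := by
  simp [toPos]

theorem posD0_C (p : Polynomial (DiffPoly N)) :
    posD0 (LaurentPolynomial.C p) = LaurentPolynomial.C (Polynomial.derivative p) := by
  rw [← LaurentPolynomial.single_eq_C]
  refine (laurentMap_single _ (by simp) 0 p).trans ?_
  simp

theorem posLift_C (F : Jet N → JetPoly N) (p : Polynomial (DiffPoly N)) :
    posLift F (LaurentPolynomial.C p) = LaurentPolynomial.C (polyMap (lder F) p) := by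
  rw [← LaurentPolynomial.single_eq_C]
  refine (laurentMap_single _ (derTwist_zero (isDer_polyMap (isDer_lder F)) _) 0 p).trans ?_
  simp

/-- `d/dX` turns the term `(εX)^(k+1) ∂^(k+1) f / (k+1)!` into `ε∂`, at the base point, of the term
before it. -/
theorem posDelta_toPos (f : Alg N) : posDelta (toPos N f) = 0 := by
  unfold posDelta
  rw [sub_eq_zero]
  have hD := isDer_lder (jetShift N)
  have hmon : ∀ (k : ℕ) (a : DiffPoly N), Polynomial.derivative
      (Polynomial.monomial (k + 1) ((((k + 1).factorial : ℂ)⁻¹) • a)) =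
      Polynomial.monomial k (((k.factorial : ℂ)⁻¹) • a) := by
    intro k a
    rw [Polynomial.derivative_monomial, Nat.add_sub_cancel]
    congr 1
    rw [mul_comm, ← nsmul_eq_mul, ← Nat.cast_smul_eq_nsmul ℂ, smul_smul, Nat.factorial_succ]
    congr 1
    have h1 : ((k + 1 : ℕ) : ℂ) ≠ 0 := Nat.cast_ne_zero.2 (Nat.succ_ne_zero k)
    have h2 : (k.factorial : ℂ) ≠ 0 := Nat.cast_ne_zero.2 (Nat.factorial_ne_zero k)
    push_cast at h1 ⊢
    field_simp
  ext1 n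
  rw [posD_eq, coeff_psMap, coeff_toPos, isDer_posD0.sum]
  simp only [posD0_C]
  cases n with
  | zero => simp
  | succ n =>
    rw [PowerSeries.coeff_succ_X_mul, coeff_psMap, coeff_toPos, (isDer_posLift _).sum,
      Nat.sum_antidiagonal_succ]
    simp only [posLift_C, polyMap_monomial hD, hD.smul, hmon]
    simp [Function.iterate_succ_apply', dx0_eq]

theorem ev0_toPos (f : Alg N) : psMap ev0 (toPos N f) = f := by
  ext1 n
  rw [coeff_psMap, coeff_toPos, isHom_ev0.sum, Finset.sum_eq_single (0, n)]
  · simp [ev0_C]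
  · rintro ⟨a, b⟩ hab hne
    rw [ev0_C, ← Polynomial.coeff_zero_eq_eval_zero, Polynomial.coeff_monomial, if_neg]
    rintro rfl
    exact hne (by simpa using mem_antidiagonal.1 hab)
  · intro h
    exact absurd (Finset.HasAntidiagonal.mem_antidiagonal.2 (by simp)) h

/-- Taylor's theorem: the functions `f(x + εX)` are those with `ε∂ = d/dX`. -/
theorem eq_toPos_of_posDelta {f : PosAlg N} (h : posDelta f = 0) : f = toPos N (psMap ev0 f) := by
  set g := f - toPos N (psMap ev0 f) with hg
  have h1 : posDelta g = 0 := by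
    rw [hg, isDer_posDelta.sub, h, posDelta_toPos, sub_zero]
  have h2 : psMap ev0 g = 0 := by
    rw [hg, (isHom_psMap isHom_ev0).sub, ev0_toPos, sub_self]
  unfold posDelta at h1
  rw [sub_eq_zero] at h1
  have h3 : ∀ n, PowerSeries.coeff n g = 0 := by
    intro n
    have hev : ev0 (PowerSeries.coeff n g) = 0 := by
      rw [← coeff_psMap ev0, h2, map_zero]
    refine eq_zero_of_posD0 ?_ hev
    rw [← coeff_psMap posD0, ← posD_eq, ← h1]
    -- Because of the factor `ε`, the right side at order `n + 1` involves only the coefficient of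
    -- order `n`, which has no derivative and no value at `X = 0`.
    induction n with
    | zero => simp
    | succ n ih =>
      rw [PowerSeries.coeff_succ_X_mul, coeff_psMap]
      have hev' : ev0 (PowerSeries.coeff n g) = 0 := by
        rw [← coeff_psMap ev0, h2, map_zero]
      have h4 : posD0 (PowerSeries.coeff n g) = 0 := by
        rw [← coeff_psMap posD0, ← posD_eq, ← h1]; exact ih hev'
      rw [eq_zero_of_posD0 h4 hev', (isDer_posLift _).zero]
  exact sub_eq_zero.1 (PowerSeries.ext h3)

/-- The kernel of the derivation `posDelta` is a subalgebra on which evaluation at `X = 0`, a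
homomorphism, is inverse to `toPos`. No Taylor series has to be multiplied out. -/
theorem isHom_toPos : IsHom (toPos N) := by
  have he := isHom_psMap (isHom_ev0 (N := N))
  refine ⟨fun x y => ?_, fun c x => ?_, fun x y => ?_, ?_⟩
  · have h := eq_toPos_of_posDelta (f := toPos N x + toPos N y) (by
      rw [isDer_posDelta.add, posDelta_toPos, posDelta_toPos, add_zero])
    rw [h, he.add, ev0_toPos, ev0_toPos]
  · have h := eq_toPos_of_posDelta (f := c • toPos N x) (by
      rw [isDer_posDelta.smul, posDelta_toPos, smul_zero])
    rw [h, he.smul, ev0_toPos]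
  · have h := eq_toPos_of_posDelta (f := toPos N x * toPos N y) (by
      rw [isDer_posDelta.mul, posDelta_toPos, posDelta_toPos, zero_mul, mul_zero, add_zero])
    rw [h, he.mul, ev0_toPos, ev0_toPos]
  · have h := eq_toPos_of_posDelta (f := (1 : PosAlg N)) isDer_posDelta.one
    rw [h, he.one]

theorem toPos_injective : Function.Injective (toPos N) := fun f g h => by
  rw [← ev0_toPos f, h, ev0_toPos]

/-- A prolonged variation commutes with `posDelta`, so the right side is again a Taylor series and
is determined by its value at `X = 0`. -/
theorem toPos_lder {F : Jet N → JetPoly N} (hF : Prolonged F) (f : Alg N) :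
    toPos N (psMap (lder F) f) = psMap (posLift F) (toPos N f) := by
  have h := eq_toPos_of_posDelta (f := psMap (posLift F) (toPos N f)) (by
    rw [posDelta_posLift hF, posDelta_toPos, (isDer_psMap (isDer_posLift F)).zero])
  rw [h, psMap_psMap]
  congr 1
  simp only [ev0_posLift]
  rw [← psMap_psMap (lder F) ev0, ev0_toPos]

theorem posD_toPos (f : Alg N) : posD N (toPos N f) = toPos N (PowerSeries.X * dx N f) := by
  have h := posDelta_toPos f
  unfold posDelta at h
  rw [sub_eq_zero] at h
  rw [isHom_toPos.mul, dx_eq, dx0_eq, toPos_lder prolonged_jetShift, ← h]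
  congr 1
  have hX := eq_toPos_of_posDelta (f := (PowerSeries.X : PosAlg N)) (by
    have h1 : ∀ {D : PosFun N → PosFun N}, IsDer D → psMap D PowerSeries.X = 0 := by
      intro D hD
      rw [← mul_one PowerSeries.X, psMap_X_mul hD, (isDer_psMap hD).one, mul_zero]
    unfold posDelta
    rw [posD_eq, h1 isDer_posD0, h1 (isDer_posLift _), mul_zero, sub_zero])
  rw [hX]
  congr 1
  ext1 n
  rw [coeff_psMap, PowerSeries.coeff_X, PowerSeries.coeff_X]
  split_ifs
  · exact isHom_ev0.one
  · exact isHom_ev0.zero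

/-- The series `e^{m ε∂} f` is the Taylor series of `f` evaluated at `X = m`. -/
theorem shift_eq_ev0 (m : ℤ) (f : Alg N) :
    shift N m f = psMap ev0 (posShift N m (toPos N f)) := by
  ext1 n
  rw [posShift_eq, coeff_psMap, coeff_psMap, coeff_toPos, (isHom_posShift0 m).sum, isHom_ev0.sum]
  simp only [shift, PowerSeries.coeff_mk]
  refine Finset.sum_congr rfl fun p _ => ?_
  rw [← LaurentPolynomial.single_eq_C]
  have h1 := laurentMap_single (fun n p => p.comp (Polynomial.X + (m : Polynomial (DiffPoly N))) *
      Polynomial.C (LaurentPolynomial.T (n * m))) (by simp) 0 (Polynomial.monomial p.1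
        (((p.1.factorial : ℂ)⁻¹) • (dx0 N)^[p.1] (PowerSeries.coeff p.2 f)))
  refine Eq.trans ?_ (congrArg ev0 h1.symm)
  rw [ev0_single, Polynomial.monomial_comp]
  simp only [Polynomial.eval_mul, Polynomial.eval_C, Polynomial.eval_pow, Polynomial.eval_add,
    Polynomial.eval_X, Polynomial.eval_intCast, zero_mul, LaurentPolynomial.T_zero, mul_one,
    zero_add]
  rw [mul_smul, mul_comm, ← Int.cast_pow, ← Int.cast_pow, ← zsmul_eq_mul, Int.cast_smul_eq_zsmul]

theorem toPos_shift (m : ℤ) (f : Alg N) : toPos N (shift N m f) = posShift N m (toPos N f) := by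
  have h := eq_toPos_of_posDelta (f := posShift N m (toPos N f)) (by
    rw [posDelta_posShift, posDelta_toPos, (isShift_posShift.hom m).zero])
  rw [h, shift_eq_ev0]

/-- Multiplicativity and the group law are inherited from translations in `X` through the injective
homomorphism `toPos`. -/
theorem isShift_shift : IsShift (shift N) where
  hom m := by
    have h := isShift_posShift (N := N) |>.hom m
    have ht := isHom_toPos (N := N)
    exact ⟨fun x y => toPos_injective (by simp only [toPos_shift, ht.add, h.add]),
      fun c x => toPos_injective (by simp only [toPos_shift, ht.smul, h.smul]),
      fun x y => toPos_injective (by simp only [toPos_shift, ht.mul, h.mul]),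
      toPos_injective (by simp only [toPos_shift, ht.one, h.one])⟩
  zero_apply x := toPos_injective (by rw [toPos_shift, isShift_posShift.zero_apply])
  comp m n x := toPos_injective (by simp only [toPos_shift, isShift_posShift.comp])

theorem shift_lder {F : Jet N → JetPoly N} (hF : Prolonged F) (m : ℤ) (f : Alg N) :
    shift N m (psMap (lder F) f) = psMap (lder F) (shift N m f) := by
  refine toPos_injective ?_
  rw [toPos_shift, toPos_lder hF, toPos_lder hF, toPos_shift, posShift_eq, psMap_psMap, psMap_psMap]
  simp only [posLift_posShift0]

end Concrete

/-- A triangular system of equations has a solution. -/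
theorem exists_fixed {ι V : Type*} [Inhabited V] (ρ : ι → ℕ) (Φ : (ι → V) → ι → V)
    (hΦ : ∀ x y a, (∀ b, ρ b < ρ a → x b = y b) → Φ x a = Φ y a) : ∃ x, Φ x = x := by
  set x0 : ι → V := fun _ => default
  have h1 : ∀ r a, ρ a < r → Φ^[r] x0 a = Φ^[r + 1] x0 a := by
    intro r
    induction r with
    | zero => intro a ha; omega
    | succ r ih =>
      intro a ha
      rw [Function.iterate_succ_apply', Function.iterate_succ_apply' Φ (r + 1)]
      exact hΦ _ _ _ fun b hb => ih b (by omega)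
  have h2 : ∀ r a, ρ a < r → Φ^[r] x0 a = Φ^[ρ a + 1] x0 a := by
    intro r a ha
    induction r with
    | zero => omega
    | succ r ih =>
      rcases Nat.lt_succ_iff_lt_or_eq.1 ha with h | h
      · rw [← h1 r a h, ih h]
      · rw [h]
  -- The entry at `a` is stationary from the iterate `ρ a + 1` on, so every index may use its own
  -- number of iterations.
  refine ⟨fun a => Φ^[ρ a + 1] x0 a, funext fun a => ?_⟩
  rw [Function.iterate_succ_apply']
  exact hΦ _ _ _ fun b hb => (h2 (ρ a) b hb).symm

/-! ### Products of difference operators: finiteness, associativity, naturality -/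

namespace DOp

variable {R : Type*} [CommRing R] [Algebra ℂ R] {sh : ℤ → R → R}

/-- All coefficients of the product `A B` are finite sums. -/
def Summable (A B : DOp R) : Prop := ∀ n, {i : ℤ | A i ≠ 0 ∧ B (n - i) ≠ 0}.Finite

/-- The coefficients are bounded below. -/
def IsUp (A : DOp R) : Prop := ∃ a, ∀ n < a, A n = 0

/-- Only finitely many coefficients do not vanish. -/
def IsFin (A : DOp R) : Prop := {n | A n ≠ 0}.Finite

theorem IsUp.summable {A B : DOp R} (hA : IsUp A) (hB : IsUp B) : Summable A B := by
  obtain ⟨a, ha⟩ := hA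
  obtain ⟨b, hb⟩ := hB
  refine fun n => (Set.finite_Icc a (n - b)).subset fun i hi => ⟨?_, ?_⟩
  · by_contra h
    exact hi.1 (ha i (by omega))
  · by_contra h
    exact hi.2 (hb _ (by omega))

theorem IsFin.summable_left {A : DOp R} (hA : IsFin A) (B : DOp R) : Summable A B :=
  fun _ => hA.subset fun _ hi => hi.1

theorem IsFin.summable_right {B : DOp R} (hB : IsFin B) (A : DOp R) : Summable A B := fun n =>
  (hB.image fun j => n - j).subset fun i hi => ⟨n - i, hi.2, by simp⟩

theorem comp_eq_sum (h : IsShift sh) {A B : DOp R} {n : ℤ} {s : Finset ℤ}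
    (hs : ∀ i, A i ≠ 0 → B (n - i) ≠ 0 → i ∈ s) :
    comp sh A B n = ∑ i ∈ s, A i * sh i (B (n - i)) := by
  refine finsum_eq_sum_of_support_subset _ fun i hi => ?_
  rw [Function.mem_support] at hi
  refine hs i (fun h0 => hi (by rw [h0, zero_mul])) fun h0 => hi ?_
  rw [h0, (h.hom i).zero, mul_zero]

theorem exists_comp_eq_sum (h : IsShift sh) {A B : DOp R} (hAB : Summable A B) (n : ℤ) :
    ∃ s : Finset ℤ, ∀ t, s ⊆ t → ∀ A' B' : DOp R, (∀ i, A i = 0 → A' i = 0) →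
      (∀ i, B i = 0 → B' i = 0) → comp sh A' B' n = ∑ i ∈ t, A' i * sh i (B' (n - i)) :=
  ⟨(hAB n).toFinset, fun _ ht _ _ hA hB => comp_eq_sum h fun i h1 h2 => ht
    ((hAB n).mem_toFinset.2 ⟨fun h0 => h1 (hA i h0), fun h0 => h2 (hB _ h0)⟩)⟩

theorem comp_add (h : IsShift sh) {A B C : DOp R} (h1 : Summable A B) (h2 : Summable A C) :
    comp sh A (B + C) = comp sh A B + comp sh A C := by
  funext n
  have hs : ∀ i, i ∈ (h1 n).toFinset ∪ (h2 n).toFinset ↔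
      (A i ≠ 0 ∧ B (n - i) ≠ 0) ∨ (A i ≠ 0 ∧ C (n - i) ≠ 0) := fun i => by simp
  rw [Pi.add_apply, comp_eq_sum h (s := (h1 n).toFinset ∪ (h2 n).toFinset),
    comp_eq_sum h (s := (h1 n).toFinset ∪ (h2 n).toFinset),
    comp_eq_sum h (s := (h1 n).toFinset ∪ (h2 n).toFinset), ← sum_add_distrib]
  · exact sum_congr rfl fun i _ => by rw [Pi.add_apply, (h.hom i).add, mul_add]
  · exact fun i ha hb => (hs i).2 (Or.inr ⟨ha, hb⟩)
  · exact fun i ha hb => (hs i).2 (Or.inl ⟨ha, hb⟩)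
  · intro i ha hb
    rw [hs]
    by_contra hc
    push Not at hc
    exact hb (by rw [Pi.add_apply, hc.1 ha, hc.2 ha, add_zero])

theorem add_comp (h : IsShift sh) {A B C : DOp R} (h1 : Summable A C) (h2 : Summable B C) :
    comp sh (A + B) C = comp sh A C + comp sh B C := by
  funext n
  have hs : ∀ i, i ∈ (h1 n).toFinset ∪ (h2 n).toFinset ↔
      (A i ≠ 0 ∧ C (n - i) ≠ 0) ∨ (B i ≠ 0 ∧ C (n - i) ≠ 0) := fun i => by simp
  rw [Pi.add_apply, comp_eq_sum h (s := (h1 n).toFinset ∪ (h2 n).toFinset),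
    comp_eq_sum h (s := (h1 n).toFinset ∪ (h2 n).toFinset),
    comp_eq_sum h (s := (h1 n).toFinset ∪ (h2 n).toFinset), ← sum_add_distrib]
  · exact sum_congr rfl fun i _ => by rw [Pi.add_apply, add_mul]
  · exact fun i ha hb => (hs i).2 (Or.inr ⟨ha, hb⟩)
  · exact fun i ha hb => (hs i).2 (Or.inl ⟨ha, hb⟩)
  · intro i ha hb
    rw [hs]
    by_contra hc
    push Not at hc
    have h3 : A i = 0 := by by_contra h; exact hb (hc.1 h)
    have h4 : B i = 0 := by by_contra h; exact hb (hc.2 h)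
    exact ha (by rw [Pi.add_apply, h3, h4, add_zero])

theorem smul_comp (h : IsShift sh) {A B : DOp R} (hAB : Summable A B) (c : ℂ) :
    comp sh (c • A) B = c • comp sh A B := by
  funext n
  obtain ⟨s, hs⟩ := exists_comp_eq_sum h hAB n
  rw [hs s subset_rfl (c • A) B (fun i hi => by rw [Pi.smul_apply, hi, smul_zero]) fun _ h => h,
    Pi.smul_apply, hs s subset_rfl A B (fun _ h => h) fun _ h => h, smul_sum]
  exact sum_congr rfl fun i _ => by rw [Pi.smul_apply, smul_mul_assoc]

theorem comp_smul (h : IsShift sh) {A B : DOp R} (hAB : Summable A B) (c : ℂ) :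
    comp sh A (c • B) = c • comp sh A B := by
  funext n
  obtain ⟨s, hs⟩ := exists_comp_eq_sum h hAB n
  rw [hs s subset_rfl A (c • B) (fun _ h => h) (fun i hi => by rw [Pi.smul_apply, hi, smul_zero]),
    Pi.smul_apply, hs s subset_rfl A B (fun _ h => h) fun _ h => h, smul_sum]
  exact sum_congr rfl fun i _ => by rw [Pi.smul_apply, (h.hom i).smul, mul_smul_comm]

/-- Both bracketings are sums over the same set of pairs of exponents. Its finiteness is the only
requirement, which admits a bi-infinite factor such as `log L` next to two finite ones. -/
theorem comp_assoc (h : IsShift sh) {A B C : DOp R}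
    (hABC : ∀ n, {p : ℤ × ℤ | A p.1 ≠ 0 ∧ B p.2 ≠ 0 ∧ C (n - p.1 - p.2) ≠ 0}.Finite) :
    comp sh (comp sh A B) C = comp sh A (comp sh B C) := by
  classical
  funext n
  set F := (hABC n).toFinset with hF
  have hmem : ∀ i j, (i, j) ∈ F ↔ A i ≠ 0 ∧ B j ≠ 0 ∧ C (n - i - j) ≠ 0 := fun i j => by
    rw [hF, Set.Finite.mem_toFinset]; rfl
  have hL : comp sh (comp sh A B) C n =
      ∑ p ∈ F, A p.1 * sh p.1 (B p.2) * sh (p.1 + p.2) (C (n - p.1 - p.2)) := by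
    rw [comp_eq_sum h (s := F.image fun p => p.1 + p.2)]
    · rw [sum_image' (s := F) (g := fun p => p.1 + p.2)
        (h := fun p => A p.1 * sh p.1 (B p.2) * sh (p.1 + p.2) (C (n - p.1 - p.2)))
        (f := fun k => comp sh A B k * sh k (C (n - k)))]
      rintro ⟨i, j⟩ hij
      have hC := ((hmem i j).1 hij).2.2
      rw [comp_eq_sum h (s := (F.filter fun p => p.1 + p.2 = i + j).image Prod.fst), sum_mul,
        sum_image]
      · refine sum_congr rfl fun p hp => ?_
        have := (mem_filter.1 hp).2
        rw [← this, show n - (p.1 + p.2) = n - p.1 - p.2 by ring,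
          show p.1 + p.2 - p.1 = p.2 by ring]
      · rintro p hp q hq hpq
        have h1 := (mem_filter.1 hp).2
        have h2 := (mem_filter.1 hq).2
        exact Prod.ext hpq (by omega)
      · intro a ha hb
        refine mem_image.2 ⟨(a, i + j - a), mem_filter.2 ⟨(hmem _ _).2 ⟨ha, hb, ?_⟩, by simp⟩, rfl⟩
        rw [show n - a - (i + j - a) = n - i - j by ring]
        exact hC
    · intro k hk hC
      by_contra hmem'
      refine hk (finsum_eq_zero_of_forall_eq_zero fun i => ?_)
      by_contra hne
      refine hmem' (mem_image.2 ⟨(i, k - i), (hmem _ _).2 ⟨fun h0 => hne ?_, fun h0 => hne ?_, ?_⟩,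
        by simp⟩)
      · rw [h0, zero_mul]
      · rw [h0, (h.hom i).zero, mul_zero]
      · rw [show n - i - (k - i) = n - k by ring]; exact hC
  have hR : comp sh A (comp sh B C) n =
      ∑ p ∈ F, A p.1 * sh p.1 (B p.2) * sh (p.1 + p.2) (C (n - p.1 - p.2)) := by
    rw [comp_eq_sum h (s := F.image Prod.fst)]
    · rw [sum_image' (s := F) (g := Prod.fst)
        (h := fun p => A p.1 * sh p.1 (B p.2) * sh (p.1 + p.2) (C (n - p.1 - p.2)))
        (f := fun k => A k * sh k (comp sh B C (n - k)))]
      rintro ⟨i, j⟩ hij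
      have hA := ((hmem i j).1 hij).1
      rw [comp_eq_sum h (s := (F.filter fun p => p.1 = i).image Prod.snd), (h.hom i).sum, mul_sum,
        sum_image]
      · refine sum_congr rfl fun p hp => ?_
        have := (mem_filter.1 hp).2
        obtain rfl : p.1 = i := this
        rw [(h.hom _).mul, h.comp, mul_assoc]
      · rintro p hp q hq hpq
        have h1 := (mem_filter.1 hp).2
        have h2 := (mem_filter.1 hq).2
        exact Prod.ext (h1.trans h2.symm) hpq
      · intro b hb hc
        exact mem_image.2 ⟨(i, b), mem_filter.2 ⟨(hmem _ _).2 ⟨hA, hb, hc⟩, rfl⟩, rfl⟩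
    · intro i hi hne
      by_contra hmem'
      refine hne (finsum_eq_zero_of_forall_eq_zero fun j => ?_)
      by_contra hne'
      refine hmem' (mem_image.2 ⟨(i, j), (hmem _ _).2 ⟨hi, fun h0 => hne' ?_, fun h0 => hne' ?_⟩,
        rfl⟩)
      · rw [h0, zero_mul]
      · rw [h0, (h.hom j).zero, mul_zero]
  rw [hL, hR]

theorem IsUp.comp_assoc (h : IsShift sh) {A B C : DOp R} (hA : IsUp A) (hB : IsUp B)
    (hC : IsUp C) : comp sh (comp sh A B) C = comp sh A (comp sh B C) := by
  refine DOp.comp_assoc h fun n => ?_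
  obtain ⟨a, ha⟩ := hA
  obtain ⟨b, hb⟩ := hB
  obtain ⟨c, hc⟩ := hC
  refine ((Set.finite_Icc a (n - b - c)).prod (Set.finite_Icc b (n - a - c))).subset ?_
  rintro ⟨i, j⟩ ⟨hi, hj, hk⟩
  have h1 : a ≤ i := by by_contra h; exact hi (ha _ (by simpa using h))
  have h2 : b ≤ j := by by_contra h; exact hj (hb _ (by simpa using h))
  have h3 : c ≤ n - i - j := by by_contra h; exact hk (hc _ (by simpa using h))
  exact ⟨⟨h1, by simp only; omega⟩, ⟨h2, by simp only; omega⟩⟩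

theorem IsFin.comp_assoc₁₂ (h : IsShift sh) {A B : DOp R} (hA : IsFin A) (hB : IsFin B)
    (C : DOp R) : comp sh (comp sh A B) C = comp sh A (comp sh B C) :=
  DOp.comp_assoc h fun _ =>
    (Set.Finite.prod hA hB).subset fun _ hp => ⟨hp.1, hp.2.1⟩

theorem IsFin.comp_assoc₁₃ (h : IsShift sh) {A C : DOp R} (hA : IsFin A) (hC : IsFin C)
    (B : DOp R) : comp sh (comp sh A B) C = comp sh A (comp sh B C) := by
  refine DOp.comp_assoc h fun n =>
    ((Set.Finite.prod hA hC).image fun p => (p.1, n - p.1 - p.2)).subset ?_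
  rintro ⟨i, j⟩ hp
  exact ⟨(i, n - i - j), ⟨hp.1, hp.2.2⟩, by simp⟩

theorem mono_comp (h : IsShift sh) (a : R) (m : ℤ) (B : DOp R) (n : ℤ) :
    comp sh (mono a m) B n = a * sh m (B (n - m)) := by
  rw [comp_eq_sum h (s := {m}), sum_singleton, mono, if_pos rfl]
  intro i hi _
  rw [mem_singleton]
  by_contra hm
  exact hi (if_neg hm)

theorem comp_mono (h : IsShift sh) (A : DOp R) (b : R) (m n : ℤ) :
    comp sh A (mono b m) n = A (n - m) * sh (n - m) b := by
  rw [comp_eq_sum h (s := {n - m}), sum_singleton, mono, if_pos (by ring)]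
  intro i _ hi
  rw [mem_singleton]
  by_contra hm
  exact hi (if_neg fun h' => hm (by omega))

theorem isFin_mono (a : R) (m : ℤ) : IsFin (mono a m) :=
  (Set.finite_singleton m).subset fun n hn => by
    by_contra hm
    exact hn (if_neg hm)

theorem IsFin.add {A B : DOp R} (hA : IsFin A) (hB : IsFin B) : IsFin (A + B) :=
  (Set.Finite.union hA hB).subset fun n hn => by
    by_contra hm
    simp only [Set.mem_union, Set.mem_ofPred_eq, not_or, not_not] at hm
    exact hn (by rw [Pi.add_apply, hm.1, hm.2, add_zero])

theorem IsFin.comp (h : IsShift sh) {A B : DOp R} (hA : IsFin A) (hB : IsFin B) :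
    IsFin (DOp.comp sh A B) :=
  ((Set.Finite.prod hA hB).image fun p => p.1 + p.2).subset fun n hn => by
    by_contra hm
    refine hn (finsum_eq_zero_of_forall_eq_zero fun i => ?_)
    by_contra hne
    refine hm ⟨(i, n - i), ⟨fun h0 => hne ?_, fun h0 => hne ?_⟩, by simp⟩
    · rw [h0, zero_mul]
    · rw [h0, (h.hom i).zero, mul_zero]

theorem one_comp (h : IsShift sh) (A : DOp R) : comp sh (mono 1 0) A = A := by
  funext n
  rw [mono_comp h, h.zero_apply, one_mul, sub_zero]

theorem comp_one (h : IsShift sh) (A : DOp R) : comp sh A (mono 1 0) = A := by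
  funext n
  rw [comp_mono h, (h.hom _).one, mul_one, sub_zero]

/-- The product of difference operators is natural. -/
theorem hom_comp {S : Type*} [CommRing S] [Algebra ℂ S] {sh' : ℤ → S → S} (h : IsShift sh)
    (h' : IsShift sh') {f : R → S} (hf : IsHom f) (hfs : ∀ m x, f (sh m x) = sh' m (f x))
    {A B : DOp R} (hAB : Summable A B) :
    f ∘ comp sh A B = comp sh' (f ∘ A) (f ∘ B) := by
  funext n
  rw [Function.comp_apply, comp_eq_sum h (s := (hAB n).toFinset), hf.sum,
    comp_eq_sum h' (s := (hAB n).toFinset)]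
  · exact sum_congr rfl fun i _ => by rw [hf.mul, hfs]; rfl
  · intro i ha hb
    refine (hAB n).mem_toFinset.2 ⟨fun h0 => ha ?_, fun h0 => hb ?_⟩
    · rw [Function.comp_apply, h0, hf.zero]
    · rw [Function.comp_apply, h0, hf.zero]
  · exact fun i ha hb => (hAB n).mem_toFinset.2 ⟨ha, hb⟩

theorem der_comp (h : IsShift sh) {D : R → R} (hD : IsDer D) (hDs : ∀ m x, D (sh m x) = sh m (D x))
    {A B : DOp R} (hAB : Summable A B) :
    D ∘ comp sh A B = comp sh (D ∘ A) B + comp sh A (D ∘ B) := by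
  funext n
  obtain ⟨s, hs⟩ := exists_comp_eq_sum h hAB n
  have h0 : ∀ {A : DOp R} (i), A i = 0 → (D ∘ A) i = 0 := fun i hi => by
    rw [Function.comp_apply, hi, hD.zero]
  rw [Function.comp_apply, Pi.add_apply, hs s subset_rfl A B (fun _ h => h) fun _ h => h,
    hs s subset_rfl (D ∘ A) B h0 fun _ h => h, hs s subset_rfl A (D ∘ B) (fun _ h => h) h0,
    hD.sum, ← sum_add_distrib]
  exact sum_congr rfl fun i _ => by rw [hD.mul, hDs]; rfl

/-- The reflection `Λ ↦ Λ⁻¹`. -/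
theorem comp_reflect (A B : DOp R) (n : ℤ) :
    comp (fun m => sh (-m)) (fun i => A (-i)) (fun i => B (-i)) n = comp sh A B (-n) := by
  unfold comp
  rw [← finsum_comp_equiv (Equiv.neg ℤ)]
  refine finsum_congr fun i => ?_
  simp only [Equiv.neg_apply, neg_neg]
  rw [show -(n - -i) = -n - i by ring]

end DOp

/-! ## The ring of difference operators with coefficients bounded below -/

section Up

variable {R : Type*} [CommRing R] [Algebra ℂ R] {sh : ℤ → R → R}

/-- Difference operators `∑ A_n Λ^n` with `A_n = 0` for `n` small. -/
@[ext]
structure UpOp (h : IsShift sh) where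
  /-- The coefficients. -/
  coeff : DOp R
  isUp : DOp.IsUp coeff

namespace UpOp

variable {h : IsShift sh}

theorem coeff_injective : Function.Injective (coeff : UpOp h → DOp R) := fun _ _ => UpOp.ext

instance : Zero (UpOp h) := ⟨⟨0, 0, fun _ _ => rfl⟩⟩

instance : Add (UpOp h) := ⟨fun A B => ⟨A.coeff + B.coeff, by
  obtain ⟨a, ha⟩ := A.isUp
  obtain ⟨b, hb⟩ := B.isUp
  exact ⟨min a b, fun n hn => by rw [Pi.add_apply, ha n (by omega), hb n (by omega), add_zero]⟩⟩⟩

instance : Neg (UpOp h) := ⟨fun A => ⟨-A.coeff, by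
  obtain ⟨a, ha⟩ := A.isUp
  exact ⟨a, fun n hn => by rw [Pi.neg_apply, ha n hn, neg_zero]⟩⟩⟩

instance : Sub (UpOp h) := ⟨fun A B => ⟨A.coeff - B.coeff, (A + -B).isUp.imp fun a ha n hn => by
  rw [sub_eq_add_neg]; exact ha n hn⟩⟩

instance {T : Type*} [Monoid T] [DistribMulAction T R] : SMul T (UpOp h) :=
  ⟨fun c A => ⟨c • A.coeff, by
    obtain ⟨a, ha⟩ := A.isUp
    exact ⟨a, fun n hn => by rw [Pi.smul_apply, ha n hn, smul_zero]⟩⟩⟩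

instance : AddCommGroup (UpOp h) :=
  Function.Injective.addCommGroup coeff coeff_injective rfl (fun _ _ => rfl) (fun _ => rfl)
    (fun _ _ => rfl) (fun _ _ => rfl) (fun _ _ => rfl)

/-- `coeff` as an additive homomorphism. -/
def coeffHom : UpOp h →+ DOp R where
  toFun := coeff
  map_zero' := rfl
  map_add' := fun _ _ => rfl

instance : Module ℂ (UpOp h) :=
  Function.Injective.module ℂ coeffHom coeff_injective (fun _ _ => rfl)

theorem summable (A B : UpOp h) : DOp.Summable A.coeff B.coeff := A.isUp.summable B.isUp

/-- The operator `a Λ^m`. -/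
def mono (h : IsShift sh) (a : R) (m : ℤ) : UpOp h := ⟨DOp.mono a m, m, fun _ hn => if_neg hn.ne⟩

instance : One (UpOp h) := ⟨mono h 1 0⟩

theorem comp_eq_zero {A B : DOp R} {a b : ℤ} (ha : ∀ n < a, A n = 0) (hb : ∀ n < b, B n = 0)
    (h : IsShift sh) {n : ℤ} (hn : n < a + b) : DOp.comp sh A B n = 0 :=
  finsum_eq_zero_of_forall_eq_zero fun i => by
    by_cases hi : i < a
    · rw [ha i hi, zero_mul]
    · rw [hb _ (by omega), (h.hom i).zero, mul_zero]

instance : Mul (UpOp h) := ⟨fun A B => ⟨DOp.comp sh A.coeff B.coeff, by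
  obtain ⟨a, ha⟩ := A.isUp
  obtain ⟨b, hb⟩ := B.isUp
  exact ⟨a + b, fun n hn => comp_eq_zero ha hb h hn⟩⟩⟩

theorem coeff_mul (A B : UpOp h) : (A * B).coeff = DOp.comp sh A.coeff B.coeff := rfl

instance : Ring (UpOp h) :=
  { (inferInstance : AddCommGroup (UpOp h)), (inferInstance : Mul (UpOp h)),
    (inferInstance : One (UpOp h)) with
    mul_assoc := fun A B C => UpOp.ext (DOp.IsUp.comp_assoc h A.isUp B.isUp C.isUp)
    one_mul := fun A => UpOp.ext (DOp.one_comp h _)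
    mul_one := fun A => UpOp.ext (DOp.comp_one h _)
    zero_mul := fun A => UpOp.ext (funext fun _ => finsum_eq_zero_of_forall_eq_zero fun i =>
      zero_mul _)
    mul_zero := fun A => UpOp.ext (funext fun _ => finsum_eq_zero_of_forall_eq_zero fun i => by
      change A.coeff i * sh i 0 = 0
      rw [(h.hom i).zero, mul_zero])
    left_distrib := fun A B C => UpOp.ext (DOp.comp_add h (A.summable B) (A.summable C))
    right_distrib := fun A B C => UpOp.ext (DOp.add_comp h (A.summable C) (B.summable C)) }

@[simp] theorem coeff_add (A B : UpOp h) (n : ℤ) : (A + B).coeff n = A.coeff n + B.coeff n := rfl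

@[simp] theorem coeff_sub (A B : UpOp h) (n : ℤ) : (A - B).coeff n = A.coeff n - B.coeff n := rfl

@[simp] theorem coeff_smul (c : ℂ) (A : UpOp h) (n : ℤ) : (c • A).coeff n = c • A.coeff n := rfl

theorem coeff_sum {ι : Type*} (s : Finset ι) (f : ι → UpOp h) (n : ℤ) :
    (∑ k ∈ s, f k).coeff n = ∑ k ∈ s, (f k).coeff n := by
  have h1 : (∑ k ∈ s, f k).coeff = ∑ k ∈ s, (f k).coeff := map_sum (coeffHom (h := h)) f s
  rw [h1, Finset.sum_apply]

theorem coeff_one : (1 : UpOp h).coeff = DOp.mono 1 0 := rfl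

theorem coeff_mono (a : R) (m : ℤ) : (mono h a m).coeff = DOp.mono a m := rfl

theorem coeff_mono_mul (a : R) (m : ℤ) (A : UpOp h) (n : ℤ) :
    (mono h a m * A).coeff n = a * sh m (A.coeff (n - m)) := DOp.mono_comp h a m A.coeff n

theorem coeff_mul_mono (A : UpOp h) (a : R) (m : ℤ) (n : ℤ) :
    (A * mono h a m).coeff n = A.coeff (n - m) * sh (n - m) a := DOp.comp_mono h A.coeff a m n

theorem smul_mul' (c : ℂ) (A B : UpOp h) : (c • A) * B = c • (A * B) :=
  UpOp.ext (DOp.smul_comp h (A.summable B) c)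

theorem mul_smul' (c : ℂ) (A B : UpOp h) : A * (c • B) = c • (A * B) :=
  UpOp.ext (DOp.comp_smul h (A.summable B) c)

theorem mono_mul_mono (a b : R) (m n : ℤ) : mono h a m * mono h b n = mono h (a * sh m b) (m + n) := by
  ext1
  funext k
  rw [coeff_mono_mul, coeff_mono, coeff_mono, DOp.mono, DOp.mono]
  by_cases hk : k = m + n
  · rw [if_pos (by omega), if_pos hk]
  · rw [if_neg (by omega), if_neg hk, (h.hom m).zero, mul_zero]

/-- Vanishing of the coefficients of a product below the sum of the orders. -/
theorem coeff_mul_eq_zero {A B : UpOp h} {a b n : ℤ} (ha : ∀ k < a, A.coeff k = 0)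
    (hb : ∀ k < b, B.coeff k = 0) (hn : n < a + b) : (A * B).coeff n = 0 :=
  comp_eq_zero ha hb h hn

/-- The lowest coefficient of a product. -/
theorem coeff_mul_lowest {A B : UpOp h} {a b : ℤ} (ha : ∀ k < a, A.coeff k = 0)
    (hb : ∀ k < b, B.coeff k = 0) : (A * B).coeff (a + b) = A.coeff a * sh a (B.coeff b) := by
  rw [coeff_mul, DOp.comp_eq_sum h (s := {a}), sum_singleton, add_sub_cancel_left]
  intro i h1 h2
  rw [mem_singleton]
  by_contra hne
  rcases lt_or_gt_of_ne hne with hlt | hlt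
  · exact h1 (ha i hlt)
  · exact h2 (hb _ (by omega))

/-- Coefficients of a product of operators of order at least `a`, `0`. -/
theorem coeff_mul_sum {A B : UpOp h} {a b : ℤ} (ha : ∀ k < a, A.coeff k = 0)
    (hb : ∀ k < b, B.coeff k = 0) (n : ℤ) :
    (A * B).coeff n = ∑ i ∈ Finset.Icc a (n - b), A.coeff i * sh i (B.coeff (n - i)) := by
  rw [coeff_mul, DOp.comp_eq_sum h]
  intro i h1 h2
  rw [Finset.mem_Icc]
  refine ⟨not_lt.1 fun hlt => h1 (ha i hlt), not_lt.1 fun hlt => h2 (hb _ (by omega))⟩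

/-- An operator with invertible lowest coefficient has a right inverse. -/
theorem exists_right_inverse {A : UpOp h} (h0 : ∀ n < 0, A.coeff n = 0) (hu : IsUnit (A.coeff 0)) :
    ∃ B : UpOp h, (∀ n < 0, B.coeff n = 0) ∧ IsUnit (B.coeff 0) ∧ A * B = 1 := by
  obtain ⟨w, hw⟩ := isUnit_iff_exists_inv.1 hu
  have : Inhabited R := ⟨0⟩
  -- The recursion is coefficient `n` of `A B = 1` solved for `B n`. All indices `n ≤ 0` have weight
  -- `0`, which is harmless as no other entry is consulted there.
  obtain ⟨x, hx⟩ := exists_fixed (V := R) (fun n : ℤ => n.toNat)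
    (fun B n => if n < 0 then 0 else
      w * ((if n = 0 then 1 else 0) - ∑ i ∈ Finset.Icc 1 n, A.coeff i * sh i (B (n - i)))) (by
      intro x y a hxy
      by_cases ha : a < 0
      · simp only [if_pos ha]
      · simp only [if_neg ha]
        congr 2
        refine sum_congr rfl fun i hi => ?_
        rw [Finset.mem_Icc] at hi
        rw [hxy _ (by omega)])
  have hx0 : ∀ n < 0, x n = 0 := fun n hn => by rw [← hx]; exact if_pos hn
  have hxn : ∀ n, 0 ≤ n → x n = w * ((if n = 0 then 1 else 0) -
      ∑ i ∈ Finset.Icc 1 n, A.coeff i * sh i (x (n - i))) := fun n hn => by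
    conv_lhs => rw [← hx]
    exact if_neg (not_lt.2 hn)
  refine ⟨⟨x, 0, hx0⟩, hx0, ?_, ?_⟩
  · change IsUnit (x 0)
    rw [hxn 0 le_rfl]
    simpa using isUnit_iff_exists_inv.2 ⟨A.coeff 0, by rw [mul_comm, hw]⟩
  · ext1
    funext n
    rw [coeff_one]
    by_cases hn : n < 0
    · rw [coeff_mul_eq_zero (a := 0) (b := 0) h0 hx0 (by omega), DOp.mono, if_neg hn.ne]
    · push Not at hn
      rw [coeff_mul_sum (a := 0) (b := 0) h0 hx0, sub_zero, ← Finset.insert_Icc_add_one_left_eq_Icc hn,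
        sum_insert (by simp)]
      change A.coeff 0 * sh 0 (x (n - 0)) + _ = _
      rw [h.zero_apply, sub_zero, hxn n hn, ← mul_assoc, hw, one_mul, zero_add]
      change _ - _ + ∑ i ∈ Finset.Icc 1 n, A.coeff i * sh i (x (n - i)) = _
      rw [sub_add_cancel]
      rfl

/-- The right inverse has itself a right inverse, and by associativity this must be the original
operator. -/
theorem exists_inverse {A : UpOp h} (h0 : ∀ n < 0, A.coeff n = 0) (hu : IsUnit (A.coeff 0)) :
    ∃ B : UpOp h, (∀ n < 0, B.coeff n = 0) ∧ A * B = 1 ∧ B * A = 1 := by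
  obtain ⟨B, hB0, hBu, hAB⟩ := exists_right_inverse h0 hu
  obtain ⟨C, -, -, hBC⟩ := exists_right_inverse hB0 hBu
  have : C = A := by rw [← one_mul C, ← hAB, mul_assoc, hBC, mul_one]
  exact ⟨B, hB0, hAB, this ▸ hBC⟩

/-- A derivation commuting with the shift. -/
structure IsShiftDer (sh : ℤ → R → R) (D : R → R) : Prop where
  isDer : IsDer D
  comm : ∀ m x, D (sh m x) = sh m (D x)

/-- Coefficientwise action of a derivation. -/
def der {D : R → R} (hD : IsShiftDer sh D) (A : UpOp h) : UpOp h :=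
  ⟨D ∘ A.coeff, A.isUp.imp fun a ha n hn => by rw [Function.comp_apply, ha n hn, hD.isDer.zero]⟩

section der

variable {D : R → R} (hD : IsShiftDer sh D)

theorem coeff_der (A : UpOp h) (n : ℤ) : (der hD A).coeff n = D (A.coeff n) := rfl

theorem der_neg (A : UpOp h) : der hD (-A) = -der hD A :=
  UpOp.ext (funext fun _ => hD.isDer.neg _)

theorem der_mul (A B : UpOp h) : der hD (A * B) = der hD A * B + A * der hD B :=
  UpOp.ext (DOp.der_comp h hD.isDer hD.comm (A.summable B))

theorem der_mono_one (m : ℤ) : der hD (mono h 1 m) = 0 := by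
  ext1
  funext n
  rw [coeff_der, coeff_mono, DOp.mono]
  split_ifs
  · exact hD.isDer.one
  · exact hD.isDer.zero

theorem der_one : der hD (1 : UpOp h) = 0 := der_mono_one hD 0

theorem der_comm {D' : R → R} (hD' : IsShiftDer sh D') (hc : ∀ x, D (D' x) = D' (D x))
    (A : UpOp h) : der hD (der hD' A) = der hD' (der hD A) :=
  UpOp.ext (funext fun _ => hc _)

end der

/-- Coefficientwise action of a homomorphism which commutes with the shifts. -/
def map {S : Type*} [CommRing S] [Algebra ℂ S] {sh' : ℤ → S → S} (h : IsShift sh) (h' : IsShift sh')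
    {f : R → S} (hf : IsHom f) (hfs : ∀ m x, f (sh m x) = sh' m (f x)) : UpOp h →+* UpOp h' where
  toFun A := ⟨f ∘ A.coeff, A.isUp.imp fun a ha n hn => by
    rw [Function.comp_apply, ha n hn, hf.zero]⟩
  map_zero' := UpOp.ext (funext fun _ => hf.zero)
  map_add' A B := UpOp.ext (funext fun _ => hf.add _ _)
  map_one' := UpOp.ext (funext fun n => by
    change f (DOp.mono 1 0 n) = DOp.mono 1 0 n
    unfold DOp.mono
    split_ifs
    · exact hf.one
    · exact hf.zero)
  map_mul' A B := UpOp.ext (DOp.hom_comp h h' hf hfs (A.summable B))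

theorem coeff_map {S : Type*} [CommRing S] [Algebra ℂ S] {sh' : ℤ → S → S} {h : IsShift sh}
    {h' : IsShift sh'} {f : R → S} (hf : IsHom f) (hfs : ∀ m x, f (sh m x) = sh' m (f x))
    (A : UpOp h) (n : ℤ) : (map h h' hf hfs A).coeff n = f (A.coeff n) := rfl

theorem map_injective {S : Type*} [CommRing S] [Algebra ℂ S] {sh' : ℤ → S → S} {h : IsShift sh}
    {h' : IsShift sh'} {f : R → S} (hf : IsHom f) (hfs : ∀ m x, f (sh m x) = sh' m (f x))
    (hi : Function.Injective f) : Function.Injective (map h h' hf hfs) := fun A B hAB =>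
  UpOp.ext (funext fun n => hi (by rw [← coeff_map (h := h) (h' := h') hf hfs, hAB]; rfl))

end UpOp

end Up

open UpOp

/-! ### Dressed derivations and their variations -/

section Dressing

variable {R : Type*} [CommRing R] [Algebra ℂ R] {sh : ℤ → R → R}

/-- The operator `Λ⁻¹`. -/
abbrev shInv (h : IsShift sh) : UpOp h := mono h 1 (-1)

/-- `L = S Λ⁻¹ S'` for mutually inverse `S`, `S'` of non-negative order. -/
structure IsDressed (h : IsShift sh) (L S S' : UpOp h) : Prop where
  low : ∀ n < 0, S.coeff n = 0
  low' : ∀ n < 0, S'.coeff n = 0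
  mul : S * S' = 1
  mul' : S' * S = 1
  lax : L = S * shInv h * S'

/-- Coefficientwise action of `Λ⁻¹`. -/
def shiftInv (h : IsShift sh) : UpOp h →+* UpOp h :=
  UpOp.map h h (h.hom (-1)) fun m x => by rw [← h.comp, ← h.comp, add_comm]

theorem shInv_mul (h : IsShift sh) (A : UpOp h) : shInv h * A = shiftInv h A * shInv h := by
  ext1
  funext n
  rw [coeff_mono_mul, coeff_mul_mono, (h.hom _).one, one_mul, mul_one]
  rfl

variable {h : IsShift sh} {L S S' T T' : UpOp h} {d D : R → R}

/-- Commuting with `Λ⁻¹` means that all coefficients are periodic, and periodic elements are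
constants of `d`. -/
theorem der_eq_zero_of_commute (hd : IsShiftDer sh d) (hper : ∀ x, sh (-1) x = x → d x = 0)
    {C : UpOp h} (hC : shInv h * C = C * shInv h) : der hd C = 0 := by
  ext1
  funext n
  refine hper _ ?_
  have h1 := congrArg (fun A : UpOp h => A.coeff (n - 1)) hC
  simp only [coeff_mono_mul, coeff_mul_mono, (h.hom _).one, one_mul, mul_one, sub_neg_eq_add,
    sub_add_cancel] at h1
  exact h1

/-- The difference operator `S ∘ d ∘ S⁻¹ - d`. -/
def dressD (hd : IsShiftDer sh d) (S S' : UpOp h) : UpOp h := S * der hd S'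

namespace IsDressed

theorem lax_mul (hS : IsDressed h L S S') : L * S = S * shInv h := by
  rw [hS.lax, mul_assoc, hS.mul', mul_one]

theorem mul_lax (hS : IsDressed h L S S') : S' * L = shInv h * S' := by
  rw [hS.lax, ← mul_assoc, ← mul_assoc, hS.mul', one_mul]

theorem commute_mul (hS : IsDressed h L S S') (hT : IsDressed h L T T') :
    shInv h * (S' * T) = S' * T * shInv h := by
  rw [← mul_assoc, ← hS.mul_lax, mul_assoc, hT.lax_mul, mul_assoc]

/-- The quotient `T' S` of two dressings commutes with `Λ⁻¹`, so `d` kills it and the dressed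
derivation does not depend on the dressing. -/
theorem dressD_eq (hS : IsDressed h L S S') (hT : IsDressed h L T T') (hd : IsShiftDer sh d)
    (hper : ∀ x, sh (-1) x = x → d x = 0) : dressD hd S S' = dressD hd T T' := by
  have h2 := der_eq_zero_of_commute hd hper (hT.commute_mul hS)
  have h3 : T' = T' * S * S' := by rw [mul_assoc, hS.mul, mul_one]
  unfold dressD
  rw [h3, der_mul, h2, zero_mul, zero_add, ← mul_assoc, ← mul_assoc, hT.mul, one_mul]

theorem der_inv (hS : IsDressed h L S S') (hD : IsShiftDer sh D) :
    der hD S' = -(S' * der hD S * S') := by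
  have h1 : der hD S' * S + S' * der hD S = 0 := by rw [← der_mul, hS.mul', der_one]
  rw [← mul_one (der hD S'), ← hS.mul, ← mul_assoc, eq_neg_of_add_eq_zero_left h1, neg_mul]

theorem der_eq (hS : IsDressed h L S S') (hD : IsShiftDer sh D) :
    der hD S = S * (S' * der hD S) := by
  rw [← mul_assoc, hS.mul, one_mul]

/-- Naturality: derivations which annihilate `L` annihilate the dressed derivation. -/
theorem der_dressD_eq_zero (hS : IsDressed h L S S') (hd : IsShiftDer sh d)
    (hper : ∀ x, sh (-1) x = x → d x = 0) (hD : IsShiftDer sh D) (hDd : ∀ x, D (d x) = d (D x))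
    (hL : der hD L = 0) : der hD (dressD hd S S') = 0 := by
  -- Obtained by applying `D` to `L S = S Λ⁻¹`; it is the infinitesimal version of the comparison of
  -- two dressings.
  have h1 : shInv h * (S' * der hD S) = S' * der hD S * shInv h := by
    have := congrArg (der hD) hS.lax_mul
    rw [der_mul, der_mul, hL, zero_mul, zero_add, der_mono_one, mul_zero, add_zero] at this
    rw [← mul_assoc, ← hS.mul_lax, mul_assoc, this, mul_assoc]
  have h2 := der_eq_zero_of_commute hd hper h1
  unfold dressD
  rw [der_mul, der_comm hD hd hDd, hS.der_inv hD, der_neg, der_mul, h2, zero_mul, zero_add,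
    hS.der_eq hD, mul_assoc S, mul_neg, ← mul_assoc S', hS.mul', one_mul, add_neg_cancel]

/-- `[L, d + V] = 0` for `d + V = S ∘ d ∘ S⁻¹`. -/
theorem commutator (hS : IsDressed h L S S') (hd : IsShiftDer sh d) :
    L * dressD hd S S' - dressD hd S S' * L = der hd L := by
  have h1 : dressD hd S S' * L = -(der hd S * shInv h * S') := by
    unfold dressD
    rw [hS.der_inv hd, mul_assoc, neg_mul, mul_neg, mul_assoc, hS.mul_lax, ← mul_assoc,
      ← mul_assoc S, hS.mul, one_mul, mul_assoc]
  have h2 : der hd L = der hd S * shInv h * S' + S * shInv h * der hd S' := by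
    conv_lhs => rw [hS.lax, der_mul, der_mul, der_mono_one, mul_zero, add_zero]
  have h3 : L * dressD hd S S' = S * shInv h * der hd S' := by
    unfold dressD
    rw [← mul_assoc, hS.lax_mul]
  rw [h1, h2, h3, sub_neg_eq_add, add_comm]

/-- With `Q = S' D(S)`, the variation of `S ∘ d ∘ S'` is `S [Q, d] S'`, and `[Q, d] = -d(Q)`. -/
theorem der_dressD (hS : IsDressed h L S S') (hd : IsShiftDer sh d) (hD : IsShiftDer sh D)
    (hDd : ∀ x, D (d x) = d (D x)) :
    der hD (dressD hd S S') = -(S * der hd (S' * der hD S) * S') := by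
  have h1 : der hD S' = -(S' * der hD S * S') := hS.der_inv hD
  have h2 := hS.der_eq hD
  set Q := S' * der hD S
  unfold dressD
  rw [der_mul, der_comm hD hd hDd, h1, der_neg, der_mul, h2]
  noncomm_ring

theorem der_lax (hS : IsDressed h L S S') (hD : IsShiftDer sh D) :
    der hD L = S * (S' * der hD S * shInv h - shInv h * (S' * der hD S)) * S' := by
  have h1 : der hD S' = -(S' * der hD S * S') := hS.der_inv hD
  have h2 := hS.der_eq hD
  set Q := S' * der hD S
  rw [hS.lax, der_mul, der_mul, der_mono_one, h1, h2]
  noncomm_ring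

/-- As `d + V = S ∘ d ∘ S'`, the commutator with `d + V` is conjugate by `S` to the commutator with
`d`. -/
theorem dressD_conj (hS : IsDressed h L S S') (hd : IsShiftDer sh d) (M : UpOp h) :
    der hd (S * M * S') + (dressD hd S S' * (S * M * S') - S * M * S' * dressD hd S S') =
      S * der hd M * S' := by
  have h1 : dressD hd S S' * (S * M * S') = -(der hd S * M * S') := by
    have : dressD hd S S' * (S * M * S') = S * (der hd S' * S) * M * S' := by
      unfold dressD; noncomm_ring
    have h2 : der hd S' * S = -(S' * der hd S) := by
      rw [eq_neg_iff_add_eq_zero, ← der_mul, hS.mul', der_one]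
    rw [this, h2, mul_neg, ← mul_assoc, hS.mul, one_mul, neg_mul, neg_mul]
  have h3 : S * M * S' * dressD hd S S' = S * M * der hd S' := by
    unfold dressD
    rw [← mul_assoc, mul_assoc (S * M), hS.mul', mul_one]
  rw [h1, h3, der_mul, der_mul]
  noncomm_ring

end IsDressed

/-- The action of `d + V` by commutators. -/
def adStep (hd : IsShiftDer sh d) (V Y : UpOp h) : UpOp h := der hd Y + (V * Y - Y * V)

/-- The variation of `V` is already `-S d(Q) S'`, and each commutator with `d + V` adds one more
derivative of `Q`. -/
theorem IsDressed.adStep_iterate (hS : IsDressed h L S S') (hd : IsShiftDer sh d)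
    (hD : IsShiftDer sh D) (hDd : ∀ x, D (d x) = d (D x)) (k : ℕ) :
    (adStep hd (dressD hd S S'))^[k] (der hD (dressD hd S S')) =
      -(S * (der hd)^[k + 1] (S' * der hD S) * S') := by
  induction k with
  | zero => exact hS.der_dressD hd hD hDd
  | succ k ih =>
    rw [Function.iterate_succ_apply', ih, Function.iterate_succ_apply' _ (k + 1),
      ← hS.dressD_conj hd]
    unfold adStep
    rw [der_neg]
    noncomm_ring

/-- Taylor expansion of the variation of `L`. -/
theorem IsDressed.der_lax_sub (hS : IsDressed h L S S') (hd : IsShiftDer sh d)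
    (hD : IsShiftDer sh D) (hDd : ∀ x, D (d x) = d (D x)) (r : ℕ) :
    der hD L - ∑ k ∈ range r, (((k + 1).factorial : ℂ)⁻¹) •
        ((adStep hd (dressD hd S S'))^[k] (der hD (dressD hd S S')) * L) =
      S * (∑ k ∈ range (r + 1), ((k.factorial : ℂ)⁻¹) • (der hd)^[k] (S' * der hD S) -
        shiftInv h (S' * der hD S)) * shInv h * S' := by
  simp only [hS.adStep_iterate hd hD hDd]
  -- The right side measures how far the truncated exponential of `d` is from the action of `Λ⁻¹` on
  -- `Q`. Its term `k = 0` is the summand `Q Λ⁻¹` in the variation of `L`.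
  rw [hS.der_lax hD, shInv_mul, sum_range_succ']
  set Q := S' * der hD S
  have h1 : ∀ k ∈ range r, (((k + 1).factorial : ℂ)⁻¹) • (-(S * (der hd)^[k + 1] Q * S') * L) =
      -(S * ((((k + 1).factorial : ℂ)⁻¹) • (der hd)^[k + 1] Q) * (shInv h * S')) := by
    intro k _
    rw [neg_mul, smul_neg, mul_assoc _ S', hS.mul_lax, UpOp.mul_smul', UpOp.smul_mul']
  rw [sum_congr rfl h1, sum_neg_distrib, ← sum_mul, ← mul_sum]
  simp only [Nat.factorial_zero, Nat.cast_one, inv_one, one_smul, Function.iterate_zero, id_eq]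
  noncomm_ring

/-! ## Residues modulo exact terms -/

/-- A space of exact terms: it contains all `Λ^m x - x` and `d x`. -/
structure IsExactSpace (sh : ℤ → R → R) (E : Submodule ℂ R) : Prop where
  shift_sub : ∀ m x, sh m x - x ∈ E

/-- Pairing `a = A_i` with `b = B_(-i)`, the difference `a Λ^i(b) - b Λ^(-i)(a)` equals `Λ^i y - y`
for `y = b Λ^(-i)(a)`. -/
theorem IsExactSpace.res_comm {E : Submodule ℂ R} (hE : IsExactSpace sh E) (h : IsShift sh)
    {A B : DOp R} (hAB : DOp.Summable A B) : DOp.comp sh A B 0 - DOp.comp sh B A 0 ∈ E := by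
  set s := (hAB 0).toFinset with hs
  have hmem : ∀ i, i ∈ s ↔ A i ≠ 0 ∧ B (0 - i) ≠ 0 := fun i => (hAB 0).mem_toFinset
  rw [DOp.comp_eq_sum h (s := s) fun i h1 h2 => (hmem i).2 ⟨h1, h2⟩,
    DOp.comp_eq_sum h (s := s.image fun i => -i) fun i h1 h2 => mem_image.2
      ⟨-i, (hmem _).2 ⟨by rwa [← zero_sub], by rwa [zero_sub, neg_neg]⟩, neg_neg i⟩,
    sum_image fun i _ j _ hij => neg_injective hij, ← sum_sub_distrib]
  refine E.sum_mem fun i _ => ?_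
  have := hE.shift_sub i (B (-i) * sh (-i) (A i))
  rw [(h.hom i).mul, ← h.comp, add_neg_cancel, h.zero_apply] at this
  rw [zero_sub, zero_sub, neg_neg, mul_comm]
  exact this

theorem IsExactSpace.res_mul_comm {E : Submodule ℂ R} (hE : IsExactSpace sh E) (A B : UpOp h) :
    (A * B).coeff 0 - (B * A).coeff 0 ∈ E := hE.res_comm h (A.summable B)

theorem der_pow_eq {V : UpOp h} (hd : IsShiftDer sh d) (hL : L * V - V * L = der hd L) (m : ℕ) :
    der hd (L ^ m) = L ^ m * V - V * L ^ m := by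
  induction m with
  | zero => rw [pow_zero, der_one, one_mul, mul_one, sub_self]
  | succ m ih =>
    rw [pow_succ, der_mul, ih, ← hL]
    noncomm_ring

/-- Since `L^m` commutes with `d + V`, one has `L^m [d + V, Y] = [d + V, L^m Y]`: a derivative plus
a commutator. -/
theorem IsExactSpace.res_adStep {E : Submodule ℂ R} (hE : IsExactSpace sh E)
    (hd : IsShiftDer sh d) (hdE : ∀ x, d x ∈ E) {V : UpOp h} (hL : L * V - V * L = der hd L)
    (m : ℕ) (Y : UpOp h) : (L ^ m * adStep hd V Y).coeff 0 ∈ E := by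
  have h1 : L ^ m * adStep hd V Y = der hd (L ^ m * Y) + (V * (L ^ m * Y) - L ^ m * Y * V) := by
    unfold adStep
    rw [der_mul, der_pow_eq hd hL]
    noncomm_ring
  rw [h1]
  exact E.add_mem (hdE _) (hE.res_mul_comm _ _)

end Dressing

theorem IsShift.scale {R : Type*} [CommRing R] [Algebra ℂ R] {sh : ℤ → R → R} (h : IsShift sh)
    (g : ℤ) : IsShift fun m => sh (g * m) where
  hom m := h.hom _
  zero_apply x := by rw [mul_zero, h.zero_apply]
  comp m n x := by rw [mul_add, h.comp]

/-! ### Solving for the dressing of a three-term operator -/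

section Abstract

variable {R : Type*} [CommRing R] [Algebra ℂ R] {sh : ℤ → R → R}

/-- The operator `a Λ + u + b Λ⁻¹`. -/
def laxOp (h : IsShift sh) (a u b : R) : UpOp h := mono h a 1 + mono h u 0 + mono h b (-1)

theorem coeff_laxOp_mul (h : IsShift sh) (a u b : R) (A : UpOp h) (n : ℤ) :
    (laxOp h a u b * A).coeff n =
      a * sh 1 (A.coeff (n - 1)) + u * A.coeff n + b * sh (-1) (A.coeff (n + 1)) := by
  unfold laxOp
  rw [add_mul, add_mul, coeff_add, coeff_add, coeff_mono_mul, coeff_mono_mul, coeff_mono_mul,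
    h.zero_apply, sub_zero, sub_neg_eq_add]

/-- Existence of dressing operators, provided that the leading coefficient exists and that the
difference equations are solvable. -/
theorem exists_dressing (h : IsShift sh) {a u b g : R} (hg : IsUnit g) (hb : b * sh (-1) g = g)
    (hK : ∀ x, ∃ y, y - sh (-1) y = x) :
    ∃ G G' : UpOp h, IsDressed h (laxOp h a u b) G G' ∧ G.coeff 0 = g := by
  obtain ⟨w, hw⟩ := isUnit_iff_exists_inv.1 hg
  choose K hK using hK
  have : Inhabited R := ⟨0⟩
  -- The unknowns are the coefficients in `L G = G Λ⁻¹`. Writing the `n`-th one as `g y` and using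
  -- `b Λ⁻¹(g) = g`, the coefficient at `n - 1` becomes `y - Λ⁻¹(y) = g⁻¹ (u x_(n-1) + a
  -- Λ(x_(n-2)))`.
  obtain ⟨x, hx⟩ := exists_fixed (V := R) (fun n : ℤ => n.toNat)
    (fun x n => if n < 0 then 0 else if n = 0 then g else
      g * K (w * (u * x (n - 1) + a * sh 1 (x (n - 2))))) (by
      intro x y n hxy
      by_cases h0 : n < 0
      · simp only [if_pos h0]
      · by_cases h1 : n = 0
        · simp only [if_pos h1]
        · simp only [if_neg h0, if_neg h1]
          rw [hxy _ (by omega), hxy _ (by omega)])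
  have hx0 : ∀ n < 0, x n = 0 := fun n hn => by rw [← hx]; exact if_pos hn
  have hxg : x 0 = g := by rw [← hx]; simp
  have hxn : ∀ n, 0 < n → x n = g * K (w * (u * x (n - 1) + a * sh 1 (x (n - 2)))) := fun n hn => by
    conv_lhs => rw [← hx]
    simp only [if_neg (not_lt.2 hn.le), if_neg hn.ne']
  set G : UpOp h := ⟨x, 0, hx0⟩ with hG
  obtain ⟨G', hG', h1, h2⟩ := exists_inverse (A := G) hx0 (by change IsUnit (x 0); rwa [hxg])
  refine ⟨G, G', ⟨hx0, hG', h1, h2, ?_⟩, hxg⟩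
  have h3 : laxOp h a u b * G = G * shInv h := by
    ext1
    funext n
    rw [coeff_laxOp_mul, coeff_mul_mono, (h.hom _).one, mul_one, sub_neg_eq_add]
    change a * sh 1 (x (n - 1)) + u * x n + b * sh (-1) (x (n + 1)) = x (n + 1)
    rcases lt_trichotomy n (-1) with hn | hn | hn
    · rw [hx0 _ (by omega), hx0 _ (by omega), hx0 (n + 1) (by omega), (h.hom _).zero, (h.hom _).zero]
      ring
    · subst hn
      rw [hx0 _ (by omega), hx0 _ (by omega), (h.hom _).zero, neg_add_cancel, hxg, hb]
      ring
    · have h4 := hxn (n + 1) (by omega)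
      rw [add_sub_cancel_right, show n + 1 - 2 = n - 1 by ring] at h4
      have h5 := hK (w * (u * x n + a * sh 1 (x (n - 1))))
      set y := K (w * (u * x n + a * sh 1 (x (n - 1))))
      rw [h4, (h.hom _).mul, ← mul_assoc, hb]
      linear_combination (-g) * h5 - (u * x n + a * sh 1 (x (n - 1))) * hw
  rw [← h3, mul_assoc, h1, mul_one]

end Abstract

/-! ## Triangular equations in `Z_N[[ε]]` -/

section Triangular

variable {N : ℕ} [NeZero N] {V : Type*} [CommRing V] [Algebra ℂ V]

/-- Give `Γ^i ε^n` the weight `i + n`. As `z` has no part of weight `0`, the product in a given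
weight involves only entries of `w` of smaller weight. -/
theorem coeff_mul_congr {z w w' : ZN N (PowerSeries V)}
    (hz : PowerSeries.coeff 0 (z.coeff 0) = 0) {i : Fin N} {n : ℕ}
    (hw : ∀ (j : Fin N) (k : ℕ), (j : ℕ) + k < i + n →
      PowerSeries.coeff k (w.coeff j) = PowerSeries.coeff k (w'.coeff j)) :
    PowerSeries.coeff n ((z * w).coeff i) = PowerSeries.coeff n ((z * w').coeff i) := by
  rw [ZN.mul_coeff, ZN.mul_coeff, map_sum, map_sum]
  refine sum_congr rfl fun p hp => ?_
  rw [PowerSeries.coeff_mul, PowerSeries.coeff_mul]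
  refine sum_congr rfl fun q hq => ?_
  have h1 := HasAntidiagonal.mem_antidiagonal.1 hp
  have h2 := HasAntidiagonal.mem_antidiagonal.1 hq
  by_cases h0 : p.1 = 0 ∧ q.1 = 0
  · have hpos : 0 < N := Nat.pos_of_ne_zero (NeZero.ne N)
    have h3 : PowerSeries.coeff q.1 (z.ext0 p.1) = 0 := by
      rw [h0.1, h0.2, ZN.ext0, dif_pos hpos]
      exact hz
    rw [h3, zero_mul, zero_mul]
  · congr 1
    unfold ZN.ext0
    split_ifs with hlt
    · exact hw _ _ (by simp only; omega)
    · rfl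

/-- Solution of a triangular equation in `Z_N[[ε]]`. -/
theorem exists_triangular {z : ZN N (PowerSeries V)} (hz : PowerSeries.coeff 0 (z.coeff 0) = 0)
    (f g : V → V) :
    ∃ y : ZN N (PowerSeries V), y = 1 + ZN.map (psMap f) (z * ZN.map (psMap g) y) := by
  have : Inhabited V := ⟨0⟩
  let toZ : (Fin N × ℕ → V) → ZN N (PowerSeries V) := fun x =>
    ⟨fun i => PowerSeries.mk fun n => x (i, n)⟩
  have hto : ∀ x i n, PowerSeries.coeff n ((toZ x).coeff i) = x (i, n) := fun x i n => by
    simp [toZ]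
  obtain ⟨x, hx⟩ := exists_fixed (V := V) (fun a : Fin N × ℕ => (a.1 : ℕ) + a.2)
    (fun x a => PowerSeries.coeff a.2
      ((1 + ZN.map (psMap f) (z * ZN.map (psMap g) (toZ x))).coeff a.1)) (by
      intro x y a hxy
      simp only [ZN.coeff_add, map_add, ZN.coeff_map, coeff_psMap]
      congr 2
      refine coeff_mul_congr hz fun j k hjk => ?_
      simp only [ZN.coeff_map, coeff_psMap, hto]
      rw [hxy (j, k) hjk])
  refine ⟨toZ x, ZN.ext (funext fun i => PowerSeries.ext fun n => ?_)⟩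
  rw [hto]
  exact (congrFun hx (i, n)).symm

theorem coeff_zero_of_triangular {y z : ZN N (PowerSeries V)} {f g : V → V} (hf : f 0 = 0)
    (hz : PowerSeries.coeff 0 (z.coeff 0) = 0)
    (hy : y = 1 + ZN.map (psMap f) (z * ZN.map (psMap g) y)) :
    PowerSeries.coeff 0 (y.coeff 0) = 1 := by
  rw [hy, ZN.coeff_add, map_add, ZN.coeff_map, coeff_psMap, coeff_mul_congr (w' := 0) hz, mul_zero]
  · simp [ZN.coeff_one, hf]
  · intro j k hjk
    simp at hjk

/-- Elements with constant coefficient `1` are invertible. -/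
theorem isUnit_of_coeff_zero {y : ZN N (PowerSeries V)}
    (hy : PowerSeries.coeff 0 (y.coeff 0) = 1) : IsUnit y := by
  -- With identity maps the triangular equation reads `w = 1 + (1 - y) w`, that is `y w = 1`.
  obtain ⟨w, hw⟩ := exists_triangular (z := 1 - y)
    (by rw [ZN.coeff_sub, map_sub, hy]; simp [ZN.coeff_one]) id id
  have hid : ∀ x : ZN N (PowerSeries V), ZN.map (psMap id) x = x := fun x => by
    refine ZN.ext (funext fun i => PowerSeries.ext fun n => ?_)
    simp [coeff_psMap]
  rw [hid, hid] at hw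
  exact isUnit_iff_exists_inv.2 ⟨w, by linear_combination hw⟩

end Triangular

/-! ## Polynomial functions of the position -/

section Pol

/-- The difference equation `q(X) - q(X + c) = p(X)`. -/
theorem exists_sub_comp {B : Type*} [CommRing B] [Algebra ℂ B] {c : ℤ} (hc : c ≠ 0)
    (p : Polynomial B) : ∃ q : Polynomial B, q - q.comp (Polynomial.X + (c : Polynomial B)) = p := by
  have hn : ∀ n : ℕ, ∀ p : Polynomial B, p.degree < n →
      ∃ q : Polynomial B, q - q.comp (Polynomial.X + (c : Polynomial B)) = p := by
    intro n
    induction n with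
    | zero =>
      intro p hp
      refine ⟨0, ?_⟩
      rw [Polynomial.zero_comp, sub_zero]
      exact (Polynomial.degree_eq_bot.1 (Nat.WithBot.lt_zero_iff.1 hp)).symm
    | succ n ih =>
      intro p hp
      -- `X^(n+1) - (X + c)^(n+1)` has leading term `-(n+1) c X^n`, so this monomial cancels the
      -- term of degree `n` of `p`.
      set r : Polynomial B := Polynomial.monomial (n + 1)
        ((-(((n : ℂ) + 1) * c)⁻¹) • p.coeff n) with hr
      have hcoef : ∀ k, (r.comp (Polynomial.X + (c : Polynomial B))).coeff k =
          ((-(((n : ℂ) + 1) * c)⁻¹) • p.coeff n) *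
            ((c : B) ^ (n + 1 - k) * ((n + 1).choose k : B)) := fun k => by
        rw [hr, Polynomial.monomial_comp, ← Polynomial.C_eq_intCast, Polynomial.coeff_C_mul,
          Polynomial.coeff_X_add_C_pow]
      have hdeg : (p - (r - r.comp (Polynomial.X + (c : Polynomial B)))).degree < n := by
        rw [Polynomial.degree_lt_iff_coeff_zero]
        intro m hm
        rw [Polynomial.coeff_sub, Polynomial.coeff_sub, hcoef, hr, Polynomial.coeff_monomial]
        rcases Nat.lt_trichotomy m (n + 1) with h | h | h
        · obtain rfl : m = n := by omega
          rw [if_neg (by omega), Nat.add_sub_cancel_left, pow_one, Nat.choose_succ_self_right]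
          have hc' : (c : ℂ) ≠ 0 := Int.cast_ne_zero.2 hc
          have hn' : (m : ℂ) + 1 ≠ 0 := Nat.cast_add_one_ne_zero m
          have : (c : B) * ((m + 1 : ℕ) : B) = (((m : ℂ) + 1) * c) • (1 : B) := by
            rw [Algebra.smul_def, mul_one]
            push_cast
            simp
            ring
          rw [this, smul_mul_smul_comm, mul_one, neg_mul, inv_mul_cancel₀ (mul_ne_zero hn' hc')]
          simp
        · subst h
          have h0 : p.coeff (n + 1) = 0 :=
            Polynomial.coeff_eq_zero_of_degree_lt (by simpa using hp)
          simp [h0]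
        · have h0 : p.coeff m = 0 := Polynomial.coeff_eq_zero_of_degree_lt
            (hp.trans (by exact_mod_cast h))
          rw [if_neg (by omega), Nat.choose_eq_zero_of_lt h, h0]
          simp
      obtain ⟨q, hq⟩ := ih _ hdeg
      refine ⟨q + r, ?_⟩
      rw [Polynomial.add_comp]
      linear_combination hq
  exact hn (p.natDegree + 1) p (by
    refine Polynomial.degree_le_natDegree.trans_lt ?_
    exact_mod_cast Nat.lt_succ_self _)

/-- Taylor's formula for polynomials. -/
theorem comp_eq_sum_derivative {B : Type*} [CommRing B] [Algebra ℂ B] (c : ℤ) (p : Polynomial B)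
    {r : ℕ} (hr : p.natDegree < r) :
    ∑ k ∈ range r, ((k.factorial : ℂ)⁻¹ * (c : ℂ) ^ k) • Polynomial.derivative^[k] p =
      p.comp (Polynomial.X + (c : Polynomial B)) := by
  conv_lhs => rw [p.as_sum_range' r hr]
  conv_rhs => rw [p.as_sum_range' r hr]
  have hmon : ∀ k m (a : B), Polynomial.derivative^[k] (Polynomial.monomial m a) =
      Polynomial.C a * ((m.descFactorial k : Polynomial B) * Polynomial.X ^ (m - k)) :=
    fun k m a => by
      rw [← Polynomial.C_mul_X_pow_eq_monomial, Polynomial.iterate_derivative_C_mul,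
        Polynomial.iterate_derivative_X_pow_eq_natCast_mul]
  simp only [Polynomial.iterate_derivative_sum, smul_sum]
  rw [sum_comm, ← Polynomial.coe_compRingHom_apply, map_sum]
  refine sum_congr rfl fun m hm => ?_
  rw [Polynomial.coe_compRingHom_apply, Polynomial.monomial_comp, add_comm Polynomial.X, add_pow,
    mul_sum]
  symm
  refine sum_subset_zero_on_sdiff (range_subset_range.2 (by have := mem_range.1 hm; omega)) ?_ ?_
  · intro k hk
    simp only [mem_sdiff, mem_range, not_lt] at hk
    rw [hmon, Nat.descFactorial_eq_zero_iff_lt.2 (by omega)]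
    simp
  · intro k hk
    have h1 : ((m.descFactorial k : ℕ) : ℂ) = k.factorial * (m.choose k : ℂ) := by
      exact_mod_cast Nat.descFactorial_eq_factorial_mul_choose m k
    have h2 : (k.factorial : ℂ) ≠ 0 := Nat.cast_ne_zero.2 (Nat.factorial_ne_zero k)
    have h4 : ∀ x : Polynomial B, (m.descFactorial k : Polynomial B) * x =
        (m.descFactorial k : ℂ) • x := fun x => by rw [Algebra.smul_def]; simp
    rw [hmon, h4, mul_smul_comm, smul_smul, h1, show (k.factorial : ℂ)⁻¹ * (c : ℂ) ^ k *
      (k.factorial * (m.choose k : ℂ)) = (c : ℂ) ^ k * (m.choose k : ℂ) by field_simp,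
      Algebra.smul_def]
    simp only [map_mul, map_pow, map_intCast, map_natCast]
    ring

end Pol

section Concrete

variable (N : ℕ) [NeZero N]

/-- Polynomial functions of the position. -/
abbrev PolAlg (N : ℕ) : Type := PowerSeries (Polynomial (DiffPoly N))

variable {N}

/-- `X ↦ X + m`. -/
def polShift (m : ℤ) : PolAlg N → PolAlg N :=
  psMap fun p => p.comp (Polynomial.X + (m : Polynomial (DiffPoly N)))

/-- Polynomial functions as functions of the position. -/
def polIncl : PolAlg N → PosAlg N := psMap LaurentPolynomial.C

/-- The Taylor series of a density. -/
def toPol (f : Alg N) : PolAlg N :=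
  PowerSeries.mk fun n => ∑ p ∈ antidiagonal n, Polynomial.monomial p.1
      (((p.1.factorial : ℂ)⁻¹) • (dx0 N)^[p.1] (PowerSeries.coeff p.2 f))

theorem isShift_polShift : IsShift (polShift (N := N)) := by
  refine isShift_psMap ⟨fun m => isHom_polyComp _, fun x => by simp, fun m n x => ?_⟩
  rw [Polynomial.comp_assoc, Polynomial.add_comp, Polynomial.X_comp, Polynomial.intCast_comp]
  push_cast
  rw [add_assoc]

theorem isHom_polIncl : IsHom (polIncl (N := N)) :=
  isHom_psMap ⟨map_add _, fun c x => by
    ext n; simp only [LaurentPolynomial.C_apply, AddMonoidAlgebra.coeff_smul_apply]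
    split_ifs <;> simp, map_mul _, map_one _⟩

theorem polIncl_toPol (f : Alg N) : polIncl (toPol f) = toPos N f := by
  ext1 n
  rw [polIncl, coeff_psMap, coeff_toPos, toPol, PowerSeries.coeff_mk, map_sum]

theorem polIncl_polShift (m : ℤ) (f : PolAlg N) :
    polIncl (polShift m f) = posShift N m (polIncl f) := by
  ext1 n
  rw [posShift_eq, polIncl, polShift, coeff_psMap, coeff_psMap, coeff_psMap, coeff_psMap,
    ← LaurentPolynomial.single_eq_C, ← LaurentPolynomial.single_eq_C]
  refine Eq.trans ?_ (laurentMap_single _ (by simp) 0 _).symm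
  simp

/-- The exponential `e^{κ X v_0}`. -/
def posExp (κ : ℤ) : PosAlg N := PowerSeries.C (LaurentPolynomial.T κ)

/-- The constant `e^{j v_0}`. -/
def polExp (j : ℤ) : PolAlg N := PowerSeries.C (Polynomial.C (LaurentPolynomial.T j))

theorem psMap_C {R S : Type*} [CommRing R] [CommRing S] {f : R → S} (hf : f 0 = 0) (a : R) :
    psMap f (PowerSeries.C a) = PowerSeries.C (f a) := by
  ext n
  simp only [psMap, PowerSeries.coeff_mk, PowerSeries.coeff_C]
  split_ifs
  · rfl
  · exact hf

theorem posShift_posExp (m κ : ℤ) :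
    posShift N m (posExp κ) = posExp κ * polIncl (polExp (κ * m)) := by
  unfold posExp polExp polIncl
  rw [posShift_eq, psMap_C (isHom_posShift0 m).zero, psMap_C (map_zero _), ← map_mul]
  congr 1
  refine (laurentMap_single _ (by simp) κ 1).trans ?_
  rw [LaurentPolynomial.single_eq_C_mul_T, Polynomial.one_comp, one_mul, LaurentPolynomial.T_mul]

theorem posExp_add (κ κ' : ℤ) : (posExp (κ + κ') : PosAlg N) = posExp κ * posExp κ' := by
  unfold posExp
  rw [LaurentPolynomial.T_add, map_mul]

theorem posExp_zero : (posExp 0 : PosAlg N) = 1 := by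
  unfold posExp
  rw [LaurentPolynomial.T_zero, map_one]

theorem polExp_zero : (polExp 0 : PolAlg N) = 1 := by
  unfold polExp
  rw [LaurentPolynomial.T_zero, map_one, map_one]

theorem posLift_posExp (F : Jet N → JetPoly N) (κ : ℤ) :
    ∃ e : PolAlg N, psMap (posLift F) (posExp κ) = posExp κ * polIncl e := by
  refine ⟨PowerSeries.C ((κ : Polynomial (DiffPoly N)) *
    (Polynomial.X * Polynomial.C (LaurentPolynomial.C (F (1, 0, 0))))), ?_⟩
  unfold posExp polIncl
  rw [psMap_C (isDer_posLift F).zero, psMap_C (map_zero _), ← map_mul]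
  congr 1
  have hP := isDer_polyMap (isDer_lder F)
  refine (laurentMap_single _ (derTwist_zero hP _) κ 1).trans ?_
  rw [LaurentPolynomial.single_eq_C_mul_T, LaurentPolynomial.T_mul, hP.one, zero_add, mul_one]

theorem posLift_polIncl (F : Jet N → JetPoly N) (f : PolAlg N) :
    psMap (posLift F) (polIncl f) = polIncl (psMap (polyMap (lder F)) f) := by
  ext1 n
  rw [polIncl, coeff_psMap, coeff_psMap, posLift_C, coeff_psMap, coeff_psMap]

/-! ## The two reflections of the problem -/

/-- The shift of functions of the position, reflected if `s = -1`. -/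
abbrev posSh (s m : ℤ) : ZN N (PosAlg N) → ZN N (PosAlg N) := ZN.map (posShift N (s * m))

/-- The shift of densities, reflected if `s = -1`. -/
abbrev algSh (s m : ℤ) : ZN N (Alg N) → ZN N (Alg N) := zshift N (s * m)

/-- The shift of polynomial functions, reflected if `s = -1`. -/
abbrev polSh (s m : ℤ) : ZN N (PolAlg N) → ZN N (PolAlg N) := ZN.map (polShift (s * m))

theorem isShift_posSh (s : ℤ) : IsShift (posSh (N := N) s) :=
  (ZN.isShift_map isShift_posShift).scale s

theorem isShift_zshift : IsShift (zshift N) := ZN.isShift_map isShift_shift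

theorem isShift_algSh (s : ℤ) : IsShift (algSh (N := N) s) := isShift_zshift.scale s

theorem isShift_polSh (s : ℤ) : IsShift (polSh (N := N) s) :=
  (ZN.isShift_map isShift_polShift).scale s

/-- The coefficient of `Λ` in the reflected Lax operator. -/
def laxA (s : ℤ) : ZN N (Alg N) := if s = 1 then 1 else expV N

/-- The coefficient of `Λ⁻¹` in the reflected Lax operator. -/
def laxB (s : ℤ) : ZN N (Alg N) := if s = 1 then expV N else 1

/-- The Lax operator, reflected if `s = -1`. -/
def laxUp (s : ℤ) : UpOp (isShift_algSh (N := N) s) :=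
  laxOp (isShift_algSh s) (laxA s) (fld N 0) (laxB s)

theorem isHom_ztoPos : IsHom (ZN.map (toPos N) : ZN N (Alg N) → ZN N (PosAlg N)) :=
  ZN.isHom_map isHom_toPos

theorem isHom_zpolIncl : IsHom (ZN.map polIncl : ZN N (PolAlg N) → ZN N (PosAlg N)) :=
  ZN.isHom_map isHom_polIncl

/-- Operators with densities as coefficients, as operators on functions of the position. -/
def posMap (s : ℤ) : UpOp (isShift_algSh (N := N) s) →+* UpOp (isShift_posSh (N := N) s) :=
  UpOp.map _ _ isHom_ztoPos fun _ _ => ZN.ext (funext fun _ => toPos_shift _ _)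

/-- Operators with polynomial coefficients, as operators on functions of the position. -/
def inclMap (s : ℤ) : UpOp (isShift_polSh (N := N) s) →+* UpOp (isShift_posSh (N := N) s) :=
  UpOp.map _ _ isHom_zpolIncl fun _ _ => ZN.ext (funext fun _ => polIncl_polShift _ _)

theorem map_mono {R S : Type*} [CommRing R] [Algebra ℂ R] [CommRing S] [Algebra ℂ S]
    {sh : ℤ → R → R} {sh' : ℤ → S → S} (h : IsShift sh) (h' : IsShift sh')
    {f : R → S} (hf : IsHom f) (hfs : ∀ m x, f (sh m x) = sh' m (f x)) (a : R) (m : ℤ) :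
    UpOp.map h h' hf hfs (mono h a m) = mono h' (f a) m := by
  ext1
  funext n
  rw [coeff_map, coeff_mono, coeff_mono, DOp.mono, DOp.mono]
  split_ifs
  · rfl
  · exact hf.zero

theorem map_laxOp {R S : Type*} [CommRing R] [Algebra ℂ R] [CommRing S] [Algebra ℂ S]
    {sh : ℤ → R → R} {sh' : ℤ → S → S} (h : IsShift sh) (h' : IsShift sh')
    {f : R → S} (hf : IsHom f) (hfs : ∀ m x, f (sh m x) = sh' m (f x)) (a u b : R) :
    UpOp.map h h' hf hfs (laxOp h a u b) = laxOp h' (f a) (f u) (f b) := by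
  unfold laxOp
  rw [map_add, map_add, map_mono, map_mono, map_mono]

theorem map_shInv {R S : Type*} [CommRing R] [Algebra ℂ R] [CommRing S] [Algebra ℂ S]
    {sh : ℤ → R → R} {sh' : ℤ → S → S} (h : IsShift sh) (h' : IsShift sh')
    {f : R → S} (hf : IsHom f) (hfs : ∀ m x, f (sh m x) = sh' m (f x)) :
    UpOp.map h h' hf hfs (shInv h) = shInv h' := by
  rw [map_mono, hf.one]

/-- The reflected action of a derivation on functions of the position. -/
theorem isShiftDer_posLift (s : ℤ) (F : Jet N → JetPoly N) :
    IsShiftDer (posSh (N := N) s) (ZN.map (psMap (posLift F))) where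
  isDer := ZN.isDer_map (isDer_psMap (isDer_posLift F))
  comm m x := by
    refine ZN.ext (funext fun i => PowerSeries.ext fun n => ?_)
    simp only [ZN.coeff_map, posShift_eq, coeff_psMap, posLift_posShift0]

/-- `Γ⁰`-component of a product. -/
theorem ZN.mul_coeff_zero {R : Type*} [CommRing R] (a b : ZN N R) :
    (a * b).coeff 0 = a.coeff 0 * b.coeff 0 := by
  rw [ZN.mul_coeff]
  have hpos : 0 < N := Nat.pos_of_ne_zero (NeZero.ne N)
  simp [ZN.ext0, hpos]

theorem coeff_zero_expV : (expV N).coeff 0 = PowerSeries.C (LaurentPolynomial.T 1) := by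
  have h1 : ∀ m, (vNil N ^ m).coeff 0 = if m = 0 then 1 else 0 := by
    intro m
    induction m with
    | zero => simp [ZN.coeff_one]
    | succ m ih => rw [pow_succ, ZN.mul_coeff_zero]; simp [vNil]
  have h2 : (0 : ℕ) < N := Nat.pos_of_ne_zero (NeZero.ne N)
  unfold expV
  rw [ZN.coeff_smul, ZN.coeff_sum, Finset.sum_eq_single 0]
  · simp [ZN.coeff_one]
  · intro m _ hm
    rw [ZN.coeff_smul, h1, if_neg hm, smul_zero]
  · intro h
    exact absurd (mem_range.2 h2) h

theorem ZN.map_smul {R S : Type*} [CommRing R] [Algebra ℂ R] [CommRing S] [Algebra ℂ S] {f : R → S}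
    (hf : IsHom f) (a : R) (x : ZN N R) : ZN.map f (a • x) = f a • ZN.map f x :=
  ZN.ext (funext fun _ => hf.mul _ _)

theorem ZN.smul_smul' {R : Type*} [CommRing R] (a b : R) (x : ZN N R) :
    a • b • x = (a * b) • x :=
  ZN.ext (funext fun _ => (mul_assoc _ _ _).symm)

theorem ZN.mul_smul' {R : Type*} [CommRing R] [Algebra ℂ R] (a : R) (x y : ZN N R) :
    x * a • y = a • (x * y) := by
  rw [mul_comm, ZN.smul_mul', mul_comm]

/-- Dressing operators exist.  Moreover their variations are polynomial. -/
theorem exists_pos_dressing {s : ℤ} (hs : s = 1 ∨ s = -1) :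
    ∃ S S' : UpOp (isShift_posSh (N := N) s), IsDressed (isShift_posSh s) (posMap s (laxUp s)) S S' ∧
      (s = -1 → S.coeff 0 = 1) ∧ ∀ F : Jet N → JetPoly N, ∃ M : UpOp (isShift_polSh (N := N) s),
        S' * der (isShiftDer_posLift s F) S = inclMap s M := by
  -- For `s = 1` the lowest coefficient `e^v` contains `e^{v_0}`, whose dressing factor `e^{X v_0}`
  -- is not polynomial in `X`. Only this factor is split off; for `s = -1` the lowest coefficient is
  -- `1` and there is none.
  set κ : ℤ := if s = 1 then 1 else 0 with hκ
  have hκs : κ * s = κ := by rcases hs with rfl | rfl <;> simp [hκ]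
  have hs0 : -s ≠ 0 := by rcases hs with rfl | rfl <;> simp
  have hsm : s * (-1) = -s := by ring
  set b : ZN N (PolAlg N) := polExp (N := N) (-κ) • ZN.map toPol (laxB (N := N) s) with hb
  have hb0 : PowerSeries.coeff 0 (b.coeff 0) = 1 := by
    rw [hb, ZN.coeff_smul, smul_eq_mul, ZN.coeff_map, PowerSeries.coeff_mul, Nat.antidiagonal_zero,
      sum_singleton]
    have h1 : ∀ f : Alg N, PowerSeries.coeff 0 (toPol f) =
        Polynomial.C (PowerSeries.coeff 0 f) := fun f => by simp [toPol]
    rw [h1]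
    rcases hs with rfl | rfl
    · simp only [hκ, laxB, if_true, coeff_zero_expV, polExp, PowerSeries.coeff_zero_C, ← map_mul,
        ← LaurentPolynomial.T_add]
      simp
    · simp [hκ, laxB, ZN.coeff_one, polExp]
  obtain ⟨K, hK⟩ := Classical.axiomOfChoice fun p : Polynomial (DiffPoly N) =>
    exists_sub_comp (B := DiffPoly N) hs0 p
  -- A solution of the difference equation is unique at best up to constants. The choice `K0 0 = 0`
  -- keeps the constant coefficient of `g` equal to `1` and gives `g = 1` when `b = 1`.
  set K0 : Polynomial (DiffPoly N) → Polynomial (DiffPoly N) := fun p => K p - K 0 with hK0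
  have hK0' : ∀ p, K0 p - (K0 p).comp (Polynomial.X + ((-s : ℤ) : Polynomial (DiffPoly N))) = p := by
    intro p
    rw [hK0]
    simp only [Polynomial.sub_comp]
    linear_combination hK p - hK 0
  have hKz : ∀ x : ZN N (PolAlg N),
      ZN.map (psMap K0) x - polSh s (-1) (ZN.map (psMap K0) x) = x := by
    intro x
    refine ZN.ext (funext fun i => PowerSeries.ext fun n => ?_)
    simp only [ZN.coeff_sub, map_sub, ZN.coeff_map, polShift, coeff_psMap, hsm, hK0']
  have hz0 : PowerSeries.coeff 0 ((b - 1).coeff 0) = 0 := by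
    rw [ZN.coeff_sub, map_sub, hb0]; simp [ZN.coeff_one]
  -- The equation is `g = 1 + K0 ((b - 1) Λ⁻¹(g))` with the reflected `Λ`. Applying `1 - Λ⁻¹` turns
  -- it into `b Λ⁻¹(g) = g`.
  obtain ⟨g, hg⟩ := exists_triangular (N := N) (z := b - 1) hz0 K0
    (fun p => p.comp (Polynomial.X + ((-s : ℤ) : Polynomial (DiffPoly N))))
  have hgu : IsUnit g := isUnit_of_coeff_zero (coeff_zero_of_triangular (by simp [hK0]) hz0 hg)
  have hgs : ZN.map (psMap fun p => p.comp
      (Polynomial.X + ((-s : ℤ) : Polynomial (DiffPoly N)))) g = polSh s (-1) g := by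
    unfold polSh polShift
    rw [hsm]
  rw [hgs] at hg
  have hbg : b * polSh s (-1) g = g := by
    have h1 := hKz ((b - 1) * polSh s (-1) g)
    have h2 : ZN.map (psMap K0) ((b - 1) * polSh s (-1) g) = g - 1 := by
      conv_rhs => rw [hg]
      ring
    rw [h2, ((isShift_polSh s).hom _).sub, ((isShift_polSh s).hom _).one] at h1
    linear_combination -h1
  obtain ⟨G, G', hG, hG0⟩ := exists_dressing (isShift_polSh (N := N) s)
    (a := polExp (N := N) κ • ZN.map toPol (laxA s)) (u := ZN.map toPol (fld N 0)) hgu hbg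
    fun x => ⟨_, hKz x⟩
  set Ω : UpOp (isShift_posSh (N := N) s) := mono _ (posExp (N := N) κ • (1 : ZN N (PosAlg N))) 0 with hΩ
  set Ω' : UpOp (isShift_posSh (N := N) s) := mono _ (posExp (N := N) (-κ) • (1 : ZN N (PosAlg N))) 0 with hΩ'
  have hmul : ∀ k l : ℤ, (posExp (N := N) k • (1 : ZN N (PosAlg N))) *
      posExp (N := N) l • (1 : ZN N (PosAlg N)) = posExp (N := N) (k + l) • (1 : ZN N (PosAlg N)) := fun k l => by
    rw [ZN.smul_mul', one_mul, ZN.smul_smul' (N := N), posExp_add]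
  have hΩΩ' : Ω * Ω' = 1 := by
    rw [hΩ, hΩ', mono_mul_mono, (isShift_posSh s).zero_apply, hmul, add_neg_cancel, posExp_zero,
      one_smul]
    rfl
  have hΩ'Ω : Ω' * Ω = 1 := by
    rw [hΩ, hΩ', mono_mul_mono, (isShift_posSh s).zero_apply, hmul, neg_add_cancel, posExp_zero,
      one_smul]
    rfl
  have hincl : ∀ x : ZN N (Alg N), ZN.map polIncl (ZN.map toPol x) = ZN.map (toPos N) x := fun x =>
    ZN.ext (funext fun i => polIncl_toPol _)
  have hshΩ : ∀ m, posSh s m (posExp (N := N) κ • (1 : ZN N (PosAlg N))) =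
      (posExp (N := N) κ * polIncl (polExp (κ * m))) • (1 : ZN N (PosAlg N)) := fun m => by
    unfold posSh
    rw [ZN.map_smul (isShift_posShift.hom _), (ZN.isHom_map (isShift_posShift.hom _)).one,
      posShift_posExp, ← mul_assoc, hκs]
  -- Conjugation by `e^{κ X v_0}` multiplies the coefficient of `Λ^m` by the constant `e^{κ m v_0}`,
  -- so the conjugated operator is polynomial in `X`.
  have hlax : posMap s (laxUp s) * Ω = Ω * inclMap s (laxOp (isShift_polSh s)
      (polExp (N := N) κ • ZN.map toPol (laxA s)) (ZN.map toPol (fld N 0)) b) := by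
    unfold posMap laxUp inclMap
    rw [map_laxOp, map_laxOp, hb, ZN.map_smul isHom_polIncl, ZN.map_smul isHom_polIncl, hincl, hincl,
      hincl, hΩ]
    unfold laxOp
    simp only [add_mul, mul_add, mono_mul_mono, hshΩ, (isShift_posSh s).zero_apply]
    simp only [mul_zero, mul_one, mul_neg, polExp_zero, isHom_polIncl.one, ZN.smul_mul', one_mul,
      add_zero, zero_add, ZN.smul_smul', ZN.mul_smul', mul_comm (posExp (N := N) κ)]
  refine ⟨Ω * inclMap s G, inclMap s G' * Ω', ⟨?_, ?_, ?_, ?_, ?_⟩, ?_, ?_⟩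
  · intro n hn
    refine coeff_mul_eq_zero (a := 0) (b := 0) (fun k hk => if_neg hk.ne) (fun k hk => ?_) (by omega)
    change ZN.map polIncl (G.coeff k) = 0
    rw [hG.low k hk, isHom_zpolIncl.zero]
  · intro n hn
    refine coeff_mul_eq_zero (a := 0) (b := 0) (fun k hk => ?_) (fun k hk => if_neg hk.ne) (by omega)
    change ZN.map polIncl (G'.coeff k) = 0
    rw [hG.low' k hk, isHom_zpolIncl.zero]
  · rw [mul_assoc, ← mul_assoc (inclMap s G), ← map_mul, hG.mul, map_one, one_mul, hΩΩ']
  · rw [mul_assoc, ← mul_assoc Ω', hΩ'Ω, one_mul, ← map_mul, hG.mul', map_one]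
  · have h1 := congrArg (inclMap s) hG.lax
    rw [map_mul, map_mul] at h1
    have h2 : inclMap s (shInv (isShift_polSh (N := N) s)) = shInv (isShift_posSh s) :=
      map_shInv _ _ _ _
    rw [h2] at h1
    calc posMap s (laxUp s) = posMap s (laxUp s) * (Ω * Ω') := by rw [hΩΩ', mul_one]
      _ = Ω * (inclMap s G * shInv (isShift_posSh s) * inclMap s G') * Ω' := by
        rw [← mul_assoc, hlax, h1]
      _ = _ := by noncomm_ring
  -- For `s = -1` one has `κ = 0` and `b = 1`, so `K0 0 = 0` forces `g = 1`. This is the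
  -- normalisation `S = 1 + …`.
  · intro hs1
    subst hs1
    have hκ0 : κ = 0 := by rw [hκ, if_neg (by norm_num)]
    have h0 : Ω = 1 := by rw [hΩ, hκ0, posExp_zero, one_smul]; rfl
    have hb1 : b = 1 := by
      rw [hb, hκ0, neg_zero, polExp_zero, one_smul]
      have : ZN.map polIncl (ZN.map toPol (laxB (-1))) = (1 : ZN N (PosAlg N)) := by
        rw [hincl, laxB, if_neg (by norm_num), isHom_ztoPos.one]
      refine ZN.ext (funext fun i => PowerSeries.ext fun n => ?_)
      have h3 := congrArg (fun x => (PowerSeries.coeff n (x.coeff i)).coeff 0) this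
      simp only [ZN.coeff_map, polIncl, coeff_psMap, LaurentPolynomial.C_apply, if_true] at h3
      rw [ZN.coeff_map, h3, ← isHom_zpolIncl.one]
      simp [polIncl, coeff_psMap]
    have hg1 : g = 1 := by
      rw [hg, hb1, sub_self, zero_mul]
      refine ZN.ext (funext fun i => PowerSeries.ext fun n => ?_)
      simp [coeff_psMap, hK0]
    rw [h0, one_mul]
    change ZN.map polIncl (G.coeff 0) = 1
    rw [hG0, hg1, isHom_zpolIncl.one]
  · intro F
    obtain ⟨e, he⟩ := posLift_posExp F κ
    have hH : ∃ a, ∀ n < a, ZN.map (psMap (polyMap (lder F))) (G.coeff n) = 0 := ⟨0, fun n hn => by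
      rw [hG.low n hn, (ZN.isDer_map (isDer_psMap (isDer_polyMap (isDer_lder F)))).zero]⟩
    -- From `S = Ω G`, `S⁻¹ δS = G⁻¹ (Ω⁻¹ δΩ) G + G⁻¹ δG`. The factor `Ω⁻¹ δΩ` is the polynomial
    -- `e`, so the exponential disappears.
    refine ⟨G' * (mono _ (e • (1 : ZN N (PolAlg N))) 0 * G + ⟨_, hH⟩), ?_⟩
    have h1 : der (isShiftDer_posLift s F) Ω = Ω * inclMap s (mono _ (e • (1 : ZN N (PolAlg N))) 0) := by
      have : inclMap s (mono (isShift_polSh (N := N) s) (e • (1 : ZN N (PolAlg N))) 0) = mono _ (polIncl e • (1 : ZN N (PosAlg N))) 0 := by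
        unfold inclMap
        rw [map_mono, ZN.map_smul isHom_polIncl, isHom_zpolIncl.one]
      rw [this, hΩ, mono_mul_mono, (isShift_posSh s).zero_apply, ZN.smul_mul', one_mul, ZN.smul_smul' (N := N),
        ← he, zero_add]
      ext1
      funext n
      rw [coeff_der, coeff_mono, coeff_mono, DOp.mono, DOp.mono]
      split_ifs
      · refine ZN.ext (funext fun i => ?_)
        simp only [ZN.coeff_map, ZN.coeff_smul, ZN.coeff_one, smul_eq_mul]
        split_ifs
        · simp
        · simp [(isDer_psMap (isDer_posLift F)).zero]
      · exact (isShiftDer_posLift s F).isDer.zero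
    have h2 : der (isShiftDer_posLift s F) (inclMap s G) = inclMap s ⟨_, hH⟩ := by
      ext1
      funext n
      exact ZN.ext (funext fun i => posLift_polIncl F _)
    rw [der_mul, h1, h2, map_mul, map_add, map_mul, mul_assoc, mul_assoc Ω, ← mul_add,
      ← mul_assoc Ω', hΩ'Ω, one_mul]

end Concrete

/-! ## Vanishing up to a given order in `ε` -/

section Vanish

variable {N : ℕ} {R : Type*} [CommRing R] [Algebra ℂ R]

/-- The components vanish up to order `n` in `ε`. -/
def VanishTo (n : ℕ) (x : ZN N (PowerSeries R)) : Prop :=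
  ∀ i, ∀ k ≤ n, PowerSeries.coeff k (x.coeff i) = 0

theorem VanishTo.sum {ι : Type*} {n : ℕ} {s : Finset ι} {f : ι → ZN N (PowerSeries R)}
    (h : ∀ i ∈ s, VanishTo n (f i)) : VanishTo n (∑ i ∈ s, f i) := fun i k hk => by
  rw [ZN.coeff_sum, map_sum]
  exact sum_eq_zero fun j hj => h j hj i k hk

theorem VanishTo.mul_left {n : ℕ} {x : ZN N (PowerSeries R)} (hx : VanishTo n x)
    (y : ZN N (PowerSeries R)) : VanishTo n (y * x) := fun i k hk => by
  rw [ZN.mul_coeff, map_sum]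
  refine sum_eq_zero fun p _ => ?_
  rw [PowerSeries.coeff_mul]
  refine sum_eq_zero fun q hq => ?_
  have : PowerSeries.coeff q.2 (x.ext0 p.2) = 0 := by
    unfold ZN.ext0
    split_ifs with h
    · exact hx _ _ (by have := mem_antidiagonal.1 hq; omega)
    · simp
  rw [this, mul_zero]

theorem VanishTo.mul_right {n : ℕ} {x : ZN N (PowerSeries R)} (hx : VanishTo n x)
    (y : ZN N (PowerSeries R)) : VanishTo n (x * y) := by
  rw [mul_comm]; exact hx.mul_left y

theorem VanishTo.map {S : Type*} [CommRing S] [Algebra ℂ S] {n : ℕ} {x : ZN N (PowerSeries R)}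
    (hx : VanishTo n x) {f : R → S} (hf : f 0 = 0) : VanishTo n (ZN.map (psMap f) x) :=
  fun i k hk => by rw [ZN.coeff_map, coeff_psMap, hx i k hk, hf]

variable {sh : ℤ → ZN N (PowerSeries R) → ZN N (PowerSeries R)} {h : IsShift sh}

theorem vanishTo_mul_right {n : ℕ} {J b : ℤ} {A B : UpOp h} (hA : ∀ j ≤ J, VanishTo n (A.coeff j))
    (hB : ∀ j < b, B.coeff j = 0) : ∀ j ≤ J + b, VanishTo n ((A * B).coeff j) := by
  intro j hj
  obtain ⟨a, ha⟩ := A.isUp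
  rw [coeff_mul_sum ha hB]
  refine VanishTo.sum fun i hi => (hA i ?_).mul_right _
  have := Finset.mem_Icc.1 hi
  omega

theorem vanishTo_mul_left (hsh : ∀ n m x, VanishTo n x → VanishTo n (sh m x)) {n : ℕ} {J b : ℤ}
    {A B : UpOp h} (hA : ∀ j ≤ J, VanishTo n (A.coeff j))
    (hB : ∀ j < b, B.coeff j = 0) : ∀ j ≤ J + b, VanishTo n ((B * A).coeff j) := by
  intro j hj
  obtain ⟨a, ha⟩ := A.isUp
  rw [coeff_mul_sum hB ha]
  refine VanishTo.sum fun i hi => (hsh _ _ _ (hA (j - i) ?_)).mul_left _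
  have := Finset.mem_Icc.1 hi
  omega

end Vanish

/-! ### Locality of the two halves of the logarithm, and the Taylor formula for `δL` -/

section Log

variable {N : ℕ} [NeZero N]

theorem VanishTo.of_toPos {n : ℕ} {x : ZN N (Alg N)} (hx : VanishTo n (ZN.map (toPos N) x)) :
    VanishTo n x := by
  have h1 := hx.map (isHom_ev0 (N := N)).zero
  have h2 : ZN.map (psMap ev0) (ZN.map (toPos N) x) = x :=
    ZN.ext (funext fun i => ev0_toPos _)
  rwa [h2] at h1

theorem vanishTo_posSh (s : ℤ) (n : ℕ) (m : ℤ) (x : ZN N (PosAlg N)) (hx : VanishTo n x) :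
    VanishTo n (posSh s m x) := hx.map (isHom_posShift0 _).zero

/-- The derivation `-s d/dX`. -/
def posDs (s : ℤ) (x : ZN N (PosAlg N)) : ZN N (PosAlg N) := (-(s : ℂ)) • ZN.map (posD N) x

/-- The derivation `-s ε∂`. -/
def algDs (s : ℤ) (x : ZN N (Alg N)) : ZN N (Alg N) :=
  (-(s : ℂ)) • ZN.map (fun f => PowerSeries.X * dx N f) x

theorem isShiftDer_posDs (s : ℤ) : IsShiftDer (posSh (N := N) s) (posDs s) where
  isDer := (ZN.isDer_map isDer_posD).csmul _
  comm m x := by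
    have h : ∀ y, ZN.map (posD N) (posSh s m y) = posSh s m (ZN.map (posD N) y) := fun y => by
      refine ZN.ext (funext fun i => PowerSeries.ext fun n => ?_)
      simp only [ZN.coeff_map, posShift_eq, posD_eq, coeff_psMap, posD0_posShift0]
    unfold posDs
    rw [h, ((isShift_posSh s).hom m).smul]

theorem ztoPos_injective : Function.Injective (ZN.map (toPos N) : ZN N (Alg N) → ZN N (PosAlg N)) :=
  fun _ _ h => ZN.ext (funext fun i => toPos_injective (congrArg (fun z => ZN.coeff z i) h))

theorem ztoPos_algSh (s m : ℤ) (x : ZN N (Alg N)) :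
    ZN.map (toPos N) (algSh s m x) = posSh s m (ZN.map (toPos N) x) :=
  ZN.ext (funext fun _ => toPos_shift _ _)

theorem ztoPos_algDs (s : ℤ) (x : ZN N (Alg N)) :
    ZN.map (toPos N) (algDs s x) = posDs s (ZN.map (toPos N) x) := by
  unfold algDs posDs
  rw [isHom_ztoPos.smul]
  congr 1
  exact ZN.ext (funext fun i => (posD_toPos _).symm)

theorem isShiftDer_algDs (s : ℤ) : IsShiftDer (algSh (N := N) s) (algDs s) where
  isDer := (ZN.isDer_map (isDer_dx.smulDer _)).csmul _
  comm m x := by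
    refine ztoPos_injective ?_
    rw [ztoPos_algDs, ztoPos_algSh, ztoPos_algSh, ztoPos_algDs, (isShiftDer_posDs s).comm]

theorem posDs_of_periodic {s : ℤ} (hs : s = 1 ∨ s = -1) (x : ZN N (PosAlg N))
    (hx : posSh s (-1) x = x) : posDs s x = 0 := by
  have hs0 : s * (-1) ≠ 0 := by rcases hs with rfl | rfl <;> simp
  have : ZN.map (posD N) x = 0 := by
    refine ZN.ext (funext fun i => PowerSeries.ext fun n => ?_)
    have h1 := congrArg (fun y => PowerSeries.coeff n (y.coeff i)) hx
    simp only [ZN.coeff_map, posShift_eq, coeff_psMap] at h1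
    rw [ZN.coeff_map, posD_eq, coeff_psMap, posD0_eq_zero_of_periodic hs0 h1]
    simp
  unfold posDs
  rw [this, smul_zero]

theorem isShiftDer_posDelta (s : ℤ) :
    IsShiftDer (posSh (N := N) s) (ZN.map posDelta) where
  isDer := ZN.isDer_map isDer_posDelta
  comm _ _ := ZN.ext (funext fun _ => posDelta_posShift _ _)

/-- The derivation `lder F` of densities. -/
abbrev algLder (F : Jet N → JetPoly N) : ZN N (Alg N) → ZN N (Alg N) := ZN.map (psMap (lder F))

theorem isShiftDer_algLder (s : ℤ) {F : Jet N → JetPoly N} (hF : Prolonged F) :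
    IsShiftDer (algSh (N := N) s) (algLder F) where
  isDer := ZN.isDer_map (isDer_psMap (isDer_lder F))
  comm _ _ := ZN.ext (funext fun _ => (shift_lder hF _ _).symm)

theorem posMap_algDs (s : ℤ) (A : UpOp (isShift_algSh (N := N) s)) :
    posMap s (der (isShiftDer_algDs s) A) = der (isShiftDer_posDs s) (posMap s A) :=
  UpOp.ext (funext fun _ => ztoPos_algDs _ _)

theorem posMap_algLder (s : ℤ) {F : Jet N → JetPoly N} (hF : Prolonged F)
    (A : UpOp (isShift_algSh (N := N) s)) :
    posMap s (der (isShiftDer_algLder s hF) A) = der (isShiftDer_posLift s F) (posMap s A) :=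
  UpOp.ext (funext fun _ => ZN.ext (funext fun _ => toPos_lder hF _))

theorem posMap_smul (s : ℤ) (c : ℂ) (A : UpOp (isShift_algSh (N := N) s)) :
    posMap s (c • A) = c • posMap s A :=
  UpOp.ext (funext fun _ => isHom_ztoPos.smul _ _)

theorem posMap_injective (s : ℤ) : Function.Injective (posMap (N := N) s) :=
  map_injective _ _ ztoPos_injective

/-- `V` is the local form of `S ∘ d ∘ S⁻¹ - d` for `d = -s ε∂`. -/
def IsLog (s : ℤ) (V : UpOp (isShift_algSh (N := N) s)) : Prop :=
  ∀ S S' : UpOp (isShift_posSh (N := N) s), IsDressed (isShift_posSh s) (posMap s (laxUp s)) S S' →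
    dressD (isShiftDer_posDs s) S S' = posMap s V

/-- `L` consists of Taylor series, so `posDelta` kills it and, by naturality, also the dressed
derivation. The coefficients of the latter are then Taylor series of their values at `X = 0`. -/
theorem exists_isLog {s : ℤ} (hs : s = 1 ∨ s = -1) :
    ∃ V : UpOp (isShift_algSh (N := N) s), IsLog s V := by
  obtain ⟨S, S', hS, -, -⟩ := exists_pos_dressing (N := N) hs
  have hL : der (isShiftDer_posDelta s) (posMap (N := N) s (laxUp s)) = 0 :=
    UpOp.ext (funext fun n => ZN.ext (funext fun i => posDelta_toPos _))
  have h1 := hS.der_dressD_eq_zero (isShiftDer_posDs s) (posDs_of_periodic hs)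
    (isShiftDer_posDelta s) (fun x => by
      unfold posDs
      rw [(ZN.isDer_map isDer_posDelta).smul]
      congr 1
      exact ZN.ext (funext fun i => posDelta_posD _)) hL
  set V := dressD (isShiftDer_posDs s) S S' with hV
  refine ⟨⟨fun n => ZN.map (psMap ev0) (V.coeff n), V.isUp.imp fun a ha n hn => by
    beta_reduce
    rw [ha n hn, (ZN.isHom_map (isHom_psMap isHom_ev0)).zero]⟩, fun T T' hT => ?_⟩
  rw [← hS.dressD_eq hT (isShiftDer_posDs s) (posDs_of_periodic hs), ← hV]
  ext1
  funext n
  refine ZN.ext (funext fun i => ?_)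
  have h2 := congrArg (fun A => (A.coeff n).coeff i) h1
  exact eq_toPos_of_posDelta h2

section

variable {s : ℤ} {V : UpOp (isShift_algSh (N := N) s)}

theorem IsLog.commutator (hV : IsLog s V) (hs : s = 1 ∨ s = -1) :
    laxUp s * V - V * laxUp s = der (isShiftDer_algDs s) (laxUp s) := by
  obtain ⟨S, S', hS, -, -⟩ := exists_pos_dressing (N := N) hs
  refine posMap_injective s ?_
  rw [map_sub, map_mul, map_mul, posMap_algDs, ← hV S S' hS, hS.commutator]

theorem IsLog.low (hV : IsLog s V) (hs : s = 1 ∨ s = -1) (n : ℤ) (hn : n < 0) : V.coeff n = 0 := by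
  obtain ⟨S, S', hS, -, -⟩ := exists_pos_dressing (N := N) hs
  refine ztoPos_injective ?_
  change (posMap s V).coeff n = _
  rw [← hV S S' hS, isHom_ztoPos.zero]
  exact coeff_mul_eq_zero (a := 0) (b := 0) hS.low (fun k hk => by
    rw [coeff_der, hS.low' k hk, (isShiftDer_posDs s).isDer.zero]) (by omega)

theorem posDs_iterate (M : UpOp (isShift_polSh (N := N) s)) (k : ℕ) (n : ℤ) (i : Fin N) (m : ℕ) :
    PowerSeries.coeff m ((((der (isShiftDer_posDs s))^[k] (inclMap s M)).coeff n).coeff i) =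
      LaurentPolynomial.C ((((-s : ℤ) : ℂ) ^ k) • Polynomial.derivative^[k]
        (PowerSeries.coeff m ((M.coeff n).coeff i))) := by
  induction k with
  | zero =>
    simp only [Function.iterate_zero, id_eq, pow_zero, one_smul]
    change PowerSeries.coeff m (polIncl ((M.coeff n).coeff i)) = _
    rw [polIncl, coeff_psMap]
  | succ k ih =>
    rw [Function.iterate_succ_apply', coeff_der, posDs, ZN.coeff_smul, ZN.coeff_map,
      PowerSeries.coeff_smul, posD_eq, coeff_psMap, ih, posD0_C, Polynomial.derivative_smul,
      Function.iterate_succ_apply']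
    refine LaurentPolynomial.ext fun l => ?_
    rw [AddMonoidAlgebra.coeff_smul_apply, LaurentPolynomial.C_apply, LaurentPolynomial.C_apply]
    split_ifs
    · rw [smul_smul, pow_succ']
      push_cast
      ring_nf
    · simp

theorem posLift_posDs (s : ℤ) (F : Jet N → JetPoly N) (x : ZN N (PosAlg N)) :
    ZN.map (psMap (posLift F)) (posDs s x) = posDs s (ZN.map (psMap (posLift F)) x) := by
  have h : ZN.map (psMap (posLift F)) (ZN.map (posD N) x) =
      ZN.map (posD N) (ZN.map (psMap (posLift F)) x) := by
    refine ZN.ext (funext fun i => PowerSeries.ext fun n => ?_)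
    simp only [ZN.coeff_map, posD_eq, coeff_psMap, posD0_posLift]
  unfold posDs
  rw [(ZN.isDer_map (isDer_psMap (isDer_posLift F))).smul, h]

theorem posMap_adStep {F : Jet N → JetPoly N} (hF : Prolonged F) (k : ℕ) :
    posMap s ((adStep (isShiftDer_algDs s) V)^[k] (der (isShiftDer_algLder s hF) V)) =
      (adStep (isShiftDer_posDs s) (posMap s V))^[k]
        (der (isShiftDer_posLift s F) (posMap s V)) := by
  induction k with
  | zero => exact posMap_algLder s hF V
  | succ k ih =>
    rw [Function.iterate_succ_apply', Function.iterate_succ_apply', ← ih]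
    unfold adStep
    rw [map_add, map_sub, map_mul, map_mul, posMap_algDs]

/-- The Taylor formula for the variation of `L`, up to any order in `ε` and any power of `Λ`. -/
theorem IsLog.vanishTo_taylor (hV : IsLog s V) (hs : s = 1 ∨ s = -1) {F : Jet N → JetPoly N}
    (hF : Prolonged F) (n : ℕ) (J : ℤ) : ∃ r, ∀ j ≤ J, VanishTo n
      ((der (isShiftDer_algLder s hF) (laxUp s) - ∑ k ∈ range (r + 1), (((k + 1).factorial : ℂ)⁻¹) •
        ((adStep (isShiftDer_algDs s) V)^[k] (der (isShiftDer_algLder s hF) V) *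
          laxUp s)).coeff j) := by
  obtain ⟨S, S', hS, -, hM⟩ := exists_pos_dressing (N := N) hs
  obtain ⟨M, hM⟩ := hM F
  obtain ⟨a, ha⟩ := M.isUp
  -- `r` is the largest degree in `X` over a finite window of coefficients of `M`, which vanish
  -- below `a`. The window reaches `J + 1` because the later factor `Λ⁻¹` lowers powers by one.
  obtain ⟨r, hr⟩ : ∃ r, ∀ j ≤ J + 1, ∀ i, ∀ k ≤ n,
      (PowerSeries.coeff k ((M.coeff j).coeff i)).natDegree < r + 1 := by
    refine ⟨((Finset.Icc a (J + 1) ×ˢ (Finset.univ : Finset (Fin N))) ×ˢ range (n + 1)).sup fun p =>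
      (PowerSeries.coeff p.2 ((M.coeff p.1.1).coeff p.1.2)).natDegree, fun j hj i k hk => ?_⟩
    refine Nat.lt_succ_of_le ?_
    by_cases hja : j < a
    · rw [ha j hja]; simp
    · exact Finset.le_sup (f := fun p : (ℤ × Fin N) × ℕ =>
        (PowerSeries.coeff p.2 ((M.coeff p.1.1).coeff p.1.2)).natDegree)
        (b := ((j, i), k)) (by simp; omega)
  have hT := hS.der_lax_sub (isShiftDer_posDs s) (isShiftDer_posLift s F) (posLift_posDs s F) (r + 1)
  rw [hM, hV S S' hS] at hT
  simp only [← posMap_adStep hF] at hT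
  rw [← posMap_algLder s hF] at hT
  simp only [← map_mul, ← posMap_smul] at hT
  rw [← map_sum, ← map_sub] at hT
  refine ⟨r, fun j hj => VanishTo.of_toPos ?_⟩
  change VanishTo n ((posMap s _).coeff j)
  rw [hT]
  have hlow : ∀ j < -1, (shInv (isShift_posSh (N := N) s)).coeff j = 0 := fun j hj => if_neg hj.ne
  refine vanishTo_mul_right (vanishTo_mul_right (vanishTo_mul_left (vanishTo_posSh s) (J := J + 1)
    ?_ hS.low) hlow) hS.low' j (by omega)
  intro j hj i k hk
  rw [coeff_sub, coeff_sum, ZN.coeff_sub, ZN.coeff_sum, map_sub, map_sum, sub_eq_zero]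
  simp only [coeff_smul, ZN.coeff_smul, PowerSeries.coeff_smul, posDs_iterate]
  have h3 : PowerSeries.coeff k (((shiftInv (isShift_posSh s) (inclMap s M)).coeff j).coeff i) =
      LaurentPolynomial.C ((PowerSeries.coeff k ((M.coeff j).coeff i)).comp
        (Polynomial.X + ((-s : ℤ) : Polynomial (DiffPoly N)))) := by
    change PowerSeries.coeff k (posShift N (s * (-1)) (polIncl ((M.coeff j).coeff i))) = _
    rw [← polIncl_polShift, polIncl, polShift, coeff_psMap, coeff_psMap, mul_neg_one]
  -- Beyond the degree in `X` the Taylor sum is exactly the translation by `-s`, so the remainder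
  -- vanishes in this window.
  rw [h3, ← comp_eq_sum_derivative (-s) _ ((hr j hj i k hk).trans (lt_add_one _)), map_sum]
  refine sum_congr rfl fun l _ => ?_
  refine LaurentPolynomial.ext fun m => ?_
  rw [AddMonoidAlgebra.coeff_smul_apply, LaurentPolynomial.C_apply, LaurentPolynomial.C_apply]
  split_ifs
  · rw [smul_smul]
  · simp

end

end Log

/-! ### Total derivatives, and residues of the variation of a half of the logarithm -/

section Exact

variable {N : ℕ} [NeZero N]

variable (N) in
/-- Densities whose coefficients are total derivatives. -/
def exactSpace : Submodule ℂ (ZN N (Alg N)) where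
  carrier := {x | ∀ i n, ∃ y, dx0 N y = PowerSeries.coeff n (x.coeff i)}
  add_mem' := fun {x y} hx hy i n => by
    obtain ⟨a, ha⟩ := hx i n
    obtain ⟨b, hb⟩ := hy i n
    exact ⟨a + b, by rw [isDer_dx0.add, ha, hb, ZN.coeff_add, map_add]⟩
  zero_mem' := fun i n => ⟨0, by rw [isDer_dx0.zero, ZN.coeff_zero, map_zero]⟩
  smul_mem' := fun c x hx i n => by
    obtain ⟨a, ha⟩ := hx i n
    exact ⟨c • a, by rw [isDer_dx0.smul, ha, ZN.coeff_smul, PowerSeries.coeff_smul]⟩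

/-- Exactness is tested on each coefficient in `ε` separately, so the space of exact elements is
closed in the `ε`-adic topology. -/
theorem mem_exactSpace_of_approx {x : ZN N (Alg N)}
    (h : ∀ n, ∃ y ∈ exactSpace N, VanishTo n (x - y)) : x ∈ exactSpace N := fun i n => by
  obtain ⟨y, hy, hxy⟩ := h n
  obtain ⟨z, hz⟩ := hy i n
  have := hxy i n le_rfl
  rw [ZN.coeff_sub, map_sub, sub_eq_zero] at this
  exact ⟨z, by rw [hz, this]⟩

theorem algDs_mem (s : ℤ) (x : ZN N (Alg N)) : algDs s x ∈ exactSpace N := by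
  refine (exactSpace N).smul_mem _ fun i n => ?_
  cases n with
  | zero => exact ⟨0, by rw [isDer_dx0.zero, ZN.coeff_map, PowerSeries.coeff_zero_X_mul]⟩
  | succ n =>
    exact ⟨_, by rw [ZN.coeff_map, PowerSeries.coeff_succ_X_mul, dx_eq, coeff_psMap]⟩

/-- Every term of `e^{m ε∂} - 1` contains at least one factor `∂`. -/
theorem isExactSpace_zshift : IsExactSpace (zshift N) (exactSpace N) where
  shift_sub m x := fun i n => by
    refine ⟨∑ k ∈ range n, (((m : ℂ) ^ (k + 1)) * (((k + 1).factorial : ℂ)⁻¹)) •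
      (dx0 N)^[k] (PowerSeries.coeff (n - (k + 1)) (x.coeff i)), ?_⟩
    rw [isDer_dx0.sum, ZN.coeff_sub, map_sub, zshift, ZN.coeff_map, shift, PowerSeries.coeff_mk,
      Finset.Nat.sum_antidiagonal_eq_sum_range_succ (fun a b => (((m : ℂ) ^ a) *
        ((a.factorial : ℂ)⁻¹)) • (dx0 N)^[a] (PowerSeries.coeff b (x.coeff i))) n, sum_range_succ']
    simp [isDer_dx0.smul, Function.iterate_succ_apply']

theorem isExactSpace_algSh (s : ℤ) : IsExactSpace (algSh s) (exactSpace N) where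
  shift_sub _ x := isExactSpace_zshift.shift_sub _ x

variable {s : ℤ} {V : UpOp (isShift_algSh (N := N) s)}

theorem vanishTo_algSh (s : ℤ) (n : ℕ) (m : ℤ) (x : ZN N (Alg N)) (hx : VanishTo n x) :
    VanishTo n (algSh s m x) := fun i k hk => by
  rw [algSh, zshift, ZN.coeff_map, shift, PowerSeries.coeff_mk]
  refine sum_eq_zero fun p hp => ?_
  rw [hx i p.2 (by have := mem_antidiagonal.1 hp; omega)]
  have := (isDer_dx0 (N := N)).iterate p.1 |>.2 0 0
  rw [zero_smul, zero_smul] at this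
  rw [this, smul_zero]

theorem coeff_laxUp (hs : s = 1 ∨ s = -1) (n : ℤ) : (laxUp (N := N) s).coeff n = lax N (s * n) := by
  unfold laxUp laxOp lax laxA laxB
  rw [coeff_add, coeff_add, coeff_mono, coeff_mono, coeff_mono, Pi.add_apply, Pi.add_apply]
  unfold DOp.mono
  rcases hs with rfl | rfl
  · simp
  · have h1 : (-1 * n = 1) = (n = -1) := propext ⟨fun h => by omega, fun h => by omega⟩
    have h2 : (-1 * n = -1) = (n = 1) := propext ⟨fun h => by omega, fun h => by omega⟩
    have h3 : (-1 * n = 0) = (n = 0) := propext ⟨fun h => by omega, fun h => by omega⟩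
    simp only [h1, h2, h3]
    simp only [show ¬ ((-1 : ℤ) = 1) by norm_num, if_false]
    abel

theorem laxUp_low (n : ℤ) (hn : n < -1) : (laxUp (N := N) s).coeff n = 0 := by
  unfold laxUp laxOp
  rw [coeff_add, coeff_add, coeff_mono, coeff_mono, coeff_mono]
  unfold DOp.mono
  rw [if_neg (by omega), if_neg (by omega), if_neg (by omega)]
  simp

theorem coeff_laxUp_neg_one : (laxUp (N := N) s).coeff (-1) = laxB s := by
  unfold laxUp laxOp
  rw [coeff_add, coeff_add, coeff_mono, coeff_mono, coeff_mono]
  simp [DOp.mono]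

theorem laxUp_pow_low (m : ℕ) : ∀ n : ℤ, n < -m → (laxUp (N := N) s ^ m).coeff n = 0 := by
  induction m with
  | zero => exact fun n hn => if_neg (by simp at hn; omega)
  | succ m ih =>
    intro n hn
    rw [pow_succ]
    exact coeff_mul_eq_zero ih laxUp_low (by push_cast at hn; omega)

theorem adStep_low (hV : ∀ n < 0, V.coeff n = 0) {Y : UpOp (isShift_algSh (N := N) s)}
    (hY : ∀ n < 0, Y.coeff n = 0) : ∀ n < 0, (adStep (isShiftDer_algDs s) V Y).coeff n = 0 := by
  intro n hn
  unfold adStep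
  rw [coeff_add, coeff_sub, coeff_der, hY n hn, (isShiftDer_algDs s).isDer.zero,
    coeff_mul_eq_zero hV hY (by omega), coeff_mul_eq_zero hY hV (by omega), sub_zero, add_zero]

/-- `Res (L^(m+1) δV) = Res (L^m δL)` up to exact terms. -/
theorem IsLog.res_pow (hV : IsLog s V) (hs : s = 1 ∨ s = -1) {F : Jet N → JetPoly N}
    (hF : Prolonged F) (m : ℕ) :
    (laxUp s ^ (m + 1) * der (isShiftDer_algLder s hF) V).coeff 0 -
      (laxUp s ^ m * der (isShiftDer_algLder s hF) (laxUp s)).coeff 0 ∈ exactSpace N := by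
  refine mem_exactSpace_of_approx fun n => ?_
  -- `L^m` reaches down to the power `-m`, so its product with the remainder has a residue involving
  -- only powers up to `m`.
  obtain ⟨r, hr⟩ := hV.vanishTo_taylor hs hF n m
  have hE := isExactSpace_algSh (N := N) s
  have h0 := vanishTo_mul_left (vanishTo_algSh s) hr (laxUp_pow_low m) 0 (by omega)
  set DL := der (isShiftDer_algLder s hF) (laxUp s)
  set Y := fun k => (adStep (isShiftDer_algDs s) V)^[k] (der (isShiftDer_algLder s hF) V) with hY
  have hc : ∀ k, (laxUp s ^ m * (Y k * laxUp s)).coeff 0 -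
      (laxUp s ^ (m + 1) * Y k).coeff 0 ∈ exactSpace N := fun k => by
    have := hE.res_mul_comm (laxUp s ^ m * Y k) (laxUp s)
    rwa [mul_assoc, ← mul_assoc (laxUp s), ← pow_succ'] at this
  have hs1 : ∀ k, (laxUp s ^ (m + 1) * Y (k + 1)).coeff 0 ∈ exactSpace N := fun k => by
    have h1 : Y (k + 1) = adStep (isShiftDer_algDs s) V (Y k) := Function.iterate_succ_apply' _ _ _
    rw [h1]
    exact hE.res_adStep _ (algDs_mem s) (hV.commutator hs) _ _
  -- In the approximant the term `k = 0` of the sum cancels `L^(m+1) δV` by cyclicity of the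
  -- residue. The terms with `k ≥ 1` are residues of commutators with `d + V`, hence exact.
  refine ⟨(laxUp s ^ (m + 1) * Y 0).coeff 0 - ∑ k ∈ range (r + 1), (((k + 1).factorial : ℂ)⁻¹) •
    (laxUp s ^ m * (Y k * laxUp s)).coeff 0, ?_, ?_⟩
  · rw [sum_range_succ', sub_add_eq_sub_sub_swap]
    refine Submodule.sub_mem _ ?_ (Submodule.sum_mem _ fun k _ => Submodule.smul_mem _ _ ?_)
    · have := (exactSpace N).neg_mem (hc 0)
      simpa using this
    · have := (exactSpace N).add_mem (hc (k + 1)) (hs1 k)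
      rwa [sub_add_cancel] at this
  · have h1 : (laxUp s ^ (m + 1) * der (isShiftDer_algLder s hF) V).coeff 0 -
        (laxUp s ^ m * DL).coeff 0 - ((laxUp s ^ (m + 1) * Y 0).coeff 0 -
          ∑ k ∈ range (r + 1), (((k + 1).factorial : ℂ)⁻¹) •
            (laxUp s ^ m * (Y k * laxUp s)).coeff 0) =
        (-1) * (laxUp s ^ m * (DL - ∑ k ∈ range (r + 1), (((k + 1).factorial : ℂ)⁻¹) •
          (Y k * laxUp s))).coeff 0 := by
      rw [mul_sub, mul_sum, coeff_sub, coeff_sum]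
      simp only [UpOp.mul_smul', coeff_smul]
      simp only [hY, Function.iterate_zero, id_eq]
      ring
    rw [h1]
    exact h0.mul_left _

/-- The variation of the constant term of the logarithm. -/
theorem IsLog.res_zero (hV : IsLog s V) (hs : s = 1 ∨ s = -1) {F : Jet N → JetPoly N}
    (hF : Prolonged F) (hb : IsUnit (laxB (N := N) s)) {y : ZN N (Alg N)}
    (hy : y * laxB s = algLder F (laxB s)) : algLder F (V.coeff 0) - y ∈ exactSpace N := by
  refine mem_exactSpace_of_approx fun n => ?_
  -- Only the lowest coefficient is compared. The operators `Y k` have non-negative order, so the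
  -- coefficient of `Λ⁻¹` in `Y k L` is `(Y k)_0` times `laxB s`, and division by `laxB s` leaves
  -- its logarithmic variation.
  obtain ⟨r, hr⟩ := hV.vanishTo_taylor hs hF n (-1)
  have hE := isExactSpace_algSh (N := N) s
  have h0 := hr (-1) le_rfl
  set Y := fun k => (adStep (isShiftDer_algDs s) V)^[k] (der (isShiftDer_algLder s hF) V) with hY
  have hYs : ∀ k, Y (k + 1) = adStep (isShiftDer_algDs s) V (Y k) := fun k =>
    Function.iterate_succ_apply' _ _ _
  have hlow : ∀ k, ∀ n < 0, (Y k).coeff n = 0 := by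
    intro k
    induction k with
    | zero =>
      intro n hn
      change algLder F (V.coeff n) = 0
      rw [hV.low hs n hn, (isShiftDer_algLder s hF).isDer.zero]
    | succ k ih => rw [hYs]; exact adStep_low (hV.low hs) ih
  obtain ⟨b', hb'⟩ := isUnit_iff_exists_inv.1 hb
  refine ⟨(Y 0).coeff 0 - ∑ k ∈ range (r + 1), (((k + 1).factorial : ℂ)⁻¹) • (Y k).coeff 0, ?_, ?_⟩
  · rw [sum_range_succ', sub_add_eq_sub_sub_swap]
    refine Submodule.sub_mem _ (by simp) (Submodule.sum_mem _ fun k _ => Submodule.smul_mem _ _ ?_)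
    have := hE.res_adStep (isShiftDer_algDs s) (algDs_mem s) (hV.commutator hs) 0 (Y k)
    rwa [pow_zero, one_mul, ← hYs] at this
  · have h1 : algLder F (V.coeff 0) - y - ((Y 0).coeff 0 -
        ∑ k ∈ range (r + 1), (((k + 1).factorial : ℂ)⁻¹) • (Y k).coeff 0) =
        (-b') * (der (isShiftDer_algLder s hF) (laxUp s) - ∑ k ∈ range (r + 1),
          (((k + 1).factorial : ℂ)⁻¹) • (Y k * laxUp s)).coeff (-1) := by
      have h2 : ∀ k, (Y k * laxUp s).coeff (-1) = (Y k).coeff 0 * laxB s := fun k => by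
        have := coeff_mul_lowest (hlow k) (laxUp_low (N := N) (s := s))
        rwa [zero_add, (isShift_algSh s).zero_apply, coeff_laxUp_neg_one] at this
      rw [coeff_sub, coeff_sum, coeff_der, coeff_laxUp_neg_one, ← hy]
      simp only [coeff_smul, h2, ← ZN.smul_mul']
      rw [← sum_mul, ← sub_mul, mul_comm (-b'), mul_assoc, mul_neg, hb']
      simp only [hY, Function.iterate_zero, id_eq, coeff_der]
      ring
    rw [h1]
    exact h0.mul_left _

end Exact

/-! ### The full logarithm from its two reflected halves -/

section TwoSided

variable {N : ℕ} [NeZero N]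

theorem mul_self_of_sign {s : ℤ} (hs : s = 1 ∨ s = -1) (n : ℤ) : s * (s * n) = n := by
  rcases hs with rfl | rfl <;> ring

theorem comp_scale {R : Type*} [CommRing R] [Algebra ℂ R] {sh : ℤ → R → R} {s : ℤ} (hs : s = 1 ∨ s = -1)
    (A B : DOp R) (n : ℤ) :
    DOp.comp (fun m => sh (s * m)) (fun i => A (s * i)) (fun i => B (s * i)) n =
      DOp.comp sh A B (s * n) := by
  rcases hs with rfl | rfl
  · simp only [one_mul]
  · simp only [neg_one_mul]
    exact DOp.comp_reflect A B n

/-- An operator of non-negative order in `Λ^s`. -/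
def UpOp.ofDOp {R : Type*} [CommRing R] [Algebra ℂ R] {sh : ℤ → R → R} (h : IsShift sh) (s : ℤ)
    (A : DOp R) (hA : ∀ n < 0, A (s * n) = 0) : UpOp h := ⟨fun n => A (s * n), 0, hA⟩

theorem isDressed_ofDOp {s : ℤ} (hs : s = 1 ∨ s = -1) {S S' : DOp (ZN N (PosAlg N))}
    (hS : ∀ n < 0, S (s * n) = 0) (hS' : ∀ n < 0, S' (s * n) = 0)
    (h1 : posComp N S S' = DOp.mono 1 0) (h2 : posComp N S' S = DOp.mono 1 0)
    (h3 : (fun n => ZN.map (toPos N) (lax N n)) =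
      posComp N (posComp N S (DOp.mono 1 (-s))) S') :
    IsDressed (isShift_posSh s) (posMap s (laxUp s)) (UpOp.ofDOp (isShift_posSh s) s S hS)
      (UpOp.ofDOp (isShift_posSh s) s S' hS') := by
  have hm : ∀ k n : ℤ, (DOp.mono (1 : ZN N (PosAlg N)) (s * k)) (s * n) = DOp.mono 1 k n := by
    intro k n
    unfold DOp.mono
    have : s * n = s * k ↔ n = k := by rcases hs with rfl | rfl <;> simp
    simp only [this]
  have hsc : ∀ A B : DOp (ZN N (PosAlg N)), (fun n => posComp N A B (s * n)) =
      DOp.comp (posSh s) (fun i => A (s * i)) (fun i => B (s * i)) :=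
    fun A B => funext fun n => (comp_scale hs A B n).symm
  refine ⟨hS, hS', ?_, ?_, ?_⟩
  · refine UpOp.ext ((hsc S S').symm.trans (funext fun n => ?_))
    rw [h1]
    have := hm 0 n
    rwa [mul_zero] at this
  · refine UpOp.ext ((hsc S' S).symm.trans (funext fun n => ?_))
    rw [h2]
    have := hm 0 n
    rwa [mul_zero] at this
  · refine UpOp.ext (funext fun n => ?_)
    have h4 := congrFun h3 (s * n)
    have h5 := congrFun (hsc (posComp N S (DOp.mono 1 (-s))) S') n
    beta_reduce at h4 h5
    change ZN.map (toPos N) ((laxUp s).coeff n) = _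
    rw [coeff_laxUp hs, h4, h5, hsc]
    have h6 : (fun i => DOp.mono (1 : ZN N (PosAlg N)) (-s) (s * i)) = DOp.mono 1 (-1) :=
      funext fun i => by rw [← hm (-1) i, mul_neg_one]
    rw [h6]
    rfl

theorem coeff_dressD_ofDOp {s : ℤ} (hs : s = 1 ∨ s = -1) {S S' : DOp (ZN N (PosAlg N))}
    (hS : ∀ n < 0, S (s * n) = 0) (hS' : ∀ n < 0, S' (s * n) = 0) (n : ℤ) :
    (dressD (isShiftDer_posDs s) (UpOp.ofDOp (isShift_posSh s) s S hS)
      (UpOp.ofDOp (isShift_posSh s) s S' hS')).coeff n = (-(s : ℂ)) • dressedD N S S' (s * n) := by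
  unfold dressedD posComp
  rw [← comp_scale hs]
  have hD : IsShiftDer (posSh (N := N) s) (ZN.map (posD N)) :=
    ⟨ZN.isDer_map isDer_posD, fun m x => by
      refine ZN.ext (funext fun i => PowerSeries.ext fun n => ?_)
      simp only [ZN.coeff_map, posShift_eq, posD_eq, coeff_psMap, posD0_posShift0]⟩
  have h1 : der (isShiftDer_posDs s) (UpOp.ofDOp (isShift_posSh s) s S' hS') =
      (-(s : ℂ)) • der hD (UpOp.ofDOp (isShift_posSh s) s S' hS') := rfl
  unfold dressD
  rw [h1, UpOp.mul_smul']
  rfl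

/-- The logarithm from its two halves. -/
theorem isLogLax_iff {V₁ : UpOp (isShift_algSh (N := N) 1)} {V₂ : UpOp (isShift_algSh (N := N) (-1))}
    (h₁ : IsLog 1 V₁) (h₂ : IsLog (-1) V₂) (W : DOp (ZN N (Alg N))) :
    IsLogLax N W ↔ ∀ n, W n = (1 / 2 : ℂ) • (V₂.coeff (-n) + V₁.coeff n) := by
  have key : ∀ S S' Sb Sb', IsDressing N S S' Sb Sb' → ∀ n,
      (1 / 2 : ℂ) • (dressedD N S S' n - dressedD N Sb Sb' n) =
        ZN.map (toPos N) ((1 / 2 : ℂ) • (V₂.coeff (-n) + V₁.coeff n)) := by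
    intro S S' Sb Sb' h n
    -- `Sb` is the dressing for `s = 1`, and `S`, read in powers of `Λ⁻¹`, the one for `s = -1`. The
    -- factor `-s` in `d` accounts for the minus sign between the two terms of the logarithm.
    have hb := isDressed_ofDOp (s := 1) (Or.inl rfl) (fun n hn => h.Sb_upper _ (by omega))
      (fun n hn => h.Sb'_upper _ (by omega)) h.Sb_mul h.Sb'_mul h.lax_Sb
    have ha := isDressed_ofDOp (s := -1) (Or.inr rfl) (fun n hn => h.S_lower _ (by omega))
      (fun n hn => h.S'_lower _ (by omega)) h.S_mul h.S'_mul (by rw [neg_neg]; exact h.lax_S)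
    have h1 := coeff_dressD_ofDOp (s := 1) (Or.inl rfl) (fun n hn => h.Sb_upper _ (by omega))
      (fun n hn => h.Sb'_upper _ (by omega)) n
    have h2 := coeff_dressD_ofDOp (s := -1) (Or.inr rfl) (fun n hn => h.S_lower _ (by omega))
      (fun n hn => h.S'_lower _ (by omega)) (-n)
    rw [h₁ _ _ hb] at h1
    rw [h₂ _ _ ha] at h2
    change ZN.map (toPos N) (V₁.coeff n) = _ at h1
    change ZN.map (toPos N) (V₂.coeff (-n)) = _ at h2
    rw [isHom_ztoPos.smul, isHom_ztoPos.add, h1, h2, one_mul, neg_one_mul, neg_neg]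
    push_cast
    rw [neg_neg, one_smul, neg_one_smul, sub_eq_add_neg]
  have hex : ∃ S S' Sb Sb', IsDressing N S S' Sb Sb' := by
    obtain ⟨Sb, Sb', hb, -, -⟩ := exists_pos_dressing (N := N) (s := 1) (Or.inl rfl)
    obtain ⟨S, S', ha, ha0, -⟩ := exists_pos_dressing (N := N) (s := -1) (Or.inr rfl)
    have hA : ∀ {s : ℤ}, s = 1 ∨ s = -1 → ∀ A B : UpOp (isShift_posSh (N := N) s),
        posComp N (fun n => A.coeff (s * n)) (fun n => B.coeff (s * n)) =
          fun n => (A * B).coeff (s * n) := by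
      intro s hs A B
      funext n
      have := comp_scale (sh := fun m => ZN.map (posShift N m)) hs (fun n => A.coeff (s * n))
        (fun n => B.coeff (s * n)) (s * n)
      simp only [mul_self_of_sign hs] at this
      exact this.symm
    have hone : ∀ {s : ℤ}, s = 1 ∨ s = -1 → (fun n => (1 : UpOp (isShift_posSh (N := N) s)).coeff
        (s * n)) = DOp.mono 1 0 := by
      intro s hs
      funext n
      rw [coeff_one]
      unfold DOp.mono
      rcases hs with rfl | rfl <;> simp
    have hmono : ∀ {s : ℤ}, s = 1 ∨ s = -1 → (fun n =>
        (shInv (isShift_posSh (N := N) s)).coeff (s * n)) = DOp.mono 1 (-s) := by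
      intro s hs
      funext n
      rw [coeff_mono]
      unfold DOp.mono
      have : s * n = -1 ↔ n = -s := by rcases hs with rfl | rfl <;> omega
      simp only [this]
    have hlax : ∀ {s : ℤ}, s = 1 ∨ s = -1 → (fun n => ZN.map (toPos N) (lax N n)) = fun n =>
        (posMap (N := N) s (laxUp s)).coeff (s * n) := by
      intro s hs
      funext n
      change _ = ZN.map (toPos N) ((laxUp s).coeff (s * n))
      rw [coeff_laxUp hs, mul_self_of_sign hs]
    have hs1 : (1 : ℤ) = 1 ∨ (1 : ℤ) = -1 := Or.inl rfl
    have hs2 : (-1 : ℤ) = 1 ∨ (-1 : ℤ) = -1 := Or.inr rfl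
    refine ⟨fun n => S.coeff (-1 * n), fun n => S'.coeff (-1 * n), fun n => Sb.coeff (1 * n),
      fun n => Sb'.coeff (1 * n), ?_, ?_, ?_, ?_, ?_, ?_, ?_, ?_, ?_, ?_, ?_⟩
    · simpa using ha0 rfl
    · exact fun n hn => ha.low _ (by omega)
    · exact fun n hn => ha.low' _ (by omega)
    · rw [hA hs2, ha.mul, hone hs2]
    · rw [hA hs2, ha.mul', hone hs2]
    · exact fun n hn => hb.low _ (by omega)
    · exact fun n hn => hb.low' _ (by omega)
    · rw [hA hs1, hb.mul, hone hs1]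
    · rw [hA hs1, hb.mul', hone hs1]
    · have h1 := hmono hs2
      rw [neg_neg] at h1
      rw [← h1, hA hs2, hA hs2, hlax hs2, ha.lax]
    · rw [← hmono hs1, hA hs1, hA hs1, hlax hs1, hb.lax]
  constructor
  · rintro ⟨-, h⟩ n
    obtain ⟨S, S', Sb, Sb', hS⟩ := hex
    exact ztoPos_injective ((h S S' Sb Sb' hS n).trans (key S S' Sb Sb' hS n))
  · intro h
    exact ⟨hex, fun S S' Sb Sb' hS n => by rw [h n, key S S' Sb Sb' hS n]⟩

theorem existsUnique_isLogLax : ∃! W : DOp (ZN N (Alg N)), IsLogLax N W := by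
  obtain ⟨V₁, h₁⟩ := exists_isLog (N := N) (s := 1) (Or.inl rfl)
  obtain ⟨V₂, h₂⟩ := exists_isLog (N := N) (s := -1) (Or.inr rfl)
  refine ⟨fun n => (1 / 2 : ℂ) • (V₂.coeff (-n) + V₁.coeff n),
    (isLogLax_iff h₁ h₂ _).2 fun _ => rfl, fun W hW => funext ((isLogLax_iff h₁ h₂ W).1 hW)⟩

/-! ## Products of densities -/

theorem isFin_lax : DOp.IsFin (lax N) :=
  ((DOp.isFin_mono _ _).add (DOp.isFin_mono _ _)).add (DOp.isFin_mono _ _)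

theorem isFin_laxPow (m : ℕ) : DOp.IsFin (laxPow N m) := by
  induction m with
  | zero => exact DOp.isFin_mono _ _
  | succ m ih => exact isFin_lax.comp isShift_zshift ih

theorem opComp_scale {s : ℤ} (hs : s = 1 ∨ s = -1) (A B : UpOp (isShift_algSh (N := N) s)) (n : ℤ) :
    opComp N (fun n => A.coeff (s * n)) (fun n => B.coeff (s * n)) n = (A * B).coeff (s * n) := by
  have := comp_scale (sh := zshift N) hs (fun n => A.coeff (s * n))
    (fun n => B.coeff (s * n)) (s * n)
  simp only [mul_self_of_sign hs] at this
  exact this.symm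

theorem laxUp_eq {s : ℤ} (hs : s = 1 ∨ s = -1) :
    (fun n => (laxUp (N := N) s).coeff (s * n)) = lax N :=
  funext fun n => by rw [coeff_laxUp hs, mul_self_of_sign hs]

theorem laxPow_eq {s : ℤ} (hs : s = 1 ∨ s = -1) (m : ℕ) :
    (fun n => (laxUp (N := N) s ^ m).coeff (s * n)) = laxPow N m := by
  induction m with
  | zero =>
    funext n
    rw [pow_zero, coeff_one]
    change DOp.mono 1 0 (s * n) = DOp.mono 1 0 n
    unfold DOp.mono
    rcases hs with rfl | rfl <;> simp
  | succ m ih =>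
    funext n
    rw [pow_succ', ← opComp_scale hs, laxUp_eq hs, ih]
    rfl

section

variable {W : DOp (ZN N (Alg N))}

/-- The two halves of the logarithm as difference operators. -/
theorem IsLogLax.exists_halves (hW : IsLogLax N W) :
    ∃ (V₁ : UpOp (isShift_algSh (N := N) 1)) (V₂ : UpOp (isShift_algSh (N := N) (-1))),
      IsLog 1 V₁ ∧ IsLog (-1) V₂ ∧ W = (1 / 2 : ℂ) • ((fun n => V₂.coeff (-1 * n)) +
        fun n => V₁.coeff (1 * n)) := by
  obtain ⟨V₁, h₁⟩ := exists_isLog (N := N) (s := 1) (Or.inl rfl)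
  obtain ⟨V₂, h₂⟩ := exists_isLog (N := N) (s := -1) (Or.inr rfl)
  refine ⟨V₁, V₂, h₁, h₂, funext fun n => ?_⟩
  rw [(isLogLax_iff h₁ h₂ W).1 hW n, Pi.smul_apply, Pi.add_apply, one_mul, neg_one_mul]

theorem opComp_fin_right {A B C : DOp (ZN N (Alg N))} (hA : DOp.IsFin A) (c : ℂ) :
    opComp N A (c • (B + C)) = c • (opComp N A B + opComp N A C) := by
  rw [opComp, DOp.comp_smul isShift_zshift (hA.summable_left _),
    DOp.comp_add isShift_zshift (hA.summable_left _) (hA.summable_left _)]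

theorem opComp_fin_left {A B C : DOp (ZN N (Alg N))} (hA : DOp.IsFin A) (c : ℂ) :
    opComp N (c • (B + C)) A = c • (opComp N B A + opComp N C A) := by
  rw [opComp, DOp.smul_comp isShift_zshift (hA.summable_right _),
    DOp.add_comp isShift_zshift (hA.summable_right _) (hA.summable_right _)]

theorem IsLog.opComp_commutator {s : ℤ} (hs : s = 1 ∨ s = -1)
    {V : UpOp (isShift_algSh (N := N) s)} (hV : IsLog s V) (n : ℤ) :
    opComp N (lax N) (fun n => V.coeff (s * n)) n - opComp N (fun n => V.coeff (s * n)) (lax N) n =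
      algDs s (lax N n) := by
  have e1 := congrArg (fun A => A.coeff (s * n)) (hV.commutator hs)
  rw [← laxUp_eq hs, opComp_scale hs, opComp_scale hs]
  exact e1

/-- Each half satisfies `[L, V] = -s ε∂ L`, and the contributions of `s = 1` and `s = -1` cancel. -/
theorem IsLogLax.commute (hW : IsLogLax N W) : opComp N (lax N) W = opComp N W (lax N) := by
  obtain ⟨V₁, V₂, h₁, h₂, rfl⟩ := hW.exists_halves
  rw [opComp_fin_right isFin_lax, opComp_fin_left isFin_lax]
  have key : opComp N (lax N) (fun n => V₂.coeff (-1 * n)) +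
      opComp N (lax N) (fun n => V₁.coeff (1 * n)) = opComp N (fun n => V₂.coeff (-1 * n)) (lax N) +
      opComp N (fun n => V₁.coeff (1 * n)) (lax N) := by
    funext n
    have e1 := h₁.opComp_commutator (Or.inl rfl) n
    have e2 := h₂.opComp_commutator (Or.inr rfl) n
    have e3 : algDs 1 (lax N n) + algDs (-1) (lax N n) = 0 := by
      unfold algDs
      push_cast
      rw [neg_neg, one_smul, neg_one_smul, neg_add_cancel]
    rw [← e1, ← e2, sub_add_sub_comm, sub_eq_zero, add_comm, add_comm (opComp N _ (lax N) n)] at e3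
    exact e3
  rw [key]

/-- `Res (L^(m+1) δ log L) = Res (L^m δL)` up to exact terms. -/
theorem IsLogLax.res_pow (hW : IsLogLax N W) {F : Jet N → JetPoly N} (hF : Prolonged F) (m : ℕ) :
    opComp N (laxPow N (m + 1)) (algLder F ∘ W) 0 - opComp N (laxPow N m) (algLder F ∘ lax N) 0 ∈
      exactSpace N := by
  obtain ⟨V₁, V₂, h₁, h₂, rfl⟩ := hW.exists_halves
  have hs1 : (1 : ℤ) = 1 ∨ (1 : ℤ) = -1 := Or.inl rfl
  have hs2 : (-1 : ℤ) = 1 ∨ (-1 : ℤ) = -1 := Or.inr rfl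
  have key : ∀ {s : ℤ} (hs : s = 1 ∨ s = -1) {V : UpOp (isShift_algSh (N := N) s)}, IsLog s V →
      opComp N (laxPow N (m + 1)) (algLder F ∘ fun n => V.coeff (s * n)) 0 -
        opComp N (laxPow N m) (algLder F ∘ lax N) 0 ∈ exactSpace N := by
    intro s hs V hV
    have := hV.res_pow hs hF m
    rw [show (0 : ℤ) = s * 0 by rw [mul_zero], ← opComp_scale hs, ← opComp_scale hs,
      laxPow_eq hs, laxPow_eq hs] at this
    rw [← laxUp_eq hs]
    exact this
  have hD := (isShiftDer_algLder 1 hF).isDer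
  have hsplit : algLder F ∘ ((1 / 2 : ℂ) • ((fun n => V₂.coeff (-1 * n)) +
      fun n => V₁.coeff (1 * n))) = (1 / 2 : ℂ) • ((algLder F ∘ fun n => V₂.coeff (-1 * n)) +
        (algLder F ∘ fun n => V₁.coeff (1 * n))) :=
    funext fun n => by
      simp only [Function.comp_apply, Pi.smul_apply, Pi.add_apply, hD.smul, hD.add]
  rw [hsplit, opComp_fin_right (isFin_laxPow _), Pi.smul_apply, Pi.add_apply]
  have := (exactSpace N).smul_mem (1 / 2 : ℂ) ((exactSpace N).add_mem (key hs2 h₂) (key hs1 h₁))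
  convert this using 1
  module

/-- The variation of `Res log L`. -/
theorem IsLogLax.res_zero (hW : IsLogLax N W) {F : Jet N → JetPoly N} (hF : Prolonged F)
    {y : ZN N (Alg N)} (hb : IsUnit (expV N)) (hy : y * expV N = algLder F (expV N)) :
    algLder F (W 0) - (1 / 2 : ℂ) • y ∈ exactSpace N := by
  obtain ⟨V₁, V₂, h₁, h₂, rfl⟩ := hW.exists_halves
  have hs1 : (1 : ℤ) = 1 ∨ (1 : ℤ) = -1 := Or.inl rfl
  have hs2 : (-1 : ℤ) = 1 ∨ (-1 : ℤ) = -1 := Or.inr rfl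
  have hD := (isShiftDer_algLder 1 hF).isDer
  have e1 := h₁.res_zero hs1 hF (y := y) (by simpa [laxB] using hb) (by simpa [laxB] using hy)
  have e2 := h₂.res_zero hs2 hF (y := 0) (by simp [laxB]) (by simp [laxB, hD.one])
  have := (exactSpace N).smul_mem (1 / 2 : ℂ) ((exactSpace N).add_mem e1 e2)
  convert this using 1
  simp only [Pi.smul_apply, Pi.add_apply, mul_zero, hD.smul, hD.add]
  module

end

end TwoSided

/-! ### Residue calculus for powers of `L` and the logarithm -/

section Residues

variable {N : ℕ} [NeZero N]

theorem opComp_add_right {A : DOp (ZN N (Alg N))} (hA : DOp.IsFin A) (B C : DOp (ZN N (Alg N))) :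
    opComp N A (B + C) = opComp N A B + opComp N A C :=
  DOp.comp_add isShift_zshift (hA.summable_left _) (hA.summable_left _)

theorem opComp_add_left {A : DOp (ZN N (Alg N))} (hA : DOp.IsFin A) (B C : DOp (ZN N (Alg N))) :
    opComp N (B + C) A = opComp N B A + opComp N C A :=
  DOp.add_comp isShift_zshift (hA.summable_right _) (hA.summable_right _)

theorem opComp_smul_right {A : DOp (ZN N (Alg N))} (hA : DOp.IsFin A) (c : ℂ)
    (B : DOp (ZN N (Alg N))) : opComp N A (c • B) = c • opComp N A B :=
  DOp.comp_smul isShift_zshift (hA.summable_left _) c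

theorem opComp_smul_left {A : DOp (ZN N (Alg N))} (hA : DOp.IsFin A) (c : ℂ)
    (B : DOp (ZN N (Alg N))) : opComp N (c • B) A = c • opComp N B A :=
  DOp.smul_comp isShift_zshift (hA.summable_right _) c

theorem laxPow_comm (m : ℕ) : opComp N (laxPow N m) (lax N) = opComp N (lax N) (laxPow N m) := by
  induction m with
  | zero =>
    have h1 := DOp.one_comp (isShift_zshift (N := N)) (lax N)
    have h2 := DOp.comp_one (isShift_zshift (N := N)) (lax N)
    exact h1.trans h2.symm
  | succ m ih =>
    have h1 : laxPow N (m + 1) = opComp N (lax N) (laxPow N m) := rfl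
    have h2 : opComp N (opComp N (lax N) (laxPow N m)) (lax N) =
        opComp N (lax N) (opComp N (laxPow N m) (lax N)) :=
      DOp.IsFin.comp_assoc₁₂ isShift_zshift isFin_lax (isFin_laxPow m) _
    rw [h1, h2, ih]

/-! ## Operators commuting with `L` -/

/-- `[L, B] = 0`. -/
def CommutesLax (B : DOp (ZN N (Alg N))) : Prop := opComp N (lax N) B = opComp N B (lax N)

theorem CommutesLax.smul {B : DOp (ZN N (Alg N))} (hB : CommutesLax B) (c : ℂ) :
    CommutesLax (c • B) := by
  unfold CommutesLax at *
  rw [opComp_smul_right isFin_lax, opComp_smul_left isFin_lax, hB]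

theorem CommutesLax.add {B C : DOp (ZN N (Alg N))} (hB : CommutesLax B) (hC : CommutesLax C) :
    CommutesLax (B + C) := by
  unfold CommutesLax at *
  rw [opComp_add_right isFin_lax, opComp_add_left isFin_lax, hB, hC]

theorem commutesLax_laxPow (m : ℕ) : CommutesLax (laxPow N m) := (laxPow_comm m).symm

theorem CommutesLax.lax_comp {B : DOp (ZN N (Alg N))} (hB : CommutesLax B) :
    CommutesLax (opComp N B (lax N)) := by
  unfold CommutesLax at *
  conv_rhs => rw [← hB]
  exact (DOp.IsFin.comp_assoc₁₃ isShift_zshift isFin_lax isFin_lax B).symm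

theorem CommutesLax.laxPow_comp {B : DOp (ZN N (Alg N))} (hB : CommutesLax B) (m : ℕ) :
    CommutesLax (opComp N (laxPow N m) B) := by
  have h1 : opComp N (lax N) (opComp N (laxPow N m) B) =
      opComp N (opComp N (lax N) (laxPow N m)) B :=
    (DOp.IsFin.comp_assoc₁₂ isShift_zshift isFin_lax (isFin_laxPow m) _).symm
  have h2 : opComp N (opComp N (laxPow N m) (lax N)) B =
      opComp N (laxPow N m) (opComp N (lax N) B) :=
    DOp.IsFin.comp_assoc₁₂ isShift_zshift (isFin_laxPow m) isFin_lax _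
  have h3 : opComp N (opComp N (laxPow N m) B) (lax N) =
      opComp N (laxPow N m) (opComp N B (lax N)) :=
    DOp.IsFin.comp_assoc₁₃ isShift_zshift (isFin_laxPow m) isFin_lax _
  unfold CommutesLax at *
  rw [h1, h3, ← laxPow_comm, h2, hB]

/-! ## Variations of residues -/

variable {F : Jet N → JetPoly N}

theorem isShiftDer_zshift (hF : Prolonged F) : IsShiftDer (zshift N) (algLder F) where
  isDer := ZN.isDer_map (isDer_psMap (isDer_lder F))
  comm _ _ := ZN.ext (funext fun _ => (shift_lder hF _ _).symm)

theorem DOp.IsFin.der {R : Type*} [CommRing R] [Algebra ℂ R] {D : R → R} (hD : IsDer D) {A : DOp R}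
    (hA : DOp.IsFin A) : DOp.IsFin (D ∘ A) :=
  Set.Finite.subset hA fun n hn h => hn (by
    rw [Function.comp_apply, h, hD.zero])

/-- Modulo exact terms a factor `L` can be moved cyclically to the other side of `K` and then
absorbed, since `K` commutes with `L`. The induction runs over all such `K`, because the step
replaces `K` by `K L`; `K` may be `log L`. -/
theorem res_der_laxPow (hF : Prolonged F) (m : ℕ) {K : DOp (ZN N (Alg N))} (hK : CommutesLax K) :
    opComp N (algLder F ∘ laxPow N m) K 0 -
      (m : ℂ) • opComp N (algLder F ∘ lax N) (opComp N (laxPow N (m - 1)) K) 0 ∈ exactSpace N := by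
  have hD := isShiftDer_zshift hF
  induction m generalizing K with
  | zero =>
    have h1 : algLder F ∘ laxPow N 0 = DOp.mono 0 0 := by
      funext n
      change algLder F (DOp.mono 1 0 n) = _
      unfold DOp.mono
      split_ifs
      · exact hD.isDer.one
      · exact hD.isDer.zero
    rw [h1, opComp, DOp.mono_comp isShift_zshift]
    simp
  | succ m ih =>
    have hDL := isFin_lax.der hD.isDer
    have hDm := (isFin_laxPow m).der hD.isDer
    have h1 : algLder F ∘ laxPow N (m + 1) = opComp N (algLder F ∘ lax N) (laxPow N m) +
        opComp N (lax N) (algLder F ∘ laxPow N m) :=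
      DOp.der_comp isShift_zshift hD.isDer hD.comm (isFin_lax.summable_left _)
    have h2 : opComp N (algLder F ∘ laxPow N (m + 1)) K =
        opComp N (algLder F ∘ lax N) (opComp N (laxPow N m) K) +
        opComp N (lax N) (opComp N (algLder F ∘ laxPow N m) K) := by
      rw [h1]
      refine (DOp.add_comp isShift_zshift
        ((hDL.comp isShift_zshift (isFin_laxPow m)).summable_left _)
        ((isFin_lax.comp isShift_zshift hDm).summable_left _)).trans ?_
      exact congrArg₂ _ (DOp.IsFin.comp_assoc₁₂ isShift_zshift hDL (isFin_laxPow m) K)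
        (DOp.IsFin.comp_assoc₁₂ isShift_zshift isFin_lax hDm K)
    have h3 : opComp N (lax N) (opComp N (algLder F ∘ laxPow N m) K) 0 -
        opComp N (opComp N (algLder F ∘ laxPow N m) K) (lax N) 0 ∈ exactSpace N :=
      isExactSpace_zshift.res_comm isShift_zshift (isFin_lax.summable_left _)
    have h4 : opComp N (opComp N (algLder F ∘ laxPow N m) K) (lax N) =
        opComp N (algLder F ∘ laxPow N m) (opComp N K (lax N)) :=
      DOp.IsFin.comp_assoc₁₃ isShift_zshift hDm isFin_lax K
    -- For `m = 0` the truncated exponent `m - 1` is wrong but multiplied by `m = 0`.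
    have h5 : (m : ℂ) • opComp N (algLder F ∘ lax N)
        (opComp N (laxPow N (m - 1)) (opComp N K (lax N))) 0 =
        (m : ℂ) • opComp N (algLder F ∘ lax N) (opComp N (laxPow N m) K) 0 := by
      cases m with
      | zero => simp
      | succ m =>
        have h6 : opComp N (laxPow N m) (opComp N (lax N) K) =
            opComp N (opComp N (laxPow N m) (lax N)) K :=
          (DOp.IsFin.comp_assoc₁₂ isShift_zshift (isFin_laxPow m) isFin_lax K).symm
        rw [Nat.add_sub_cancel, ← hK, h6, laxPow_comm]
        rfl
    have h7 := ih hK.lax_comp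
    rw [h5] at h7
    rw [h4] at h3
    have := (exactSpace N).add_mem h3 h7
    rw [h2, Pi.add_apply, Nat.add_sub_cancel]
    convert this using 1
    push_cast
    module

theorem smul_factorial (j : ℕ) (c : ℂ) :
    c / ((j + 1).factorial : ℂ) * ((j : ℂ) + 1) = c / (j.factorial : ℂ) := by
  have h1 : (j.factorial : ℂ) ≠ 0 := by exact_mod_cast j.factorial_ne_zero
  have h2 : (j : ℂ) + 1 ≠ 0 := by exact_mod_cast j.succ_ne_zero
  rw [Nat.factorial_succ]
  push_cast
  field_simp

/-- The variation of `∫ Res L^(j+1) / (j+1)!`. -/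
theorem var_laxPow (hF : Prolonged F) (j : ℕ) :
    algLder F ((((j + 1).factorial : ℂ)⁻¹) • laxPow N (j + 1) 0) -
      opComp N (algLder F ∘ lax N) (((j.factorial : ℂ)⁻¹) • laxPow N j) 0 ∈ exactSpace N := by
  have hD := isShiftDer_zshift hF
  have h1 := res_der_laxPow hF (j + 1) (commutesLax_laxPow 0)
  have h2 : ∀ A : DOp (ZN N (Alg N)), opComp N A (laxPow N 0) = A := DOp.comp_one isShift_zshift
  rw [h2, h2] at h1
  have := (exactSpace N).smul_mem (((j + 1).factorial : ℂ)⁻¹) h1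
  rw [opComp_smul_right (isFin_lax.der hD.isDer), hD.isDer.smul]
  convert this using 1
  have h3 := smul_factorial j 1
  rw [one_div, one_div] at h3
  rw [smul_sub, smul_smul, Nat.add_sub_cancel]
  push_cast
  rw [h3]
  rfl

variable {W : DOp (ZN N (Alg N))}

theorem laxLog_eq (W : DOp (ZN N (Alg N))) (j : ℕ) :
    laxLog N W j = opComp N (laxPow N j) W + (-harm j) • laxPow N j := by
  have h1 : W - DOp.mono (harm j • (1 : ZN N (Alg N))) 0 =
      W + (-harm j) • DOp.mono (1 : ZN N (Alg N)) 0 := by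
    funext n
    simp only [Pi.sub_apply, Pi.add_apply, Pi.smul_apply, DOp.mono]
    split_ifs
    · rw [neg_smul, sub_eq_add_neg]
    · simp
  have h2 : opComp N (laxPow N j) (DOp.mono 1 0) = laxPow N j := DOp.comp_one isShift_zshift _
  unfold laxLog
  rw [h1, opComp_add_right (isFin_laxPow j), opComp_smul_right (isFin_laxPow j), h2]

theorem harm_succ (j : ℕ) : harm (j + 1) = harm j + 1 / ((j : ℂ) + 1) := sum_range_succ _ _

theorem commutesLax_laxLog (hW : IsLogLax N W) (j : ℕ) : CommutesLax (laxLog N W j) := by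
  rw [laxLog_eq]
  exact (CommutesLax.laxPow_comp hW.commute j).add ((commutesLax_laxPow j).smul _)

theorem lax_comp_laxLog (W : DOp (ZN N (Alg N))) (j : ℕ) :
    opComp N (lax N) (laxLog N W j) =
      laxLog N W (j + 1) + (1 / ((j : ℂ) + 1)) • laxPow N (j + 1) := by
  have h1 : opComp N (lax N) (opComp N (laxPow N j) W) = opComp N (laxPow N (j + 1)) W :=
    (DOp.IsFin.comp_assoc₁₂ isShift_zshift isFin_lax (isFin_laxPow j) _).symm
  rw [laxLog_eq, laxLog_eq, opComp_add_right isFin_lax, opComp_smul_right isFin_lax, h1, harm_succ]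
  change _ + _ • laxPow N (j + 1) = _
  module

/-- The variation of `∫ Res L^(j+1) (log L - c_(j+1))`. -/
theorem var_laxLog (hW : IsLogLax N W) (hF : Prolonged F) (j : ℕ) :
    algLder F ((2 / ((j + 1).factorial : ℂ)) • laxLog N W (j + 1) 0) -
      opComp N (algLder F ∘ lax N) ((2 / (j.factorial : ℂ)) • laxLog N W j) 0 ∈ exactSpace N := by
  have hD := isShiftDer_zshift hF
  have hDL := isFin_lax.der hD.isDer
  have h1 := res_der_laxPow hF (j + 1) (K := W) hW.commute
  have h2 := res_der_laxPow hF (j + 1) (commutesLax_laxPow 0)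
  have h3 : ∀ A : DOp (ZN N (Alg N)), opComp N A (laxPow N 0) = A := DOp.comp_one isShift_zshift
  rw [h3, h3] at h2
  have h4 := hW.res_pow hF j
  have h5 : opComp N (laxPow N j) (algLder F ∘ lax N) 0 -
      opComp N (algLder F ∘ lax N) (laxPow N j) 0 ∈ exactSpace N :=
    isExactSpace_zshift.res_comm isShift_zshift (hDL.summable_right _)
  have h6 : algLder F (opComp N (laxPow N (j + 1)) W 0) =
      opComp N (algLder F ∘ laxPow N (j + 1)) W 0 +
        opComp N (laxPow N (j + 1)) (algLder F ∘ W) 0 :=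
    congrFun (DOp.der_comp isShift_zshift hD.isDer hD.comm ((isFin_laxPow (j + 1)).summable_left W)) 0
  -- Varying the power gives `(j+1) Res (δL L^j log L)`, varying the logarithm gives `Res (δL L^j)`.
  -- By `(j+1) c_(j+1) = (j+1) c_j + 1` the latter converts `c_(j+1)` into `c_j`.
  have h7 := (exactSpace N).smul_mem (2 / ((j + 1).factorial : ℂ)) ((exactSpace N).add_mem
    ((exactSpace N).add_mem h1 ((exactSpace N).add_mem h4 h5))
    ((exactSpace N).smul_mem (-harm (j + 1)) h2))
  convert h7 using 1
  have h8 := smul_factorial j 2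
  rw [laxLog_eq, laxLog_eq, opComp_smul_right hDL, opComp_add_right hDL, opComp_smul_right hDL,
    hD.isDer.smul, ← h8, Pi.smul_apply, Pi.add_apply, Pi.add_apply, Pi.smul_apply, Pi.smul_apply,
    hD.isDer.add, hD.isDer.smul, h6, harm_succ, Nat.add_sub_cancel]
  have h9 : (j : ℂ) + 1 ≠ 0 := by exact_mod_cast j.succ_ne_zero
  generalize opComp N (algLder F ∘ lax N) (laxPow N j) 0 = a
  generalize opComp N (algLder F ∘ lax N) (opComp N (laxPow N j) W) 0 = b
  change _ = (2 / ((j + 1).factorial : ℂ)) • ((_ - _) + _ + (-(harm j + 1 / ((j : ℂ) + 1))) •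
    (algLder F (laxPow N (j + 1) 0) - _))
  generalize algLder F (laxPow N (j + 1) 0) = c
  push_cast
  match_scalars <;> field_simp <;> ring

/-- The residue of `δL B`. -/
theorem res_der_lax_comp (hF : Prolonged F) (B : DOp (ZN N (Alg N))) :
    opComp N (algLder F ∘ lax N) B 0 =
      algLder F (fld N 0) * B 0 + algLder F (expV N) * zshift N (-1) (B 1) := by
  have hD := isShiftDer_zshift hF
  have h1 : algLder F ∘ lax N =
      DOp.mono (algLder F (fld N 0)) 0 + DOp.mono (algLder F (expV N)) (-1) := by
    funext n
    have h2 : ∀ (a : ZN N (Alg N)) (m : ℤ), algLder F (DOp.mono a m n) =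
        DOp.mono (algLder F a) m n := fun a m => by
      unfold DOp.mono
      split_ifs
      · rfl
      · exact hD.isDer.zero
    rw [Function.comp_apply, lax, Pi.add_apply, Pi.add_apply, hD.isDer.add, hD.isDer.add, h2, h2, h2,
      hD.isDer.one, Pi.add_apply]
    simp [DOp.mono]
  rw [h1, opComp, DOp.add_comp isShift_zshift ((DOp.isFin_mono _ _).summable_left _)
    ((DOp.isFin_mono _ _).summable_left _), Pi.add_apply, DOp.mono_comp isShift_zshift,
    DOp.mono_comp isShift_zshift, isShift_zshift.zero_apply, sub_zero, zero_sub, neg_neg]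

end Residues

/-! ### Derivations of differential polynomials, and the fundamental lemma of the calculus of
variations -/

section Variational

variable {N : ℕ} [NeZero N]

theorem IsDer.commutator {R : Type*} [CommRing R] [Algebra ℂ R] {D D' : R → R} (h : IsDer D)
    (h' : IsDer D') : IsDer fun x => D (D' x) - D' (D x) where
  add x y := by rw [h.add, h'.add, h.add, h'.add]; ring
  smul c x := by rw [h.smul, h'.smul, h.smul, h'.smul, smul_sub]
  mul x y := by rw [h.mul, h'.mul, h.add, h'.add, h.mul, h.mul, h'.mul, h'.mul]; ring

theorem der_eq_zero {D : DiffPoly N → DiffPoly N} (hD : IsDer D)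
    (hX : ∀ j, D (LaurentPolynomial.C (MvPolynomial.X j)) = 0)
    (hT : D (LaurentPolynomial.T 1) = 0) (f : DiffPoly N) : D f = 0 := by
  have h1 : ∀ n : ℤ, D (LaurentPolynomial.T n) = 0 := by
    intro n
    induction n using Int.induction_on with
    | zero => rw [LaurentPolynomial.T_zero, hD.one]
    | succ n ih => rw [LaurentPolynomial.T_add, hD.mul, ih, hT, zero_mul, mul_zero, add_zero]
    | pred n ih =>
      have h2 : (LaurentPolynomial.T (-(n : ℤ)) : DiffPoly N) =
          LaurentPolynomial.T (-(n : ℤ) - 1) * LaurentPolynomial.T 1 := by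
        rw [← LaurentPolynomial.T_add, sub_add_cancel]
      rw [h2, hD.mul, hT, mul_zero, add_zero] at ih
      have h3 := congrArg (fun x => x * (LaurentPolynomial.T (-1) : DiffPoly N)) ih
      simp only [zero_mul, mul_assoc, ← LaurentPolynomial.T_add] at h3
      simpa using h3
  have h2 : ∀ p : JetPoly N, D (LaurentPolynomial.C p) = 0 := by
    intro p
    induction p using MvPolynomial.induction_on with
    | C a =>
      have : (LaurentPolynomial.C (MvPolynomial.C a) : DiffPoly N) = a • 1 := by
        rw [← LaurentPolynomial.single_eq_C, ← LaurentPolynomial.T_zero, LaurentPolynomial.T]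
        change _ = a • AddMonoidAlgebra.single 0 1
        rw [AddMonoidAlgebra.smul_single, MvPolynomial.smul_eq_C_mul, mul_one]
      rw [this, hD.smul, hD.one, smul_zero]
    | add p q hp hq => rw [map_add, hD.add, hp, hq, add_zero]
    | mul_X p j hp => rw [map_mul, hD.mul, hp, hX, zero_mul, mul_zero, add_zero]
  refine laurent_ind (P := fun f => D f = 0) f (fun p q hp hq => by rw [hD.add, hp, hq, add_zero]) fun n p => ?_
  rw [LaurentPolynomial.single_eq_C_mul_T, hD.mul, h1, h2, zero_mul, mul_zero, add_zero]

theorem der_ext {D D' : DiffPoly N → DiffPoly N} (hD : IsDer D) (hD' : IsDer D')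
    (hX : ∀ j, D (LaurentPolynomial.C (MvPolynomial.X j)) =
      D' (LaurentPolynomial.C (MvPolynomial.X j)))
    (hT : D (LaurentPolynomial.T 1) = D' (LaurentPolynomial.T 1)) : D = D' := funext fun f =>
  sub_eq_zero.1 (der_eq_zero (hD.subDer hD') (fun j => sub_eq_zero.2 (hX j)) (sub_eq_zero.2 hT) f)

theorem isDer_pd0 (j : Jet N) : IsDer (pd0 N j) := by
  rw [pd0_eq]
  exact isDer_lder _

theorem pd0_X (j k : Jet N) : pd0 N j (LaurentPolynomial.C (MvPolynomial.X k)) =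
    if k = j then 1 else 0 := by
  rw [pd0_eq, lder_C, MvPolynomial.mkDerivation_X, Pi.single_apply]
  split_ifs <;> simp

theorem pd0_T (j : Jet N) : pd0 N j (LaurentPolynomial.T 1) =
    if j = (1, 0, 0) then LaurentPolynomial.T 1 else 0 := by
  rw [pd0_eq, lder_T, Pi.single_apply]
  simp only [eq_comm (a := ((1, 0, 0) : Jet N))]
  split_ifs <;> simp

/-- A differential polynomial depends on finitely many jet variables. -/
theorem exists_pd0_eq_zero (f : DiffPoly N) : ∃ s : Finset (Jet N), ∀ j ∉ s, pd0 N j f = 0 := by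
  classical
  refine laurent_ind (P := fun f => ∃ s : Finset (Jet N), ∀ j ∉ s, pd0 N j f = 0) f
    (fun p q hp hq => ?_) fun n p => ?_
  · obtain ⟨s, hs⟩ := hp
    obtain ⟨t, ht⟩ := hq
    refine ⟨s ∪ t, fun j hj => ?_⟩
    rw [notMem_union] at hj
    rw [(isDer_pd0 j).add, hs j hj.1, ht j hj.2, add_zero]
  · refine ⟨insert (1, 0, 0) p.vars, fun j hj => ?_⟩
    rw [mem_insert, not_or] at hj
    refine (laurentMap_single _ (by simp) n p).trans ?_
    rw [MvPolynomial.pderiv_eq_zero_of_notMem_vars hj.2, if_neg hj.1, add_zero,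
      AddMonoidAlgebra.single_zero]

theorem finite_support_pd0 (f : DiffPoly N) (G : Jet N → DiffPoly N) :
    (Function.support fun j => pd0 N j f * G j).Finite := by
  obtain ⟨s, hs⟩ := exists_pd0_eq_zero f
  refine s.finite_toSet.subset fun j hj => ?_
  by_contra h
  exact hj (by beta_reduce; rw [hs j h, zero_mul])

/-- The derivation with values `G` on the jet variables. -/
def lderG (G : Jet N → DiffPoly N) (f : DiffPoly N) : DiffPoly N := ∑ᶠ j, pd0 N j f * G j

theorem isDer_lderG (G : Jet N → DiffPoly N) : IsDer (lderG G) where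
  add x y := by
    unfold lderG
    rw [← finsum_add_distrib (finite_support_pd0 x G) (finite_support_pd0 y G)]
    exact finsum_congr fun j => by rw [(isDer_pd0 j).add, add_mul]
  smul c x := by
    unfold lderG
    rw [smul_finsum' c (finite_support_pd0 x G)]
    exact finsum_congr fun j => by rw [(isDer_pd0 j).smul, smul_mul_assoc]
  mul x y := by
    unfold lderG
    rw [finsum_mul' _ _ (finite_support_pd0 x G), mul_finsum' _ _ (finite_support_pd0 y G),
      ← finsum_add_distrib]
    · exact finsum_congr fun j => by rw [(isDer_pd0 j).mul]; ring
    · exact (finite_support_pd0 x G).subset fun j hj h =>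
        hj (mul_eq_zero_of_left h _)
    · exact (finite_support_pd0 y G).subset fun j hj h =>
        hj (mul_eq_zero_of_right _ h)

theorem lderG_X (G : Jet N → DiffPoly N) (j : Jet N) :
    lderG G (LaurentPolynomial.C (MvPolynomial.X j)) = G j := by
  unfold lderG
  rw [finsum_eq_single _ j fun k hk => by rw [pd0_X, if_neg (Ne.symm hk), zero_mul], pd0_X, if_pos rfl,
    one_mul]

theorem lderG_T (G : Jet N → DiffPoly N) :
    lderG G (LaurentPolynomial.T 1) = LaurentPolynomial.T 1 * G (1, 0, 0) := by
  unfold lderG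
  rw [finsum_eq_single _ (1, 0, 0) fun k hk => by rw [pd0_T, if_neg hk, zero_mul], pd0_T, if_pos rfl]

theorem lder_eq_lderG (F : Jet N → JetPoly N) :
    lder F = lderG fun j => LaurentPolynomial.C (F j) := by
  refine der_ext (isDer_lder F) (isDer_lderG _) (fun j => ?_) ?_
  · rw [lderG_X, lder_C, MvPolynomial.mkDerivation_X]
  · rw [lderG_T, lder_T]
    rw [Int.cast_one, one_mul, mul_comm]

theorem dx0_X (j : Jet N) : dx0 N (LaurentPolynomial.C (MvPolynomial.X j)) =
    LaurentPolynomial.C (MvPolynomial.X (j.1, j.2.1, j.2.2 + 1)) := by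
  rw [dx0_eq, lder_C, MvPolynomial.mkDerivation_X]
  rfl

theorem dx0_T : dx0 N (LaurentPolynomial.T 1) =
    LaurentPolynomial.T 1 * LaurentPolynomial.C (MvPolynomial.X (1, 0, 1)) := by
  rw [dx0_eq, lder_eq_lderG, lderG_T]
  rfl

/-- The commutator of a partial derivative with `∂` is a derivation, so it is identified by its
values on the jet variables and `e^{v_0}`. -/
theorem pd0_dx0 (w : Fin 2) (i : Fin N) (k : ℕ) (f : DiffPoly N) :
    pd0 N (w, i, k + 1) (dx0 N f) = pd0 N (w, i, k) f + dx0 N (pd0 N (w, i, k + 1) f) := by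
  have h : (fun f => pd0 N (w, i, k + 1) (dx0 N f) - dx0 N (pd0 N (w, i, k + 1) f)) =
      pd0 N (w, i, k) := by
    refine der_ext ((isDer_pd0 _).commutator isDer_dx0) (isDer_pd0 _) (fun j => ?_) ?_
    · obtain ⟨w', i', k'⟩ := j
      rw [dx0_X, pd0_X, pd0_X, pd0_X]
      have h1 : dx0 N (if ((w', i', k') : Jet N) = (w, i, k + 1) then 1 else 0) = 0 := by
        split_ifs
        · exact isDer_dx0.one
        · exact isDer_dx0.zero
      rw [h1, sub_zero]
      simp only [Prod.mk.injEq, add_left_inj]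
    · have h1 : ((w, i, k + 1) : Jet N) ≠ (1, 0, 0) := by simp
      rw [dx0_T, (isDer_pd0 _).mul, pd0_T, pd0_T, if_neg h1, isDer_dx0.zero, zero_mul, zero_add,
        sub_zero, pd0_X]
      simp only [Prod.mk.injEq]
      by_cases h2 : w = 1 ∧ i = 0 ∧ k = 0
      · obtain ⟨rfl, rfl, rfl⟩ := h2
        simp
      · rw [if_neg h2, if_neg fun h3 => h2 ⟨h3.1.symm, h3.2.1.symm, by omega⟩, mul_zero]
  rw [← congrFun h f, sub_add_cancel]

theorem pd0_comm (j k : Jet N) (f : DiffPoly N) : pd0 N j (pd0 N k f) = pd0 N k (pd0 N j f) := by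
  have h1 : ∀ (j : Jet N) (p : Prop) [Decidable p], pd0 N j (if p then 1 else 0) = 0 := by
    intro j p _
    split_ifs
    · exact (isDer_pd0 j).one
    · exact (isDer_pd0 j).zero
  refine sub_eq_zero.1 (der_eq_zero ((isDer_pd0 j).commutator (isDer_pd0 k)) (fun l => ?_) ?_ f)
  · rw [pd0_X, pd0_X, h1, h1, sub_zero]
  · rw [pd0_T, pd0_T]
    split_ifs
    · simp_all
    · rw [pd0_T, if_neg ‹_›, (isDer_pd0 _).zero, sub_zero]
    · rw [pd0_T, if_neg ‹_›, (isDer_pd0 _).zero, sub_zero]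
    · rw [(isDer_pd0 _).zero, (isDer_pd0 _).zero, sub_zero]

theorem exists_pd0_bound (w : Fin 2) (i : Fin N) (f : DiffPoly N) :
    ∃ K, ∀ k ≥ K, pd0 N (w, i, k) f = 0 := by
  obtain ⟨s, hs⟩ := exists_pd0_eq_zero f
  refine ⟨s.sup (fun j => j.2.2) + 1, fun k hk => hs _ fun hmem => ?_⟩
  have := Finset.le_sup (f := fun j : Jet N => j.2.2) hmem
  simp only at this
  omega

/-- The fundamental lemma of the calculus of variations. -/
theorem eq_zero_of_forall_exact {g : DiffPoly N}
    (h : ∀ f : JetPoly N, ∃ y, dx0 N y = LaurentPolynomial.C f * g) : g = 0 := by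
  obtain ⟨M, hM⟩ := exists_pd0_bound 0 0 g
  -- Test with `z²`, where `z` is a derivative of `u_0` of higher order than any in `g`. A total
  -- derivative is at most linear in its highest derivative of `u_0`, while `z² g` is quadratic in
  -- `z`.
  obtain ⟨y, hy⟩ := h (MvPolynomial.X (0, 0, M + 1) ^ 2)
  obtain ⟨K, hK⟩ := exists_pd0_bound 0 0 y
  set z : DiffPoly N := LaurentPolynomial.C (MvPolynomial.X (0, 0, M + 1)) with hz
  rw [map_pow, ← hz, pow_two] at hy
  have hpz : ∀ k, pd0 N (0, 0, k) z = if k = M + 1 then 1 else 0 := fun k => by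
    rw [hz, pd0_X]
    simp [eq_comm]
  have h1 : ∀ k ≥ M + 2, pd0 N (0, 0, k) (dx0 N y) = 0 := fun k hk => by
    rw [hy, (isDer_pd0 _).mul, (isDer_pd0 _).mul, hpz, if_neg (by omega), hM k (by omega)]
    simp
  -- Descending induction on the order: `∂y` contains no derivative of order above `M + 1`, hence
  -- `y` contains none of order above `M`.
  have h2 : ∀ d k, k ≥ M + 1 → k + d ≥ K → pd0 N (0, 0, k) y = 0 := by
    intro d
    induction d with
    | zero => exact fun k _ hk => hK k hk
    | succ d ih =>
      intro k hk hkd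
      have h3 := pd0_dx0 0 0 k y
      rw [h1 (k + 1) (by omega), ih (k + 1) (by omega) (by omega), isDer_dx0.zero, add_zero] at h3
      exact h3.symm
  have h3 : ∀ k ≥ M + 1, pd0 N (0, 0, k) y = 0 := fun k hk => h2 K k hk (by omega)
  have h4 := congrArg (pd0 N (0, 0, M + 1)) (pd0_dx0 0 0 M y)
  rw [h3 _ le_rfl, isDer_dx0.zero, add_zero, pd0_comm _ (0, 0, M), h3 _ le_rfl, (isDer_pd0 _).zero,
    hy] at h4
  simp only [(isDer_pd0 _).mul, (isDer_pd0 _).add, hpz, if_true, hM (M + 1) (by omega),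
    (isDer_pd0 _).zero, (isDer_pd0 _).one] at h4
  have h5 : (2 : DiffPoly N) * g = 0 := by linear_combination h4
  have h6 : (2 : ℂ) • g = 0 := by
    rw [Algebra.smul_def, map_ofNat, h5]
  exact (smul_eq_zero.1 h6).resolve_left two_ne_zero

/-! ## Variational derivatives -/

/-- The variation of the component `w_i` by `f`. -/
def testVar (w : Fin 2) (i : Fin N) (f : JetPoly N) (j : Jet N) : JetPoly N :=
  if j.1 = w ∧ j.2.1 = i then (dxP N)^[j.2.2] f else 0

theorem prolonged_testVar (w : Fin 2) (i : Fin N) (f : JetPoly N) : Prolonged (testVar w i f) :=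
  fun w' i' k => by
    unfold testVar
    simp only
    split_ifs
    · rw [Function.iterate_succ_apply']
    · rw [map_zero]

theorem dx0_C (p : JetPoly N) :
    dx0 N (LaurentPolynomial.C p) = LaurentPolynomial.C (dxP N p) := by
  rw [dx0_eq, lder_C]; rfl

theorem dx0_iterate_C (k : ℕ) (p : JetPoly N) :
    (dx0 N)^[k] (LaurentPolynomial.C p) = LaurentPolynomial.C ((dxP N)^[k] p) := by
  induction k with
  | zero => rfl
  | succ k ih => rw [Function.iterate_succ_apply', Function.iterate_succ_apply', ih, dx0_C]

theorem integration_by_parts (k : ℕ) (a b : DiffPoly N) :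
    ∃ y, dx0 N y = (dx0 N)^[k] a * b - a * ((-1) ^ k * (dx0 N)^[k] b) := by
  induction k generalizing b with
  | zero => exact ⟨0, by simp [isDer_dx0.zero]⟩
  | succ k ih =>
    obtain ⟨y, hy⟩ := ih (dx0 N b)
    refine ⟨(dx0 N)^[k] a * b - y, ?_⟩
    rw [isDer_dx0.sub, isDer_dx0.mul, hy, Function.iterate_succ_apply', Function.iterate_succ_apply,
      pow_succ]
    ring

/-- Integration by parts moves all derivatives from the test function `f` to the partial derivatives
of `h`, which produces the Euler operator. -/
theorem lder_testVar (w : Fin 2) (i : Fin N) (f : JetPoly N) (h : DiffPoly N) :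
    ∃ y, dx0 N y = lder (testVar w i f) h - LaurentPolynomial.C f *
      ∑ᶠ k : ℕ, (-1 : DiffPoly N) ^ k * (dx0 N)^[k] (pd0 N (w, i, k) h) := by
  classical
  obtain ⟨K, hK⟩ := exists_pd0_bound w i h
  have h0 : ∀ k, (dx0 N)^[k] 0 = 0 := fun k => by
    induction k with
    | zero => rfl
    | succ k ih => rw [Function.iterate_succ_apply', ih, isDer_dx0.zero]
  have h1 : lder (testVar w i f) h = ∑ k ∈ range K,
      (dx0 N)^[k] (LaurentPolynomial.C f) * pd0 N (w, i, k) h := by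
    rw [lder_eq_lderG, lderG, finsum_eq_sum_of_support_subset (s := (range K).image fun k => (w, i, k)),
      sum_image fun a _ b _ hab => by simpa using hab]
    · refine sum_congr rfl fun k _ => ?_
      rw [dx0_iterate_C, mul_comm]
      simp [testVar]
    · rintro ⟨w', i', k⟩ hj
      rw [Function.mem_support] at hj
      unfold testVar at hj
      simp only at hj
      by_cases hwi : w' = w ∧ i' = i
      · obtain ⟨rfl, rfl⟩ := hwi
        rw [coe_image]
        refine ⟨k, ?_, rfl⟩
        rw [mem_coe, mem_range]
        by_contra hk
        exact hj (by rw [hK k (by omega), zero_mul])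
      · rw [if_neg hwi, map_zero, mul_zero] at hj
        exact absurd rfl hj
  have h2 : ∑ᶠ k : ℕ, (-1 : DiffPoly N) ^ k * (dx0 N)^[k] (pd0 N (w, i, k) h) =
      ∑ k ∈ range K, (-1 : DiffPoly N) ^ k * (dx0 N)^[k] (pd0 N (w, i, k) h) := by
    refine finsum_eq_sum_of_support_subset _ fun k hk => ?_
    rw [Function.mem_support] at hk
    rw [mem_coe, mem_range]
    by_contra hkK
    exact hk (by rw [hK k (by omega), h0, mul_zero])
  choose y hy using fun k => integration_by_parts k (LaurentPolynomial.C f) (pd0 N (w, i, k) h)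
  refine ⟨∑ k ∈ range K, y k, ?_⟩
  rw [isDer_dx0.sum, h1, h2, mul_sum, ← sum_sub_distrib]
  exact sum_congr rfl fun k _ => hy k

/-- The number paired with `i` is `Tr_N (Γ^i a)`, the sum of the coefficients of `a` that `Γ^i` does
not push beyond `Γ^(N-1)`. Hence an element is recovered from its trace pairings. -/
theorem ZN.eq_ofPairing {R : Type*} [CommRing R] (a : ZN N R) :
    a = ZN.ofPairing fun i : Fin N => ∑ k ∈ range (N - i), a.ext0 k := by
  ext m
  have hm := m.2
  unfold ZN.ofPairing
  have h1 : N - (Fin.rev m : ℕ) = m + 1 := by rw [Fin.val_rev]; omega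
  have h2 : a.ext0 m = a.coeff m := by simp [ZN.ext0]
  simp only [h1]
  split_ifs with h
  · rw [h, zero_add, sum_range_one, sub_zero, ← h2, h]
  · have h3 : N - (N - (m : ℕ)) = m := by omega
    rw [h3, sum_range_succ, add_sub_cancel_left, h2]

/-- The variational derivatives from the variations. -/
theorem grad_eq_of_variation {h : Alg N} {a : Fin 2 → ZN N (Alg N)}
    (H : ∀ F : Jet N → JetPoly N, Prolonged F → ∀ n, ∃ y, dx0 N y = PowerSeries.coeff n
      (psMap (lder F) h - (algLder F (fld N 0) * a 0 + algLder F (fld N 1) * a 1).tr))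
    (w : Fin 2) : grad N w h = a w := by
  rw [ZN.eq_ofPairing (a w)]
  unfold grad
  congr 1
  funext i
  set e : Fin 2 → Fin N → Alg N := fun w i => ∑ k ∈ range (N - i), (a w).ext0 k with he
  change _ = e w i
  have htr : ∀ f, (algLder (testVar w i f) (fld N 0) * a 0 +
      algLder (testVar w i f) (fld N 1) * a 1).tr =
        PowerSeries.C (LaurentPolynomial.C f) * e w i := by
    intro f
    have h1 : ∀ w', (algLder (testVar w i f) (fld N w') * a w').tr =
        if w' = w then PowerSeries.C (LaurentPolynomial.C f) * e w i else 0 := by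
      intro w'
      have h3 : ∀ i', (algLder (testVar w i f) (fld N w')).coeff i' =
          if w' = w ∧ i' = i then PowerSeries.C (LaurentPolynomial.C f) else 0 := by
        intro i'
        rw [ZN.coeff_map, fld, psMap_C (isDer_lder _).zero, lder_C, MvPolynomial.mkDerivation_X,
          testVar]
        split_ifs <;> simp
      conv_lhs => rw [ZN.eq_ofPairing (a w')]
      rw [ZN.tr_mul_ofPairing]
      simp only [h3]
      by_cases hw : w' = w
      · subst hw
        simp [he]
      · simp [hw]
    rw [ZN.tr_add, h1, h1]
    fin_cases w <;> simp
  refine sub_eq_zero.1 (PowerSeries.ext fun n => ?_)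
  rw [map_zero]
  -- The variation with test function `f` is computed by the hypothesis and by the Euler operator;
  -- the two results differ by a total derivative.
  refine eq_zero_of_forall_exact fun f => ?_
  obtain ⟨y, hy⟩ := H _ (prolonged_testVar w i f) n
  obtain ⟨z, hz⟩ := lder_testVar w i f (PowerSeries.coeff n h)
  refine ⟨y - z, ?_⟩
  rw [isDer_dx0.sub, hy, hz, htr, map_sub, map_sub, coeff_psMap, PowerSeries.coeff_C_mul, euler,
    coeff_psMap]
  ring

end Variational

/-! ### The chain rule for `e^v` -/

section ExpV

variable {N : ℕ} [NeZero N]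

theorem IsDer.pow_succ {R : Type*} [CommRing R] [Algebra ℂ R] {D : R → R} (hD : IsDer D) (x : R)
    (m : ℕ) : D (x ^ (m + 1)) = ((m : ℂ) + 1) • (x ^ m * D x) := by
  induction m with
  | zero => simp
  | succ m ih =>
    rw [_root_.pow_succ, hD.mul, ih, smul_mul_assoc, mul_right_comm, ← _root_.pow_succ]
    push_cast
    module

theorem ZN.ext0_mul_eq_zero {R : Type*} [CommRing R] {x y : ZN N R} {a b : ℕ}
    (hx : ∀ n < a, x.ext0 n = 0) (hy : ∀ n < b, y.ext0 n = 0) :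
    ∀ n < a + b, (x * y).ext0 n = 0 := by
  intro n hn
  unfold ZN.ext0
  split_ifs with h
  · rw [ZN.mul_coeff]
    refine sum_eq_zero fun p hp => ?_
    have h1 : p.1 + p.2 = n := mem_antidiagonal.1 hp
    by_cases h2 : p.1 < a
    · rw [hx _ h2, zero_mul]
    · rw [hy _ (by omega), mul_zero]
  · rfl

theorem ZN.ext0_pow_eq_zero {R : Type*} [CommRing R] {x : ZN N R} (hx : ∀ n < 1, x.ext0 n = 0)
    (m : ℕ) : ∀ n < m, (x ^ m).ext0 n = 0 := by
  induction m with
  | zero => exact fun n hn => absurd hn (Nat.not_lt_zero n)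
  | succ m ih =>
    rw [_root_.pow_succ]
    exact ZN.ext0_mul_eq_zero ih hx

theorem ZN.eq_zero_of_ext0 {R : Type*} [CommRing R] {x : ZN N R} (hx : ∀ n < N, x.ext0 n = 0) :
    x = 0 := by
  ext i
  have := hx i i.2
  simpa [ZN.ext0] using this

/-- Derivations act on `e^v` by the chain rule. -/
theorem der_expV {D : Alg N → Alg N} (hD : IsDer D)
    (hT : D (PowerSeries.C (LaurentPolynomial.T 1)) = PowerSeries.C (LaurentPolynomial.T 1) *
      D (PowerSeries.C (LaurentPolynomial.C (MvPolynomial.X (1, 0, 0))))) :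
    ZN.map D (expV N) = expV N * ZN.map D (fld N 1) := by
  have hZ : IsDer (ZN.map D : ZN N (Alg N) → ZN N (Alg N)) := ZN.isDer_map hD
  set v0 : Alg N := PowerSeries.C (LaurentPolynomial.C (MvPolynomial.X (1, 0, 0)))
  set τ : Alg N := PowerSeries.C (LaurentPolynomial.T 1)
  set P : ZN N (Alg N) := ∑ m ∈ range N, ((m.factorial : ℂ)⁻¹) • vNil N ^ m with hP0
  have hN : N - 1 + 1 = N := Nat.succ_pred_eq_of_ne_zero (NeZero.ne N)
  have hr : range N = range (N - 1 + 1) := congrArg range hN.symm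
  have hP : P = ∑ m ∈ range (N - 1 + 1), ((m.factorial : ℂ)⁻¹) • vNil N ^ m := by rw [hP0, hr]
  have hsm : ∀ (a : Alg N) (x : ZN N (Alg N)), ZN.map D (a • x) = D a • x + a • ZN.map D x :=
    fun a x => ZN.ext (funext fun i => hD.mul _ _)
  have h1 : fld N 1 = v0 • (1 : ZN N (Alg N)) + vNil N := by
    refine ZN.ext (funext fun i => ?_)
    rw [ZN.coeff_add, ZN.coeff_smul, ZN.coeff_one, vNil]
    by_cases hi : i = 0
    · subst hi
      simp only [if_true, Fin.val_zero, smul_eq_mul, mul_one, add_zero]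
      rfl
    · have : (i : ℕ) ≠ 0 := fun h => hi (Fin.ext h)
      rw [if_neg this, smul_zero, zero_add]
      exact (if_neg hi).symm
  have h0 : ∀ n < 1, (vNil N).ext0 n = 0 := fun n hn => by
    obtain rfl : n = 0 := by omega
    simp [ZN.ext0, vNil]
  have h0' : ∀ n < 1, (ZN.map D (vNil N)).ext0 n = 0 := fun n hn => by
    rw [ZN.ext0_map hD.zero, h0 n hn, hD.zero]
  -- Both `v - v_0` and its image under `D` lie in the ideal of `Γ`, so this product lies in the
  -- `N`-th power of that ideal. The truncated exponential series therefore satisfies the exact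
  -- chain rule.
  have hlast : vNil N ^ (N - 1) * ZN.map D (vNil N) = 0 :=
    ZN.eq_zero_of_ext0 fun n hn =>
      ZN.ext0_mul_eq_zero (ZN.ext0_pow_eq_zero h0 (N - 1)) h0' n (by omega)
  have h2 : ZN.map D P = P * ZN.map D (vNil N) := by
    rw [hP, hZ.sum, sum_range_succ', sum_range_succ, add_mul, smul_mul_assoc, hlast, smul_zero,
      add_zero, pow_zero, hZ.smul, hZ.one, smul_zero, add_zero, sum_mul]
    refine sum_congr rfl fun m _ => ?_
    have h3 := smul_factorial m 1
    rw [one_div, one_div] at h3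
    rw [hZ.smul, hZ.pow_succ, smul_smul, h3, smul_mul_assoc]
  have h3 : expV N = τ • P := rfl
  rw [h3, hsm, h2, h1, hZ.add, hsm, hZ.one, smul_zero, add_zero, mul_add, ZN.smul_mul',
    ZN.smul_mul', ZN.mul_smul', mul_one, ZN.smul_smul', hT]

theorem isUnit_expV : IsUnit (expV N) := by
  have h1 : IsUnit (expV N *
      ((PowerSeries.C (LaurentPolynomial.T (-1)) : Alg N) • (1 : ZN N (Alg N)))) := by
    refine isUnit_of_coeff_zero ?_
    rw [ZN.mul_smul', mul_one, ZN.coeff_smul, coeff_zero_expV, smul_eq_mul, ← map_mul,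
      ← LaurentPolynomial.T_add]
    simp
  exact isUnit_of_mul_isUnit_left h1

theorem algLder_expV (F : Jet N → JetPoly N) :
    algLder F (expV N) = expV N * algLder F (fld N 1) := by
  refine der_expV (isDer_psMap (isDer_lder F)) ?_
  rw [psMap_C (isDer_lder F).zero, psMap_C (isDer_lder F).zero, lder_T, lder_jet, ← map_mul]
  rw [Int.cast_one, one_mul, mul_comm]

/-! ## Gradients of the Hamiltonians -/

/-- The gradient of the functional with variation `Tr_N Res (δL B)`. -/
def gradOp (B : DOp (ZN N (Alg N))) : Fin 2 → ZN N (Alg N) :=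
  ![B 0, expV N * zshift N (-1) (B 1)]

theorem exists_dx0_tr {x : ZN N (Alg N)} (hx : x ∈ exactSpace N) (n : ℕ) :
    ∃ y, dx0 N y = PowerSeries.coeff n x.tr := by
  choose y hy using fun i => hx i n
  exact ⟨∑ i, y i, by rw [isDer_dx0.sum, ZN.tr_eq_sum, map_sum]; exact sum_congr rfl fun i _ => hy i⟩

theorem grad_tr {A : ZN N (Alg N)} {a : Fin 2 → ZN N (Alg N)}
    (H : ∀ F : Jet N → JetPoly N, Prolonged F →
      algLder F A - (algLder F (fld N 0) * a 0 + algLder F (fld N 1) * a 1) ∈ exactSpace N)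
    (w : Fin 2) : grad N w A.tr = a w := by
  refine grad_eq_of_variation (fun F hF n => ?_) w
  have h1 := exists_dx0_tr (H F hF) n
  rw [← ZN.tr_map (isDer_psMap (isDer_lder F))]
  have h2 : ∀ x y : ZN N (Alg N), (x - y).tr = x.tr - y.tr := fun x y => by
    simp [ZN.tr_eq_sum]
  rwa [h2] at h1

/-- From `δL = δu + e^v δv Λ⁻¹`, the residue of `δL B` is `δu B_0 + δv e^v Λ⁻¹(B_1)`; the factors of
`δu` and `δv` are the gradients. -/
theorem grad_tr_gradOp {A : ZN N (Alg N)} {B : DOp (ZN N (Alg N))}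
    (H : ∀ F : Jet N → JetPoly N, Prolonged F →
      algLder F A - opComp N (algLder F ∘ lax N) B 0 ∈ exactSpace N)
    (w : Fin 2) : grad N w A.tr = gradOp B w := by
  refine grad_tr (fun F hF => ?_) w
  have h1 := H F hF
  rw [res_der_lax_comp hF, algLder_expV] at h1
  convert h1 using 2
  simp only [gradOp, Matrix.cons_val_zero, Matrix.cons_val_one]
  ring

theorem grad_ham_zero (W : DOp (ZN N (Alg N))) (j : ℕ) (w : Fin 2) :
    grad N w (hamDensity N W 0 j) = gradOp (((j.factorial : ℂ)⁻¹) • laxPow N j) w := by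
  unfold hamDensity
  rw [if_pos rfl, ← ZN.tr_smul]
  exact grad_tr_gradOp (fun F hF => var_laxPow hF j) w

variable {W : DOp (ZN N (Alg N))}

theorem grad_ham_one_succ (hW : IsLogLax N W) (j : ℕ) (w : Fin 2) :
    grad N w (hamDensity N W 1 (j + 1)) = gradOp ((2 / (j.factorial : ℂ)) • laxLog N W j) w := by
  unfold hamDensity
  rw [if_neg one_ne_zero, ← ZN.tr_smul]
  exact grad_tr_gradOp (fun F hF => var_laxLog hW hF j) w

theorem grad_ham_succ (hW : IsLogLax N W) (k : Fin 2) (j : ℕ) (w : Fin 2) :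
    grad N w (hamDensity N W k (j + 1)) = gradOp (flowOp N W k j) w := by
  unfold flowOp
  split_ifs with hk
  · rw [hk, grad_ham_zero]
  · rw [show k = 1 by omega, grad_ham_one_succ hW]

/-- The residue of `log L` varies by half the logarithmic variation of `e^v`, and the density
carries a factor `2`; so `∫ h_{1,0}` varies like `∫ Tr_N v`. -/
theorem grad_ham_one_zero (hW : IsLogLax N W) (w : Fin 2) :
    grad N w (hamDensity N W 1 0) = (![0, 1] : Fin 2 → ZN N (Alg N)) w := by
  unfold hamDensity
  rw [if_neg one_ne_zero, ← ZN.tr_smul]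
  have h1 : laxLog N W 0 = W := by
    have h2 : opComp N (laxPow N 0) W = W := DOp.one_comp isShift_zshift W
    rw [laxLog_eq, h2, harm, range_zero, sum_empty, neg_zero, zero_smul, add_zero]
  rw [h1, Nat.factorial_zero, Nat.cast_one, div_one]
  refine grad_tr (fun F hF => ?_) w
  have h2 := hW.res_zero hF (y := algLder F (fld N 1)) isUnit_expV
    (by rw [algLder_expV, mul_comm])
  have h3 := (exactSpace N).smul_mem (2 : ℂ) h2
  rw [smul_sub, smul_smul] at h3
  have hD := (isShiftDer_zshift hF).isDer
  have h4 : algLder F (fld N 0) * (![0, 1] : Fin 2 → ZN N (Alg N)) 0 +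
      algLder F (fld N 1) * (![0, 1] : Fin 2 → ZN N (Alg N)) 1 = algLder F (fld N 1) := by
    simp only [Matrix.cons_val_zero, Matrix.cons_val_one, mul_zero, mul_one, zero_add]
  rw [mul_one_div_cancel two_ne_zero, one_smul] at h3
  rw [hD.smul, h4]
  exact h3

end ExpV

/-! ### Evolutionary vector fields -/

section Flows

variable {N : ℕ} [NeZero N]

/-- The values of the evolutionary vector field on the jet variables, at order `p` in `ε`. -/
def evolJet (X : Fin 2 → ZN N (Alg N)) (p : ℕ) (j : Jet N) : DiffPoly N :=
  PowerSeries.coeff p ((dx N)^[j.2.2] ((X j.1).coeff j.2.1))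

theorem coeff_evol0 (X : Fin 2 → ZN N (Alg N)) (p : ℕ) (f : DiffPoly N) :
    PowerSeries.coeff p (evol0 N X f) = lderG (evolJet X p) f := by
  unfold evol0 lderG
  obtain ⟨s, hs⟩ := exists_pd0_eq_zero f
  rw [finsum_eq_sum_of_support_subset (s := s), finsum_eq_sum_of_support_subset (s := s), map_sum]
  · exact sum_congr rfl fun j _ => PowerSeries.coeff_C_mul _ _ _
  · intro j hj
    by_contra h
    exact hj (by beta_reduce; rw [hs j h, zero_mul])
  · intro j hj
    by_contra h
    exact hj (by beta_reduce; rw [hs j h, map_zero, zero_mul])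

theorem coeff_evol (X : Fin 2 → ZN N (Alg N)) (n : ℕ) (f : Alg N) :
    PowerSeries.coeff n (evol N X f) =
      ∑ p ∈ antidiagonal n, lderG (evolJet X p.1) (PowerSeries.coeff p.2 f) := by
  rw [evol, PowerSeries.coeff_mk]
  exact sum_congr rfl fun p _ => coeff_evol0 _ _ _

/-- Up to a given order in `ε` the vector field is a finite sum of derivations `ε^p D_p`; this
transfers the Leibniz rule to it. -/
theorem coeff_evol_eq_sum (X : Fin 2 → ZN N (Alg N)) {n m : ℕ} (hnm : n ≤ m) (f : Alg N) :
    PowerSeries.coeff n (evol N X f) = PowerSeries.coeff n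
      (∑ p ∈ range (m + 1), PowerSeries.X ^ p * psMap (lderG (evolJet X p)) f) := by
  rw [coeff_evol, map_sum, Finset.Nat.sum_antidiagonal_eq_sum_range_succ
    (fun a b => lderG (evolJet X a) (PowerSeries.coeff b f)) n]
  rw [← sum_subset (range_subset_range.2 (Nat.succ_le_succ hnm))]
  · refine sum_congr rfl fun p hp => ?_
    rw [PowerSeries.coeff_X_pow_mul', if_pos (Nat.lt_succ_iff.1 (mem_range.1 hp)), coeff_psMap]
  · intro p _ hp
    rw [mem_range] at hp
    rw [PowerSeries.coeff_X_pow_mul', if_neg (by omega)]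

theorem IsDer.sumDer {R : Type*} [CommRing R] [Algebra ℂ R] {ι : Type*} {s : Finset ι}
    {D : ι → R → R} (hD : ∀ i, IsDer (D i)) : IsDer fun x => ∑ i ∈ s, D i x where
  add x y := by simp only [(hD _).add, sum_add_distrib]
  smul c x := by simp only [(hD _).smul, smul_sum]
  mul x y := by simp only [(hD _).mul, sum_add_distrib, sum_mul, mul_sum]

theorem isDer_evol (X : Fin 2 → ZN N (Alg N)) : IsDer (evol N X) := by
  have hE : ∀ m, IsDer fun f : Alg N =>
      ∑ p ∈ range (m + 1), PowerSeries.X ^ p * psMap (lderG (evolJet X p)) f := fun m =>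
    IsDer.sumDer fun p => (isDer_psMap (isDer_lderG _)).smulDer _
  refine ⟨fun x y => PowerSeries.ext fun n => ?_, fun c x => PowerSeries.ext fun n => ?_,
    fun x y => PowerSeries.ext fun n => ?_⟩
  · rw [coeff_evol_eq_sum X le_rfl, (hE n).add, map_add, map_add, ← coeff_evol_eq_sum X le_rfl,
      ← coeff_evol_eq_sum X le_rfl]
  · rw [coeff_evol_eq_sum X le_rfl, (hE n).smul, PowerSeries.coeff_smul, PowerSeries.coeff_smul,
      ← coeff_evol_eq_sum X le_rfl]
  · rw [coeff_evol_eq_sum X le_rfl, (hE n).mul, map_add, map_add, PowerSeries.coeff_mul,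
      PowerSeries.coeff_mul, PowerSeries.coeff_mul, PowerSeries.coeff_mul]
    exact congrArg₂ (· + ·)
      (sum_congr rfl fun p hp => by rw [← coeff_evol_eq_sum X (Nat.le.intro (HasAntidiagonal.mem_antidiagonal.1 hp))])
      (sum_congr rfl fun p hp => by rw [← coeff_evol_eq_sum X (Nat.le.intro ((add_comm _ _).trans (HasAntidiagonal.mem_antidiagonal.1 hp)))])

theorem evol_C (X : Fin 2 → ZN N (Alg N)) (f : DiffPoly N) (n : ℕ) :
    PowerSeries.coeff n (evol N X (PowerSeries.C f)) = lderG (evolJet X n) f := by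
  rw [coeff_evol, sum_eq_single (n, 0)]
  · rw [PowerSeries.coeff_zero_C]
  · rintro ⟨a, b⟩ hp hne
    have hab : a + b = n := mem_antidiagonal.1 hp
    have hb : b ≠ 0 := fun h => hne (by simp only [Prod.mk.injEq]; omega)
    rw [PowerSeries.coeff_C, if_neg hb, (isDer_lderG _).zero]
  · intro h
    exact absurd (mem_antidiagonal.2 (add_zero n)) h

theorem evol_fld (X : Fin 2 → ZN N (Alg N)) (w : Fin 2) (i : Fin N) :
    evol N X ((fld N w).coeff i) = (X w).coeff i := by
  ext1 n
  rw [fld, evol_C, lderG_X]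
  rfl

theorem evol_T (X : Fin 2 → ZN N (Alg N)) :
    evol N X (PowerSeries.C (LaurentPolynomial.T 1)) =
      PowerSeries.C (LaurentPolynomial.T 1) * (X 1).coeff 0 := by
  ext1 n
  rw [evol_C, lderG_T, PowerSeries.coeff_C_mul]
  rfl

theorem zevol_fld (X : Fin 2 → ZN N (Alg N)) (w : Fin 2) :
    ZN.map (evol N X) (fld N w) = X w :=
  ZN.ext (funext fun i => evol_fld X w i)

theorem zevol_expV (X : Fin 2 → ZN N (Alg N)) :
    ZN.map (evol N X) (expV N) = expV N * X 1 := by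
  rw [der_expV (isDer_evol X), zevol_fld]
  rw [evol_T]
  congr 1
  exact (evol_fld X 1 0).symm

theorem lderG_linear (c d : ℂ) (G G' : Jet N → DiffPoly N) (f : DiffPoly N) :
    lderG (fun j => c • G j + d • G' j) f = c • lderG G f + d • lderG G' f := by
  unfold lderG
  rw [smul_finsum' c (finite_support_pd0 f G), smul_finsum' d (finite_support_pd0 f G'),
    ← finsum_add_distrib (f := fun j => c • (pd0 N j f * G j)) (g := fun j => d • (pd0 N j f * G' j))
      ((finite_support_pd0 f G).subset (Function.support_const_smul_subset c _))
      ((finite_support_pd0 f G').subset (Function.support_const_smul_subset d _))]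
  exact finsum_congr fun j => by rw [mul_add, mul_smul_comm, mul_smul_comm]

theorem evol_linear (c d : ℂ) (X Y : Fin 2 → ZN N (Alg N)) (f : Alg N) :
    evol N (c • X + d • Y) f = c • evol N X f + d • evol N Y f := by
  ext1 n
  have h1 : ∀ p, evolJet (c • X + d • Y) p = fun j => c • evolJet X p j + d • evolJet Y p j := by
    intro p
    funext j
    have h2 : ((c • X + d • Y) j.1).coeff j.2.1 =
        c • (X j.1).coeff j.2.1 + d • (Y j.1).coeff j.2.1 := rfl
    have h3 := isDer_dx (N := N) |>.iterate j.2.2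
    unfold evolJet
    rw [h2, h3.1, h3.2, h3.2, map_add, PowerSeries.coeff_smul, PowerSeries.coeff_smul]
  rw [map_add, PowerSeries.coeff_smul, PowerSeries.coeff_smul, coeff_evol, coeff_evol, coeff_evol,
    smul_sum, smul_sum, ← sum_add_distrib]
  exact sum_congr rfl fun p _ => by rw [h1, lderG_linear]

theorem evol_zero (f : Alg N) : evol N 0 f = 0 := by
  have h := evol_linear 0 0 (0 : Fin 2 → ZN N (Alg N)) 0 f
  simpa using h

/-! ## Division by `ε` -/

theorem zdivEps_linear (c d : ℂ) (x y : ZN N (Alg N)) :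
    zdivEps N (c • x + d • y) = c • zdivEps N x + d • zdivEps N y := by
  refine ZN.ext (funext fun i => PowerSeries.ext fun n => ?_)
  simp [zdivEps, divEps]

theorem coeff_zero_shift (m : ℤ) (f : Alg N) :
    PowerSeries.coeff 0 (shift N m f) = PowerSeries.coeff 0 f := by
  simp [shift]

theorem eq_zdivEps_iff (x : ZN N (Alg N)) {y : ZN N (Alg N)}
    (hy : ∀ i, PowerSeries.coeff 0 (y.coeff i) = 0) :
    x = zdivEps N y ↔ (PowerSeries.X : Alg N) • x = y := by
  have h1 : (PowerSeries.X : Alg N) • zdivEps N y = y :=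
    ZN.ext (funext fun i => X_mul_divEps _ (by
      rw [← PowerSeries.coeff_zero_eq_constantCoeff_apply]; exact hy i))
  constructor
  · rintro rfl
    exact h1
  · intro h
    refine ZN.ext (funext fun i => ?_)
    rw [← h1] at h
    have h2 := congrArg (fun z => z.coeff i) h
    simp only [ZN.coeff_smul, smul_eq_mul] at h2
    exact PowerSeries.X_mul_inj.1 h2

theorem coeff_zero_zshift_sub (m : ℤ) (x : ZN N (Alg N)) (i : Fin N) :
    PowerSeries.coeff 0 ((zshift N m x - x).coeff i) = 0 := by
  rw [ZN.coeff_sub, map_sub, zshift, ZN.coeff_map, coeff_zero_shift, sub_self]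

/-! ## The Lax equations -/

theorem lax_comp (A : DOp (ZN N (Alg N))) (n : ℤ) :
    opComp N (lax N) A n = zshift N 1 (A (n - 1)) + fld N 0 * A n +
      expV N * zshift N (-1) (A (n + 1)) := by
  have hs := isShift_zshift (N := N)
  have hf : ∀ (a : ZN N (Alg N)) (m : ℤ), DOp.Summable (DOp.mono a m) A := fun a m =>
    (DOp.isFin_mono a m).summable_left A
  have h1 : DOp.IsFin (DOp.mono (1 : ZN N (Alg N)) 1 + DOp.mono (fld N 0) 0) :=
    (DOp.isFin_mono _ _).add (DOp.isFin_mono _ _)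
  rw [opComp, lax, DOp.add_comp hs (h1.summable_left A) (hf _ _), DOp.add_comp hs (hf _ _) (hf _ _),
    Pi.add_apply, Pi.add_apply, DOp.mono_comp hs, DOp.mono_comp hs, DOp.mono_comp hs, one_mul,
    hs.zero_apply, sub_zero, sub_neg_eq_add]

theorem comp_lax (A : DOp (ZN N (Alg N))) (n : ℤ) :
    opComp N A (lax N) n = A (n - 1) + A n * zshift N n (fld N 0) +
      A (n + 1) * zshift N (n + 1) (expV N) := by
  have hs := isShift_zshift (N := N)
  have hf : ∀ (a : ZN N (Alg N)) (m : ℤ), DOp.Summable A (DOp.mono a m) := fun a m =>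
    (DOp.isFin_mono a m).summable_right A
  have h1 : DOp.IsFin (DOp.mono (1 : ZN N (Alg N)) 1 + DOp.mono (fld N 0) 0) :=
    (DOp.isFin_mono _ _).add (DOp.isFin_mono _ _)
  rw [opComp, lax, DOp.comp_add hs (h1.summable_right A) (hf _ _), DOp.comp_add hs (hf _ _) (hf _ _),
    Pi.add_apply, Pi.add_apply, DOp.comp_mono hs, DOp.comp_mono hs, DOp.comp_mono hs,
    (hs.hom _).one, mul_one, sub_zero, sub_neg_eq_add]

theorem CommutesLax.coeff_eq {B : DOp (ZN N (Alg N))} (hB : CommutesLax B) (n : ℤ) :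
    zshift N 1 (B (n - 1)) + fld N 0 * B n + expV N * zshift N (-1) (B (n + 1)) =
      B (n - 1) + B n * zshift N n (fld N 0) + B (n + 1) * zshift N (n + 1) (expV N) :=
  (EZTH.lax_comp B n).symm.trans ((congrFun hB n).trans (comp_lax B n))

theorem zshift_expV_mul (x : ZN N (Alg N)) :
    zshift N 1 (expV N * zshift N (-1) x) = zshift N 1 (expV N) * x := by
  have hs := isShift_zshift (N := N)
  rw [(hs.hom 1).mul, ← hs.comp, add_neg_cancel, hs.zero_apply]

/-- This is coefficient `0` of `[L, B] = 0`. It expresses the flow of `u`, which involves `B_(-1)`,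
through the `v`-gradient, which involves `B_1`. -/
theorem CommutesLax.shift_sub {B : DOp (ZN N (Alg N))} (hB : CommutesLax B) :
    zshift N 1 (B (-1)) - B (-1) =
      zshift N 1 (expV N * zshift N (-1) (B 1)) - expV N * zshift N (-1) (B 1) := by
  have h1 := hB.coeff_eq 0
  rw [zshift_expV_mul]
  rw [isShift_zshift.zero_apply, zero_sub, zero_add] at h1
  linear_combination h1

/-- By definition `[B_+, L]` has no powers below `-1`, and as `-[B_-, L]` it has none above `0`. The
two remaining coefficients determine the flow because `e^v` is invertible. -/
theorem isLaxFlow_iff {B : DOp (ZN N (Alg N))} (hB : CommutesLax B) (X : Fin 2 → ZN N (Alg N)) :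
    IsLaxFlow N X B ↔ (PowerSeries.X : Alg N) • X 0 = zshift N 1 (B (-1)) - B (-1) ∧
      (PowerSeries.X : Alg N) • X 1 = B 0 - zshift N (-1) (B 0) := by
  have hs := isShift_zshift (N := N)
  have hD := ZN.isDer_map (N := N) (isDer_evol X)
  have hE : ∀ n : ℤ, ZN.map (evol N X) (lax N n) =
      if n = 0 then X 0 else if n = -1 then expV N * X 1 else 0 := by
    intro n
    rw [lax, Pi.add_apply, Pi.add_apply, hD.add, hD.add]
    unfold DOp.mono
    by_cases h0 : n = 0
    · subst h0
      simp [hD.zero, zevol_fld]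
    by_cases h1 : n = 1
    · subst h1
      simp [hD.zero, hD.one]
    by_cases h2 : n = -1
    · subst h2
      simp [hD.zero, zevol_expV]
    · simp [h0, h1, h2, hD.zero]
  have hR : ∀ n : ℤ, opComp N B.pos (lax N) n - opComp N (lax N) B.pos n =
      if n = 0 then zshift N 1 (B (-1)) - B (-1)
      else if n = -1 then expV N * (B 0 - zshift N (-1) (B 0)) else 0 := by
    intro n
    have hz : ∀ m, zshift N m 0 = 0 := fun m => (hs.hom m).zero
    rw [lax_comp, comp_lax]
    unfold DOp.pos
    by_cases h0 : n = 0
    · subst h0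
      have := hB.coeff_eq 0
      rw [zero_sub] at this
      simp only [zero_sub, zero_add, show ¬ ((0 : ℤ) ≤ -1) by norm_num, show (0 : ℤ) ≤ 1 by norm_num,
        le_refl, if_true, if_false, hz]
      rw [zero_add] at this
      linear_combination -this
    by_cases h2 : n = -1
    · subst h2
      simp only [show ¬ ((0 : ℤ) ≤ -1 - 1) by norm_num, show ¬ ((0 : ℤ) ≤ -1) by norm_num,
        neg_add_cancel, le_refl, if_true, if_false, hz, hs.zero_apply, if_neg h0]
      ring
    · rw [if_neg h0, if_neg h2]
      by_cases h3 : 0 ≤ n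
      · rw [if_pos (by omega), if_pos (by omega), if_pos (by omega)]
        linear_combination -hB.coeff_eq n
      · rw [if_neg (by omega), if_neg (by omega), if_neg (by omega)]
        simp only [hz]
        ring
  unfold IsLaxFlow
  simp only [hE, hR]
  constructor
  · intro h
    refine ⟨by simpa using h 0, ?_⟩
    have h1 := h (-1)
    simp only [show ¬ ((-1 : ℤ) = 0) by norm_num, if_true, if_false] at h1
    rw [← ZN.mul_smul'] at h1
    exact isUnit_expV.mul_left_cancel h1
  · rintro ⟨h1, h2⟩ n
    split_ifs
    · exact h1
    · rw [← ZN.mul_smul', h2]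
    · exact smul_zero _

/-- The Lax equation is the Hamiltonian equation for the first Poisson structure. -/
theorem isLaxFlow_iff_poisson1 {B : DOp (ZN N (Alg N))} (hB : CommutesLax B)
    (X : Fin 2 → ZN N (Alg N)) :
    IsLaxFlow N X B ↔ X = poisson1 N (gradOp B 0) (gradOp B 1) := by
  have h0 : X = poisson1 N (gradOp B 0) (gradOp B 1) ↔
      X 0 = zdivEps N (zshift N 1 (gradOp B 1) - gradOp B 1) ∧
        X 1 = zdivEps N (gradOp B 0 - zshift N (-1) (gradOp B 0)) := by
    constructor
    · intro h
      rw [h]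
      exact ⟨rfl, rfl⟩
    · rintro ⟨h1, h2⟩
      funext w
      fin_cases w
      · exact h1
      · exact h2
  rw [h0, isLaxFlow_iff hB, eq_zdivEps_iff _ (coeff_zero_zshift_sub _ _), eq_zdivEps_iff, hB.shift_sub]
  · rfl
  · intro i
    have := coeff_zero_zshift_sub (-1) (gradOp B 0) i
    rw [ZN.coeff_sub, map_sub, sub_eq_zero] at this ⊢
    exact this.symm

/-! ## The recursion relations -/

/-- The products `L B` and `B L` agree, so each coefficient of `L B` has two expressions. Choosing
them suitably for the coefficients `0` and `1` makes the two Poisson operators coincide. -/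
theorem poisson2_gradOp {B : DOp (ZN N (Alg N))} (hB : CommutesLax B) :
    poisson2 N (gradOp B 0) (gradOp B 1) =
      poisson1 N (gradOp (opComp N (lax N) B) 0) (gradOp (opComp N (lax N) B) 1) := by
  have hs := isShift_zshift (N := N)
  have h1 := hB.shift_sub
  have h2 := hB.coeff_eq 1
  -- The shifted coefficient `1` of `[L, B] = 0` writes `Λ⁻¹((L B)_1)` in the form coming from `B
  -- L`.
  have h3 := congrArg (zshift N (-1)) h2
  rw [(hs.hom _).add, (hs.hom _).add, (hs.hom _).mul, (hs.hom _).mul, (hs.hom _).add, (hs.hom _).add,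
    (hs.hom _).mul, (hs.hom _).mul] at h3
  have e1 : ∀ x, zshift N (-1) (zshift N 1 x) = x := fun x => by
    rw [← hs.comp, neg_add_cancel, hs.zero_apply]
  have e2 : zshift N (-1) (zshift N (1 + 1) (expV N)) = zshift N 1 (expV N) := by
    rw [← hs.comp, neg_add_cancel_left]
  rw [e1, e1, e2, sub_self] at h3
  unfold poisson1 poisson2
  have hc0 : opComp N (lax N) B 0 = zshift N 1 (B (-1)) + fld N 0 * B 0 +
      expV N * zshift N (-1) (B 1) := by rw [lax_comp, zero_sub, zero_add]
  have hc1 : opComp N (lax N) B 1 = zshift N 1 (B 0) + fld N 0 * B 1 +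
      expV N * zshift N (-1) (B (1 + 1)) := by rw [lax_comp, sub_self]
  have hc1s : zshift N (-1) (opComp N (lax N) B 1) = zshift N (-1) (B 0) +
      zshift N (-1) (B 1) * fld N 0 + zshift N (-1) (B (1 + 1)) * zshift N 1 (expV N) := by
    rw [hc1, (hs.hom _).add, (hs.hom _).add, (hs.hom _).mul, (hs.hom _).mul, e1, h3]
  have k0 : zshift N 1 (expV N * B 0) - expV N * zshift N (-1) (B 0) + fld N 0 *
      (zshift N 1 (expV N * zshift N (-1) (B 1)) - expV N * zshift N (-1) (B 1)) =
      zshift N 1 (expV N * zshift N (-1) (opComp N (lax N) B 1)) -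
        expV N * zshift N (-1) (opComp N (lax N) B 1) := by
    rw [zshift_expV_mul, zshift_expV_mul, hc1s, hc1, (hs.hom _).mul]
    ring
  have k1 : fld N 0 * B 0 - zshift N (-1) (fld N 0 * B 0) +
      (zshift N 1 (expV N * zshift N (-1) (B 1)) - zshift N (-1) (expV N * zshift N (-1) (B 1))) =
      opComp N (lax N) B 0 - zshift N (-1) (opComp N (lax N) B 0) := by
    rw [hc0, (hs.hom (-1)).add, (hs.hom (-1)).add, e1]
    linear_combination -h1
  exact congrArg₂ (fun x y => ![zdivEps N x, zdivEps N y]) k0 k1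

theorem poisson1_linear (c d : ℂ) (B C : DOp (ZN N (Alg N))) :
    poisson1 N (gradOp (c • B + d • C) 0) (gradOp (c • B + d • C) 1) =
      c • poisson1 N (gradOp B 0) (gradOp B 1) + d • poisson1 N (gradOp C 0) (gradOp C 1) := by
  have hs := isShift_zshift (N := N)
  have hg : ∀ w, gradOp (c • B + d • C) w = c • gradOp B w + d • gradOp C w := by
    intro w
    fin_cases w
    · rfl
    · change expV N * zshift N (-1) (c • B 1 + d • C 1) = _
      rw [(hs.hom _).add, (hs.hom _).smul, (hs.hom _).smul, mul_add, mul_smul_comm, mul_smul_comm]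
      rfl
  rw [hg, hg]
  funext w
  fin_cases w
  · change zdivEps N _ = c • zdivEps N _ + d • zdivEps N _
    rw [← zdivEps_linear, (hs.hom _).add, (hs.hom _).smul, (hs.hom _).smul]
    congr 1
    module
  · change zdivEps N _ = c • zdivEps N _ + d • zdivEps N _
    rw [← zdivEps_linear, (hs.hom _).add, (hs.hom _).smul, (hs.hom _).smul]
    congr 1
    module

/-- The Hamiltonian vector field with gradient `gradOp B`, for the first bracket. -/
def field1 (B : DOp (ZN N (Alg N))) (f : Alg N) : Alg N :=
  evol N (poisson1 N (gradOp B 0) (gradOp B 1)) f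

theorem field1_linear (c d : ℂ) (B C : DOp (ZN N (Alg N))) (f : Alg N) :
    field1 (c • B + d • C) f = c • field1 B f + d • field1 C f := by
  unfold field1
  rw [poisson1_linear, evol_linear]

theorem field1_smul (c : ℂ) (B : DOp (ZN N (Alg N))) (f : Alg N) :
    field1 (c • B) f = c • field1 B f := by
  have := field1_linear c 0 B 0 f
  simpa using this

theorem commutesLax_flowOp {W : DOp (ZN N (Alg N))} (hW : IsLogLax N W) (k : Fin 2) (j : ℕ) :
    CommutesLax (flowOp N W k j) := by
  unfold flowOp
  split_ifs
  · exact (commutesLax_laxPow _).smul _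
  · exact (commutesLax_laxLog hW _).smul _

variable {W : DOp (ZN N (Alg N))}

theorem bracket1_ham_zero (W : DOp (ZN N (Alg N))) (j : ℕ) (f : Alg N) :
    bracket1 N f (hamDensity N W 0 j) = field1 (((j.factorial : ℂ)⁻¹) • laxPow N j) f := by
  unfold bracket1 field1
  rw [grad_ham_zero, grad_ham_zero]

theorem bracket1_ham_one (hW : IsLogLax N W) (j : ℕ) (f : Alg N) :
    bracket1 N f (hamDensity N W 1 (j + 1)) =
      field1 ((2 / (j.factorial : ℂ)) • laxLog N W j) f := by
  unfold bracket1 field1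
  rw [grad_ham_one_succ hW, grad_ham_one_succ hW]

theorem bracket1_ham_succ (hW : IsLogLax N W) (k : Fin 2) (j : ℕ) (w : Fin 2) (i : Fin N) :
    bracket1 N ((fld N w).coeff i) (hamDensity N W k (j + 1)) =
      (poisson1 N (gradOp (flowOp N W k j) 0) (gradOp (flowOp N W k j) 1) w).coeff i := by
  unfold bracket1
  rw [grad_ham_succ hW, grad_ham_succ hW, evol_fld]

/-- The recursion relation for the powers of `L`. -/
theorem recursion_zero (W : DOp (ZN N (Alg N))) (n : ℕ) (f : Alg N) :
    bracket2 N f (hamDensity N W 0 n) =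
      ((n : ℂ) + 1) • bracket1 N f (hamDensity N W 0 (n + 1)) := by
  unfold bracket2
  rw [grad_ham_zero, grad_ham_zero, poisson2_gradOp ((commutesLax_laxPow n).smul _),
    bracket1_ham_zero, ← field1_smul, smul_smul, opComp_smul_right isFin_lax]
  have h := smul_factorial n 1
  rw [one_div, one_div] at h
  rw [mul_comm, h]
  rfl

/-- The gradient is the constant `(1, 0)`, which the difference operators in the first bracket
annihilate. -/
theorem field1_one (f : Alg N) : field1 (laxPow N 0) f = 0 := by
  have hs := isShift_zshift (N := N)
  have h0 : gradOp (laxPow N 0) 0 = 1 := rfl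
  have h1 : gradOp (laxPow N 0) 1 = 0 := by
    change expV N * zshift N (-1) 0 = 0
    rw [(hs.hom _).zero, mul_zero]
  have h2 : zdivEps N (0 : ZN N (Alg N)) = 0 := by simpa using zdivEps_linear 0 0 (0 : ZN N (Alg N)) 0
  unfold field1
  rw [h0, h1]
  have h3 : poisson1 N (1 : ZN N (Alg N)) 0 = 0 := by
    unfold poisson1
    rw [(hs.hom _).zero, (hs.hom _).one, sub_self, sub_self, h2]
    funext w
    fin_cases w <;> rfl
  rw [h3, evol_zero]

/-- The recursion relation for the logarithmic Hamiltonians. -/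
theorem recursion_one (hW : IsLogLax N W) (n : ℕ) (f : Alg N) :
    bracket2 N f (hamDensity N W 1 n) =
      (n : ℂ) • bracket1 N f (hamDensity N W 1 (n + 1)) +
        (2 : ℂ) • bracket1 N f (hamDensity N W 0 n) := by
  cases n with
  | zero =>
    -- Here the gradient is `(0, 1)`, which the second Poisson operator annihilates. On the right
    -- one term has the factor `0` and the other is the vanishing field of the identity operator.
    have hs := isShift_zshift (N := N)
    have h2 : zdivEps N (0 : ZN N (Alg N)) = 0 := by
      simpa using zdivEps_linear 0 0 (0 : ZN N (Alg N)) 0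
    have h3 : poisson2 N (0 : ZN N (Alg N)) 1 = 0 := by
      unfold poisson2
      rw [(hs.hom _).one, (hs.hom _).one, mul_zero, mul_zero, (hs.hom _).zero, (hs.hom _).zero,
        mul_zero, sub_self, sub_self, mul_zero, add_zero, h2]
      funext w
      fin_cases w <;> rfl
    unfold bracket2
    rw [grad_ham_one_zero hW, grad_ham_one_zero hW, bracket1_ham_zero, Nat.factorial_zero,
      field1_smul, field1_one]
    simp only [Matrix.cons_val_zero, Matrix.cons_val_one]
    rw [h3, evol_zero, Nat.cast_zero, zero_smul, smul_zero, smul_zero, add_zero]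
  | succ m =>
    unfold bracket2
    rw [grad_ham_one_succ hW, grad_ham_one_succ hW,
      poisson2_gradOp ((commutesLax_laxLog hW m).smul _), bracket1_ham_one hW, bracket1_ham_zero,
      ← field1_linear, opComp_smul_right isFin_lax, lax_comp_laxLog]
    -- This is `L B_{1,m} = (m + 1) B_{1,m+1} + 2 B_{0,m}`; the summand with `1 / (m + 1)` is the
    -- jump from `c_m` to `c_(m+1)`.
    have h : (2 / (m.factorial : ℂ)) • (laxLog N W (m + 1) +
        (1 / ((m : ℂ) + 1)) • laxPow N (m + 1)) =
        ((m + 1 : ℕ) : ℂ) • (2 / ((m + 1).factorial : ℂ)) • laxLog N W (m + 1) +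
          (2 : ℂ) • (((m + 1).factorial : ℂ)⁻¹) • laxPow N (m + 1) := by
      have h1 : (m : ℂ) + 1 ≠ 0 := by exact_mod_cast m.succ_ne_zero
      have h2 : ((m + 1).factorial : ℂ) ≠ 0 := by exact_mod_cast (m + 1).factorial_ne_zero
      rw [← smul_factorial m 2, smul_add, smul_smul, smul_smul, smul_smul]
      push_cast
      congr 2
      · ring
      · field_simp
    rw [h]
    rfl

end Flows

end EZTH

end

/-! ### The main theorem -/

theorem mainTheorem5 (N : ℕ) [NeZero N] :
    (∃! W : EZTH.DOp (EZTH.ZN N (EZTH.Alg N)), EZTH.IsLogLax N W) ∧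
    ∀ W : EZTH.DOp (EZTH.ZN N (EZTH.Alg N)), EZTH.IsLogLax N W →
      (∀ (k : Fin 2) (j : ℕ) (X : Fin 2 → EZTH.ZN N (EZTH.Alg N)),
        EZTH.IsLaxFlow N X (EZTH.flowOp N W k j) ↔
          ∀ i : Fin N,
            (X 0).coeff i = EZTH.bracket1 N ((EZTH.fld N 0).coeff i) (EZTH.hamDensity N W k (j + 1)) ∧
            (X 1).coeff i = EZTH.bracket1 N ((EZTH.fld N 1).coeff i) (EZTH.hamDensity N W k (j + 1))) ∧
      (∀ (n : ℕ) (f : EZTH.Alg N),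
        EZTH.bracket2 N f (EZTH.hamDensity N W 1 n) =
          (n : ℂ) • EZTH.bracket1 N f (EZTH.hamDensity N W 1 (n + 1))
            + (2 : ℂ) • EZTH.bracket1 N f (EZTH.hamDensity N W 0 n)) ∧
      (∀ (n : ℕ) (f : EZTH.Alg N),
        EZTH.bracket2 N f (EZTH.hamDensity N W 0 n) =
          ((n : ℂ) + 1) • EZTH.bracket1 N f (EZTH.hamDensity N W 0 (n + 1))) := by
  refine ⟨EZTH.existsUnique_isLogLax, fun W hW => ⟨fun k j X => ?_,
    fun n f => EZTH.recursion_one hW n f, fun n f => EZTH.recursion_zero W n f⟩⟩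
  rw [EZTH.isLaxFlow_iff_poisson1 (EZTH.commutesLax_flowOp hW k j)]
  constructor
  · rintro rfl i
    exact ⟨(EZTH.bracket1_ham_succ hW k j 0 i).symm, (EZTH.bracket1_ham_succ hW k j 1 i).symm⟩
  · intro h
    funext w
    fin_cases w
    · exact EZTH.ZN.ext (funext fun i => (h i).1.trans (EZTH.bracket1_ham_succ hW k j 0 i))
    · exact EZTH.ZN.ext (funext fun i => (h i).2.trans (EZTH.bracket1_ham_succ hW k j 1 i))
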